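/- **Setting.** A promise problem is a pair $\mathcal I=(\mathcal I_{\rm yes},\mathcal I_{\rm no})$ of disjoint subsets of $\{0,1\}^*$. A *stoquastic verification circuit* with two witness registers of $\ell$ qubits each, $n_0$ ancillas initialized to $|0\rangle$ and $n_+$ ancillas initialized to $|+\rangle$ consists of X, CNOT and Toffoli gates, followed by a measurement of one designated output qubit in the Hadamard basis; it accepts on outcome $+$. A promise problem $\mathcal I$ is in $\mathsf{StoqMA}(2,c,s)$ if there is a polynomial-time computable map $x\mapsto V_x$ from strings to such circuits, where for all $x\in\mathcal I_{\rm yes}\cup\mathcal I_{\rm no}$ the proof length $\ell=\ell(|x|)$ depends only on $|x|$, such that * if $x\in\mathcal I_{\rm yes}$, some pair of $\ell$-qubit states $|\psi_1\rangle,|\psi_2\rangle$ with non-negative amplitudes satisfies $\Pr[V_x\text{ accepts }|\psi_1\rangle\otimes|\psi_2\rangle]\ge c(|x|)$; * if $x\in\mathcal I_{\rm no}$, every such pair satisfies $\Pr[V_x\text{ accepts }|\psi_1\rangle\otimes|\psi_2\rangle]\le s(|x|)$; where $1/2\le s(n)<c(n)\le 1$ for all $n$ and $c-s$ is at least an inverse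 polynomial. $\mathsf{StoqMA}_{\ell,r}(2,c,s)$ denotes the subclass in which the proof length is $\ell(|x|)$ and $n_+\le r(|x|)$ (for $x\in\mathcal I_{\rm yes}\cup\mathcal I_{\rm no}$), so $\mathsf{StoqMA}(2,c,s)=\bigcup_{\ell,r}\mathsf{StoqMA}_{\ell,r}(2,c,s)$. $\mathsf{StoqMA}(2)_1$ is the union of $\mathsf{StoqMA}(2,1,s)$ over all admissible $s$ (so $s\le 1-1/\mathrm{poly}$). A promise problem is in $\mathsf{PSPACE}$ if some language decidable by a deterministic polynomial-space Turing machine contains $\mathcal I_{\rm yes}$ and is disjoint from $\mathcal I_{\rm no}$. Polynomials below have natural-number coefficients. **Theorem.** 1. For every polynomial $q$ there is a polynomial $p$ such that for all functions $\ell,r:\mathbb N\to\mathbb N$ with $\ell,r\le q$ and all $\epsilon,s:\mathbb N\to\mathbb R$ with $\epsilon(n)\ge 0$ and $s(n)\ge 1/2$ for all $n$, and $$\epsilon(n)\le \exp(-\exp(p(n))),\qquad s(n)\le 1-\frac1{q(n)+1}\qquad\text{for all sufficiently large } n,$$ one has $\mathsf{StoqMA}_{\ell,r}(2,1-\epsilon,s)\subseteq\mathsf{PSPACE}$.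 2. Consequently, if $\epsilon\ge 0$ satisfies, for every polynomial $p$, $\epsilon(n)\le\exp(-\exp(p(n)))$ for all sufficiently large $n$, and if $s\ge 1/2$ and, for some polynomial $q$, $s(n)\le 1-1/(q(n)+1)$ for all sufficiently large $n$, then $\mathsf{StoqMA}(2,1-\epsilon,s)\subseteq\mathsf{PSPACE}$. 3. In particular, $\mathsf{StoqMA}(2)_1\subseteq\mathsf{PSPACE}$. -/

import Mathlib

open Filter

noncomputable section

/-! ### Promise problems and polynomial space -/

/-- A promise problem: two disjoint sets of binary strings. -/
structure PromiseProblem where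
  yes : Set (List Bool)
  no : Set (List Bool)
  disj : Disjoint yes no

/-- The number of cells used by a configuration of a (multi-stack) Turing machine: the total
length of its stacks. -/
def configSpace (tm : Turing.FinTM2) (c : tm.Cfg) : ℕ :=
  haveI := tm.kFin
  ∑ k : tm.K, (c.stk k).length

open Classical in
/-- The characteristic function of a language. -/
def charFun (L : Set (List Bool)) (x : List Bool) : Bool := decide (x ∈ L)

/-- A language is decidable in polynomial space: a deterministic Turing machine with finitely many
stacks over finite alphabets halts on every input `x`, with the one-symbol output that tells
whether `x ∈ L`, and every configuration that it visits has size at most `p |x|`. -/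
def LanguageInPSPACE (L : Set (List Bool)) : Prop :=
  ∃ (M : Turing.TM2ComputableAux Bool Bool) (p : Polynomial ℕ),
    (∀ k, Finite (M.tm.Γ k)) ∧
    ∀ x : List Bool,
      Nonempty (Turing.TM2Outputs M.tm (x.map M.inputAlphabet.symm)
        (some ([charFun L x].map M.outputAlphabet.symm))) ∧
      ∀ c : M.tm.Cfg,
        StateTransition.Reaches M.tm.step
          (Turing.initList M.tm (x.map M.inputAlphabet.symm)) c →
        configSpace M.tm c ≤ p.eval x.length

/-- The promise problems in `PSPACE`: those solved by a language in `PSPACE`. -/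
def PSPACE : Set PromiseProblem :=
  {I | ∃ L : Set (List Bool), LanguageInPSPACE L ∧ I.yes ⊆ L ∧ Disjoint I.no L}

/-! ### Stoquastic verification circuits -/

/-- The qubits of a verification circuit: `k` witness registers of `l` qubits each, then `n₀`
ancillas for `|0⟩`, then `n₁` ancillas for `|+⟩`. -/
abbrev Qubit (k l n₀ n₁ : ℕ) : Type := (Fin k × Fin l) ⊕ (Fin n₀ ⊕ Fin n₁)

/-- The gates X, CNOT and Toffoli on a set `Q` of qubits; the target is the last argument. -/
inductive StoqGate (Q : Type) : Type
  | x (t : Q)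
  | cnot (c t : Q) (h : c ≠ t)
  | toffoli (c₁ c₂ t : Q) (h₁₂ : c₁ ≠ c₂) (h₁ : c₁ ≠ t) (h₂ : c₂ ≠ t)

/-- The action of a gate on computational basis states. -/
def StoqGate.act {Q : Type} [DecidableEq Q] : StoqGate Q → (Q → Bool) → (Q → Bool)
  | .x t, b => Function.update b t (!(b t))
  | .cnot c t _, b => Function.update b t (xor (b t) (b c))
  | .toffoli c₁ c₂ t _ _ _, b => Function.update b t (xor (b t) (b c₁ && b c₂))

/-- A stoquastic verification circuit with `k` witness registers: a list of gates, applied from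
left to right, and the output qubit, which is finally measured in the Hadamard basis. -/
structure StoqCircuit (k : ℕ) where
  /-- number of qubits of each of the `k` witness registers -/
  proofLen : ℕ
  /-- number of ancillas initialized to `|0⟩` -/
  zeros : ℕ
  /-- number of ancillas initialized to `|+⟩` -/
  pluses : ℕ
  gates : List (StoqGate (Qubit k proofLen zeros pluses))
  out : Qubit k proofLen zeros pluses

/-- A non-negative (pure) state on `l` qubits: non-negative amplitudes, norm one. -/
structure NonnegState (l : ℕ) where
  amp : (Fin l → Bool) → ℝ
  nonneg : ∀ b, 0 ≤ amp b
  norm_one : ∑ b, amp b ^ 2 = 1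

namespace StoqCircuit

variable {k : ℕ} (C : StoqCircuit k)

/-- The qubits of the circuit. -/
abbrev Q : Type := Qubit k C.proofLen C.zeros C.pluses

/-- The permutation of the computational basis states which the gates implement. -/
def act (b : C.Q → Bool) : C.Q → Bool :=
  C.gates.foldl (fun b g => g.act b) b

/-- The amplitudes of the initial state `|ψ₁⟩ ⊗ ⋯ ⊗ |ψₖ⟩ ⊗ |0⋯0⟩ ⊗ |+⋯+⟩`. -/
def initAmp (ψ : Fin k → NonnegState C.proofLen) (b : C.Q → Bool) : ℝ :=
  (∏ j, (ψ j).amp fun i => b (.inl (j, i))) *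
    (if ∀ i, b (.inr (.inl i)) = false then 1 else 0) * (1 / √2) ^ C.pluses

/-- The amplitudes of the state after the gates: the linear extension of `|a⟩ ↦ |act a⟩`. -/
def finalAmp (ψ : Fin k → NonnegState C.proofLen) (b : C.Q → Bool) : ℝ :=
  ∑ a : C.Q → Bool, if C.act a = b then C.initAmp ψ a else 0

/-- The probability of the outcome `+` on the output qubit: the squared norm of the projection
by `|+⟩⟨+|` on the output qubit, which averages the amplitudes of `b` and of `b` with the output
bit flipped. -/
def acceptProb (ψ : Fin k → NonnegState C.proofLen) : ℝ :=
  ∑ b : C.Q → Bool,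
    ((C.finalAmp ψ b + C.finalAmp ψ (Function.update b C.out (!(b C.out)))) / 2) ^ 2

/-! ### Circuits as binary strings

All numbers are written in unary, so that the length of the string is polynomially equivalent to
the size of the circuit, its number of qubits included. -/

/-- Self-delimiting unary code of a number. -/
def unaryCode (m : ℕ) : List Bool := List.replicate m true ++ [false]

/-- Code of a qubit. -/
def qubitCode {k l n₀ n₁ : ℕ} : Qubit k l n₀ n₁ → List Bool
  | .inl (j, i) => unaryCode 0 ++ unaryCode j ++ unaryCode i
  | .inr (.inl i) => unaryCode 1 ++ unaryCode i
  | .inr (.inr i) => unaryCode 2 ++ unaryCode i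

/-- Code of a gate. -/
def gateCode {k l n₀ n₁ : ℕ} : StoqGate (Qubit k l n₀ n₁) → List Bool
  | .x t => unaryCode 0 ++ qubitCode t
  | .cnot c t _ => unaryCode 1 ++ qubitCode c ++ qubitCode t
  | .toffoli c₁ c₂ t _ _ _ => unaryCode 2 ++ qubitCode c₁ ++ qubitCode c₂ ++ qubitCode t

/-- Code of a circuit. -/
def code : List Bool :=
  unaryCode C.proofLen ++ unaryCode C.zeros ++ unaryCode C.pluses ++ qubitCode C.out ++
    C.gates.flatMap gateCode

end StoqCircuit

/-! ### The classes `StoqMA(k)` -/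

/-- A stoquastic verifier is a polynomial-time computable map from inputs to (descriptions of)
verification circuits. -/
def IsPolyTimeVerifier {k : ℕ} (V : List Bool → StoqCircuit k) : Prop :=
  Nonempty (Turing.TM2ComputableInPolyTime (id : List Bool → List Bool) StoqCircuit.code V)

/-- The verifier `V` solves the promise problem `I` with completeness `c` and soundness `s`, as
functions of the input length. -/
def Verifies {k : ℕ} (V : List Bool → StoqCircuit k) (c s : ℕ → ℝ) (I : PromiseProblem) : Prop :=
  (∀ x ∈ I.yes, ∃ ψ : Fin k → NonnegState (V x).proofLen, c x.length ≤ (V x).acceptProb ψ) ∧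
  (∀ x ∈ I.no, ∀ ψ : Fin k → NonnegState (V x).proofLen, (V x).acceptProb ψ ≤ s x.length)

/-- The requirement on thresholds: `1/2 ≤ s < c ≤ 1` with an inverse polynomial gap. -/
def IsThresholdPair (c s : ℕ → ℝ) : Prop :=
  (∀ n, 1 / 2 ≤ s n ∧ s n < c n ∧ c n ≤ 1) ∧
    ∃ g : Polynomial ℕ, ∀ n, 1 / (((g.eval n : ℕ) : ℝ) + 1) ≤ c n - s n

/-- `StoqMA(k, c, s)` with proofs of length `l n` and at most `r n` ancillas `|+⟩` on inputs of
length `n`. -/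
def StoqMAWith (k : ℕ) (l r : ℕ → ℕ) (c s : ℕ → ℝ) : Set PromiseProblem :=
  {I | IsThresholdPair c s ∧ ∃ V : List Bool → StoqCircuit k, IsPolyTimeVerifier V ∧
    (∀ x ∈ I.yes ∪ I.no, (V x).proofLen = l x.length ∧ (V x).pluses ≤ r x.length) ∧
    Verifies V c s I}

/-- `StoqMA(k, c, s)`; polynomial time bounds the proof length and the number of ancillas. -/
def StoqMA (k : ℕ) (c s : ℕ → ℝ) : Set PromiseProblem :=
  {I | ∃ l r : ℕ → ℕ, I ∈ StoqMAWith k l r c s}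

/-- `StoqMA(k)₁`: perfect completeness, and any soundness parameter with inverse polynomial gap. -/
def StoqMAPerfect (k : ℕ) : Set PromiseProblem :=
  {I | ∃ s : ℕ → ℝ, I ∈ StoqMA k (fun _ => 1) s}

end

/-! The gates permute the basis states, so the final measurement compares each basis state `b` with
its partner `C.perm b`, obtained by running the circuit, flipping the output bit and undoing the
circuit. The rejection probability is the sum of the squares of half the differences between the
initial amplitudes of partners (`one_sub_acceptProb`). Up to a constant from the `|+⟩` ancillas, an
initial amplitude is a product of two non-negative parts, one for the first witness register with
the zero ancillas and one for the second register. With perfect acceptance the support is therefore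
a rectangle closed under partners. Starting from a clean basis state `s`, parts are derived in
rounds: if both parts of `z` are derived, then so are the parts of its partner (`Der`). The
criterion is that, for some clean `s`, no basis state with a nonzero zero-ancilla has both parts
derived within polynomially many rounds (`¬ Bad`).

Completeness (`exists_not_bad`): for a start `s` of large amplitude, each round at worst about cubes
the lower bound on the amplitudes of derived parts, so after `T` rounds they are still at least `2 ^
(-L * 3 ^ T)`. A doubly exponentially small error cannot destroy this, whereas the first part of an
unclean state has amplitude zero.

Soundness (`bad_of_acceptProb_le`): as long as no unclean state is reached, the uniform states on
the derived parts form a legitimate witness, whose initial state is uniform on the reached set. Its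
rejection probability measures how many partners lie outside that set. A rejection probability of at
least `1 / Q` makes the set grow by a factor `1 + 1 / Q` per round, which cannot last for `Q * (2 *
l + 1)` rounds, because the size varies by a factor of at most `2 ^ (2 * l)`.

Polynomial space: unfolding the recursion of `Der` turns the criterion into a quantified Boolean
formula of polynomial length (`qeval_matrix`), evaluated by depth-first search. For the machine
model, while-programs are compiled to stack machines (`languageInPSPACE_of_exec`), the functions
they compute in polynomial space are closed under the usual constructions (`PS`), and
polynomial-time machines are simulated by them (`PS.of_polyTime`). -/

noncomputable section

/-! ### While-programs over registers -/

/-- While-programs over registers indexed by `κ`, each of which holds a stack of symbols. -/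
inductive Prog (κ : Type) : Type
  | skip
  | push (k : κ) (a : ℕ)
  | top (k w : κ)
  | pop (k : κ)
  | seq (P Q : Prog κ)
  | ite (k : κ) (c : Option ℕ → Bool) (P Q : Prog κ)
  | loop (k : κ) (c : Option ℕ → Bool) (P : Prog κ)

namespace Prog

open Function Relation Turing Turing.TM2

variable {κ κ' : Type}

/-- Big-step semantics; no register grows beyond length `B`. `top k w` copies the top symbol of
`k` to `w`; the tests of `ite` and `loop` see the top symbol of their register. -/
inductive Exec [DecidableEq κ] (B : ℕ) : Prog κ → (κ → List ℕ) → (κ → List ℕ) → Prop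
  | skip (ρ) : Exec B skip ρ ρ
  | push (ρ k a) (h : (ρ k).length + 1 ≤ B) : Exec B (push k a) ρ (update ρ k (a :: ρ k))
  | top (ρ k w a l) (hk : ρ k = a :: l) (h : (ρ w).length + 1 ≤ B) :
      Exec B (top k w) ρ (update ρ w (a :: ρ w))
  | pop (ρ k) : Exec B (pop k) ρ (update ρ k (ρ k).tail)
  | seq {P Q ρ ρ₁ ρ₂} (h₁ : Exec B P ρ ρ₁) (h₂ : Exec B Q ρ₁ ρ₂) : Exec B (seq P Q) ρ ρ₂
  | ite_true {k c P Q ρ ρ₁} (hc : c (ρ k).head? = true) (h : Exec B P ρ ρ₁) :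
      Exec B (ite k c P Q) ρ ρ₁
  | ite_false {k c P Q ρ ρ₁} (hc : c (ρ k).head? = false) (h : Exec B Q ρ ρ₁) :
      Exec B (ite k c P Q) ρ ρ₁
  | loop_exit {k c P ρ} (hc : c (ρ k).head? = false) : Exec B (loop k c P) ρ ρ
  | loop_continue {k c P ρ ρ₁ ρ₂} (hc : c (ρ k).head? = true) (h₁ : Exec B P ρ ρ₁)
      (h₂ : Exec B (loop k c P) ρ₁ ρ₂) : Exec B (loop k c P) ρ ρ₂

/-- Renaming of registers. -/
def map (e : κ → κ') : Prog κ → Prog κ'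
  | skip => skip
  | push k a => push (e k) a
  | top k w => top (e k) (e w)
  | pop k => pop (e k)
  | seq P Q => seq (P.map e) (Q.map e)
  | ite k c P Q => ite (e k) c (P.map e) (Q.map e)
  | loop k c P => loop (e k) c (P.map e)

section Exec

variable [DecidableEq κ] [DecidableEq κ'] {B B' : ℕ}

theorem Exec.mono {P : Prog κ} {ρ ρ'} (h : Exec B P ρ ρ') (hB : B ≤ B') : Exec B' P ρ ρ' := by
  induction h with
  | skip => exact .skip _
  | push ρ k a h => exact .push _ _ _ (h.trans hB)
  | top ρ k w a l hk h => exact .top _ _ _ _ l hk (h.trans hB)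
  | pop => exact .pop _ _
  | seq _ _ ih₁ ih₂ => exact .seq ih₁ ih₂
  | ite_true hc _ ih => exact .ite_true hc ih
  | ite_false hc _ ih => exact .ite_false hc ih
  | loop_exit hc => exact .loop_exit hc
  | loop_continue hc _ _ ih₁ ih₂ => exact .loop_continue hc ih₁ ih₂

theorem Exec.length_le {P : Prog κ} {ρ ρ'} (h : Exec B P ρ ρ') :
    (∀ k, (ρ k).length ≤ B) → ∀ k, (ρ' k).length ≤ B := by
  induction h with
  | skip => exact id
  | push ρ k a h =>
    intro h' j
    rcases eq_or_ne j k with rfl | hj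
    · simpa using h
    · simpa [hj] using h' j
  | top ρ k w a l hk h =>
    intro h' j
    rcases eq_or_ne j w with rfl | hj
    · simpa using h
    · simpa [hj] using h' j
  | pop ρ k =>
    intro h' j
    rcases eq_or_ne j k with rfl | hj
    · simpa using (Nat.sub_le _ _).trans (h' j)
    · simpa [hj] using h' j
  | seq _ _ ih₁ ih₂ => exact fun h => ih₂ (ih₁ h)
  | ite_true hc _ ih => exact ih
  | ite_false hc _ ih => exact ih
  | loop_exit hc => exact id
  | loop_continue hc _ _ ih₁ ih₂ => exact fun h => ih₂ (ih₁ h)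

theorem update_of_rename {e : κ → κ'} (he : Injective e) {ρ : κ → List ℕ} {τ τ' : κ' → List ℕ}
    {k : κ} {x : List ℕ}
    (hτ' : ∀ i, τ' (e i) = update ρ k x i) (h : ∀ i, τ (e i) = ρ i)
    (hoff : ∀ j, (∀ i, e i ≠ j) → τ' j = τ j) : τ' = update τ (e k) x := by
  funext j
  by_cases hj : ∃ i, e i = j
  · obtain ⟨i, rfl⟩ := hj
    rw [hτ']
    rcases eq_or_ne i k with rfl | hik
    · simp
    · simp [hik, he.ne hik, h]
  · push Not at hj
    rw [hoff j hj, update_of_ne (hj k).symm]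

/-- A renamed program acts on the renamed registers as before, and leaves the others alone. -/
theorem Exec.map {P : Prog κ} {ρ ρ'} (h : Exec B P ρ ρ') {e : κ → κ'} (he : Injective e) :
    ∀ {τ τ' : κ' → List ℕ}, (∀ i, τ (e i) = ρ i) → (∀ i, τ' (e i) = ρ' i) →
      (∀ j, (∀ i, e i ≠ j) → τ' j = τ j) → Exec B (P.map e) τ τ' := by
  have refl : ∀ {ρ : κ → List ℕ} {τ τ' : κ' → List ℕ}, (∀ i, τ (e i) = ρ i) →
      (∀ i, τ' (e i) = ρ i) → (∀ j, (∀ i, e i ≠ j) → τ' j = τ j) → τ' = τ := by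
    intro ρ τ τ' h₁ h₂ h₃
    funext j
    by_cases hj : ∃ i, e i = j
    · obtain ⟨i, rfl⟩ := hj
      rw [h₁, h₂]
    · push Not at hj
      exact h₃ j hj
  classical
  -- Sequencing needs a large register file for the intermediate state: it takes the values of `ρ`
  -- on the image of `e` and those of `τ` elsewhere.
  have mid : ∀ (τ : κ' → List ℕ) (ρ : κ → List ℕ), ∃ τ₁ : κ' → List ℕ,
      (∀ i, τ₁ (e i) = ρ i) ∧ ∀ j, (∀ i, e i ≠ j) → τ₁ j = τ j := fun τ ρ =>
    ⟨fun j => if hj : ∃ i, e i = j then ρ hj.choose else τ j, fun i => by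
      have hi : ∃ i', e i' = e i := ⟨i, rfl⟩
      simp only [hi, dite_true]
      rw [he hi.choose_spec], fun j hj => dif_neg (by simpa using hj)⟩
  induction h with
  | skip ρ =>
    intro τ τ' h₁ h₂ h₃
    rw [refl h₁ h₂ h₃]
    exact .skip _
  | push ρ k a h =>
    intro τ τ' h₁ h₂ h₃
    rw [update_of_rename he h₂ h₁ h₃, ← h₁]
    exact .push _ _ _ (by rwa [h₁])
  | top ρ k w a l hk h =>
    intro τ τ' h₁ h₂ h₃
    rw [update_of_rename he h₂ h₁ h₃, ← h₁]
    exact .top _ _ _ _ l (by rwa [h₁]) (by rwa [h₁])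
  | pop ρ k =>
    intro τ τ' h₁ h₂ h₃
    rw [update_of_rename he h₂ h₁ h₃, ← h₁]
    exact .pop _ _
  | seq _ _ ih₁ ih₂ =>
    rename_i ρ₁ _ _ _
    intro τ τ' h₁ h₂ h₃
    obtain ⟨τ₁, m₁, m₂⟩ := mid τ ρ₁
    exact .seq (ih₁ h₁ m₁ m₂) (ih₂ m₁ h₂ fun j hj => by rw [h₃ j hj, m₂ j hj])
  | ite_true hc _ ih =>
    intro τ τ' h₁ h₂ h₃
    exact .ite_true (by rwa [h₁]) (ih h₁ h₂ h₃)
  | ite_false hc _ ih =>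
    intro τ τ' h₁ h₂ h₃
    exact .ite_false (by rwa [h₁]) (ih h₁ h₂ h₃)
  | loop_exit hc =>
    intro τ τ' h₁ h₂ h₃
    rw [refl h₁ h₂ h₃]
    exact .loop_exit (by rwa [h₁])
  | loop_continue hc _ _ ih₁ ih₂ =>
    rename_i ρ₁ _ _ _
    intro τ τ' h₁ h₂ h₃
    obtain ⟨τ₁, m₁, m₂⟩ := mid τ ρ₁
    exact .loop_continue (by rwa [h₁]) (ih₁ h₁ m₁ m₂)
      (ih₂ m₁ h₂ fun j hj => by rw [h₃ j hj, m₂ j hj])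

end Exec

/-! ### Compilation to stack machines -/

/-- Stack alphabets of the compiled machine: the registers, and two Boolean stacks for input and
output. -/
abbrev Alph (κ : Type) (n : ℕ) : Bool ⊕ κ → Type
  | .inl _ => Bool
  | .inr _ => Fin (n + 2)

/-- The labels of a program: one for each loop. -/
def Pos : Prog κ → Type
  | skip | push _ _ | top _ _ | pop _ => Empty
  | seq P Q | ite _ _ P Q => P.Pos ⊕ Q.Pos
  | loop _ _ P => Option P.Pos

theorem finite_pos : ∀ P : Prog κ, Finite P.Pos
  | skip | push _ _ | top _ _ | pop _ => inferInstanceAs (Finite Empty)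
  | seq P Q | ite _ _ P Q =>
    haveI := finite_pos P
    haveI := finite_pos Q
    inferInstanceAs (Finite (P.Pos ⊕ Q.Pos))
  | loop _ _ P =>
    haveI := finite_pos P
    inferInstanceAs (Finite (Option P.Pos))

/-- A bound for the symbols pushed by a program. -/
def maxSym : Prog κ → ℕ
  | skip | top _ _ | pop _ => 0
  | push _ a => a
  | seq P Q | ite _ _ P Q => max P.maxSym Q.maxSym
  | loop _ _ P => P.maxSym

section Compile

variable {Λ : Type} {n : ℕ}

/-- The statements of the compiled machine, which keeps one symbol in its state. -/
abbrev CStmt (κ : Type) (n : ℕ) (Λ : Type) : Type :=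
  Stmt (Alph κ n) Λ (Option (Fin (n + 2)))

/-- The statement that runs a program and continues with `q`. -/
def compile (n : ℕ) : (P : Prog κ) → (P.Pos → Λ) → CStmt κ n Λ → CStmt κ n Λ
  | skip, _, q => q
  | push k a, _, q => .push (.inr k) (fun _ => Fin.ofNat (n + 2) a) q
  | top k w, _, q => .peek (.inr k) (fun _ s => s) (.push (.inr w) (fun v => v.getD 0) q)
  | pop k, _, q => .pop (.inr k) (fun v _ => v) q
  | seq P Q, e, q => compile n P (e ∘ .inl) (compile n Q (e ∘ .inr) q)
  | ite k c P Q, e, q => .peek (.inr k) (fun _ s => s) (.branch (fun v => c (v.map Fin.val))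
      (compile n P (e ∘ .inl) q) (compile n Q (e ∘ .inr) q))
  | loop _ _ _, e, _ => .goto fun _ => e none

/-- The statement at a label of a program. -/
def code (n : ℕ) : (P : Prog κ) → (P.Pos → Λ) → CStmt κ n Λ → P.Pos → CStmt κ n Λ
  | skip, _, _ => Empty.elim
  | push _ _, _, _ => Empty.elim
  | top _ _, _, _ => Empty.elim
  | pop _, _, _ => Empty.elim
  | seq P Q, e, q => Sum.elim (code n P (e ∘ .inl) (compile n Q (e ∘ .inr) q))
      (code n Q (e ∘ .inr) q)
  | ite _ _ P Q, e, q => Sum.elim (code n P (e ∘ .inl) q) (code n Q (e ∘ .inr) q)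
  | loop k c P, e, q => fun i => Option.elim i (.peek (.inr k) (fun _ s => s)
      (.branch (fun v => c (v.map Fin.val))
        (compile n P (e ∘ some) (.goto fun _ => e none)) q))
      (code n P (e ∘ some) (.goto fun _ => e none))

/-- The stacks of the compiled machine represent a register file. -/
def Sim (S : ∀ k, List (Alph κ n k)) (ρ : κ → List ℕ) : Prop :=
  (∀ k, (S (.inr k)).map Fin.val = ρ k) ∧ ∀ b, S (.inl b) = []

theorem Sim.update [DecidableEq κ] {S : ∀ k, List (Alph κ n k)} {ρ : κ → List ℕ} (h : Sim S ρ)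
    (k : κ) {l : List (Fin (n + 2))} {l' : List ℕ} (hl : l.map Fin.val = l') :
    Sim (update S (.inr k) l) (update ρ k l') := by
  refine ⟨fun j => ?_, fun b => by simp [h.2]⟩
  rcases eq_or_ne j k with rfl | hj
  · simpa using hl
  · simpa [hj] using h.1 j

theorem Sim.head? {S : ∀ k, List (Alph κ n k)} {ρ : κ → List ℕ} (h : Sim S ρ) (k : κ) :
    Option.map Fin.val (S (.inr k)).head? = (ρ k).head? := by
  rw [← h.1, List.head?_map]

/-- A machine step from a configuration of size at most `D`. -/
def BStep [Fintype κ] [DecidableEq κ] (M : Λ → CStmt κ n Λ) (D : ℕ)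
    (c c' : Cfg (Alph κ n) Λ (Option (Fin (n + 2)))) : Prop :=
  ∑ k, (c.stk k).length ≤ D ∧ c' ∈ TM2.step M c

theorem Sim.sum_length_le [Fintype κ] {S : ∀ k, List (Alph κ n k)} {ρ : κ → List ℕ} {B : ℕ}
    (h : Sim S ρ) (hB : ∀ k, (ρ k).length ≤ B) : ∑ k, (S k).length ≤ Fintype.card κ * B := by
  rw [Fintype.sum_sum_type]
  simp only [h.2, List.length_nil, Finset.sum_const_zero, zero_add]
  refine (Finset.sum_le_card_nsmul _ _ B fun k _ => ?_).trans (by simp)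
  have := hB k
  rwa [← h.1, List.length_map] at this

/-- Straight-line code is part of a single machine statement, so only loop tests cost machine steps
and space need only be checked there. The bound on `maxSym` ensures that `Fin.ofNat` does not wrap a
pushed symbol. -/
theorem Exec.reaches [Fintype κ] [DecidableEq κ] {M : Λ → CStmt κ n Λ} {B : ℕ} {P : Prog κ}
    {ρ ρ' : κ → List ℕ} (h : Exec B P ρ ρ') :
    ∀ (e : P.Pos → Λ) (q : CStmt κ n Λ), (∀ i, M (e i) = P.code n e q i) → P.maxSym < n + 2 →
      ∀ v S, Sim S ρ → (∀ k, (ρ k).length ≤ B) → ∃ v' S', Sim S' ρ' ∧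
        ReflTransGen (BStep M (Fintype.card κ * B)) (stepAux (P.compile n e q) v S)
          (stepAux q v' S') := by
  induction h with
  | skip ρ => exact fun e q _ _ v S hS _ => ⟨v, S, hS, .refl⟩
  | push ρ k a h =>
    intro e q _ ha v S hS _
    refine ⟨v, _, hS.update k (l := Fin.ofNat (n + 2) a :: S (.inr k)) ?_, .refl⟩
    simp only [List.map_cons, hS.1]
    congr 1
    exact Nat.mod_eq_of_lt ha
  | top ρ k w a l hk h =>
    intro e q _ _ v S hS _
    have := hS.head? k
    rw [hk] at this
    obtain ⟨x, hx, rfl⟩ : ∃ x, (S (.inr k)).head? = some x ∧ Fin.val x = a := by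
      simpa using this
    refine ⟨some x, _, hS.update w (l := x :: S (.inr w)) ?_, ?_⟩
    · simp [hS.1]
    · simp only [compile, stepAux, hx]
      exact .refl
  | pop ρ k =>
    intro e q _ _ v S hS _
    refine ⟨v, _, hS.update k (l := (S (.inr k)).tail) ?_, .refl⟩
    rw [← hS.1, List.map_tail]
  | seq h₁ _ ih₁ ih₂ =>
    intro e q hM hn v S hS hB
    simp only [maxSym, max_lt_iff] at hn
    obtain ⟨v₁, S₁, hS₁, r₁⟩ := ih₁ (e ∘ .inl) _ (fun i => hM (.inl i)) hn.1 v S hS hB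
    obtain ⟨v₂, S₂, hS₂, r₂⟩ := ih₂ (e ∘ .inr) q (fun i => hM (.inr i)) hn.2 v₁ S₁ hS₁
      (h₁.length_le hB)
    exact ⟨v₂, S₂, hS₂, r₁.trans r₂⟩
  | @ite_true k c P Q ρ ρ₁ hc _ ih =>
    intro e q hM hn v S hS hB
    simp only [maxSym, max_lt_iff] at hn
    obtain ⟨v₁, S₁, hS₁, r₁⟩ := ih (e ∘ .inl) _ (fun i => hM (.inl i)) hn.1
      (S (.inr k)).head? S hS hB
    refine ⟨v₁, S₁, hS₁, ?_⟩
    simpa only [compile, stepAux, hS.head?, hc, cond_true] using r₁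
  | @ite_false k c P Q ρ ρ₁ hc _ ih =>
    intro e q hM hn v S hS hB
    simp only [maxSym, max_lt_iff] at hn
    obtain ⟨v₁, S₁, hS₁, r₁⟩ := ih (e ∘ .inr) _ (fun i => hM (.inr i)) hn.2
      (S (.inr k)).head? S hS hB
    refine ⟨v₁, S₁, hS₁, ?_⟩
    simpa only [compile, stepAux, hS.head?, hc, cond_false] using r₁
  | @loop_exit k c P ρ hc =>
    intro e q hM hn v S hS hB
    refine ⟨(S (.inr k)).head?, S, hS, .single ⟨hS.sum_length_le hB, ?_⟩⟩
    have : M (e none) = _ := hM none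
    simp only [compile, stepAux, TM2.step, this, code, Option.elim, hS.head?, hc, cond_false,
      Option.mem_def]
  | @loop_continue k c P ρ ρ₁ ρ₂ hc h₁ _ ih₁ ih₂ =>
    intro e q hM hn v S hS hB
    obtain ⟨v₁, S₁, hS₁, r₁⟩ := ih₁ (e ∘ some) (.goto fun _ => e none) (fun i => hM (some i)) hn
      (S (.inr k)).head? S hS hB
    obtain ⟨v₂, S₂, hS₂, r₂⟩ := ih₂ e q hM hn v₁ S₁ hS₁ (h₁.length_le hB)
    refine ⟨v₂, S₂, hS₂, .head ⟨hS.sum_length_le hB, ?_⟩ (r₁.trans r₂)⟩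
    have : M (e none) = _ := hM none
    simp only [compile, stepAux, TM2.step, this, code, Option.elim, hS.head?, hc, cond_true,
      Option.mem_def]

end Compile

/-! ### The deciding machine -/

section Decider

variable [Fintype κ] [DecidableEq κ] (P : Prog κ) (i o : κ)

/-- The machine that moves its input to register `i`, runs `P` and outputs whether register `o`
holds the symbol `1`. -/
def deciderCode : Option P.Pos → CStmt κ P.maxSym (Option P.Pos) :=
  let q : CStmt κ P.maxSym (Option P.Pos) := .pop (.inr o) (fun _ s => s) <|
    .push (.inl true) (fun v => decide (v = some 1)) <| .load (fun _ => none) .halt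
  fun l => l.elim (.pop (.inl false) (fun _ s => s.map fun b => if b then 1 else 0) <|
    .branch Option.isSome (.push (.inr i) (fun v => v.getD 0) <| .goto fun _ => none)
      (P.compile P.maxSym some q)) (P.code P.maxSym some q)

/-- The deciding machine as a bundled machine. -/
def decider : TM2ComputableAux Bool Bool :=
  haveI := P.finite_pos
  letI := Fintype.ofFinite P.Pos
  { tm :=
      { K := Bool ⊕ κ
        k₀ := .inl false
        k₁ := .inl true
        Γ := Alph κ P.maxSym
        Λ := Option P.Pos
        main := none
        σ := Option (Fin (P.maxSym + 2))
        initialState := none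
        Γk₀Fin := inferInstanceAs (Fintype Bool)
        m := P.deciderCode i o }
    inputAlphabet := .refl Bool
    outputAlphabet := .refl Bool }

/-- The stacks while the input is read. -/
def inputStk (n : ℕ) (x : List Bool) (y : List (Fin (n + 2))) : ∀ k, List (Alph κ n k)
  | .inl false => x
  | .inl true => []
  | .inr j => if j = i then y else []

theorem sum_length_inputStk (n : ℕ) (x : List Bool) (y : List (Fin (n + 2))) :
    ∑ k, (inputStk i n x y k).length = x.length + y.length := by
  rw [Fintype.sum_sum_type, Fintype.sum_bool, Finset.sum_eq_single i]
  · simp [inputStk]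
  · intro j _ hj
    simp [inputStk, hj]
  · simp

/-- Each step moves one symbol from the input stack to register `i`. The total length is invariant,
and the input arrives reversed. -/
theorem reaches_inputStk (D : ℕ) (x : List Bool) : ∀ (y : List (Fin (P.maxSym + 2))) v,
    x.length + y.length ≤ D → ∃ v', ReflTransGen (BStep (P.deciderCode i o) D)
      ⟨some none, v, inputStk i _ x y⟩
      ⟨some none, v', inputStk i _ [] ((x.map fun b => if b then 1 else 0).reverse ++ y)⟩ := by
  induction x with
  | nil => exact fun y v _ => ⟨v, by simpa using .refl⟩
  | cons b x ih =>
    intro y v h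
    obtain ⟨v', r⟩ := ih ((if b then 1 else 0) :: y) (some (if b then 1 else 0))
      (by simp only [List.length_cons] at h ⊢; omega)
    refine ⟨v', .head ⟨(sum_length_inputStk i _ _ _).trans_le h, ?_⟩ (by simpa using r)⟩
    simp only [TM2.step, deciderCode, Option.elim, stepAux, inputStk, List.head?_cons,
      Option.map_some, Option.isSome_some, cond_true, Option.mem_def, Option.some.injEq]
    congr 1
    funext k
    rcases k with (_ | _) | j
    · simp [inputStk]
    · simp [inputStk]
    · rcases eq_or_ne j i with rfl | hj
      · simp [inputStk]
      · simp [inputStk, hj]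

end Decider

theorem nonempty_evalsTo {σ : Type} {f : σ → Option σ} {a b : σ}
    (h : StateTransition.Reaches f a b) : Nonempty (StateTransition.EvalsTo f a (some b)) := by
  induction h with
  | refl => exact ⟨.refl f a⟩
  | tail _ h ih => exact ih.map fun e => e.trans _ _ _ _ ⟨1, h⟩

/-- The machine is deterministic and `b` halts, so every reachable configuration lies on the given
run. -/
theorem le_of_reaches {σ : Type} {f : σ → Option σ} {s : σ → ℕ} {D : ℕ} {a b c : σ}
    (h : ReflTransGen (fun c c' => s c ≤ D ∧ c' ∈ f c) a b) (hb : s b ≤ D) (hn : f b = none)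
    (hc : StateTransition.Reaches f a c) : s c ≤ D := by
  induction h using ReflTransGen.head_induction_on with
  | refl =>
    rcases ReflTransGen.cases_head hc with rfl | ⟨d, hd, _⟩
    · exact hb
    · simp [hn] at hd
  | head h _ ih =>
    rcases ReflTransGen.cases_head hc with rfl | ⟨d, hd, hdc⟩
    · exact h.1
    · rw [Option.mem_unique hd h.2] at hdc
      exact ih hdc

theorem _root_.languageInPSPACE_of_exec [Fintype κ] [DecidableEq κ] (P : Prog κ) (i o : κ)
    (f : List Bool → Bool) (p : Polynomial ℕ)
    (h : ∀ x, Exec (p.eval x.length) P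
      (update (fun _ => []) i (x.map fun b => if b then 1 else 0).reverse)
      (update (fun _ => []) o [if f x then 1 else 0])) :
    LanguageInPSPACE {x | f x = true} := by
  -- The space bound allows each register the program bound plus the input length, with one spare
  -- such term for the phase that reads the input, and one more cell for the output symbol.
  refine ⟨P.decider i o, (Fintype.card κ + 1 : ℕ) * (p + .X) + 1, ?_, fun x => ?_⟩
  · rintro (_ | _)
    · exact inferInstanceAs (Finite Bool)
    · exact inferInstanceAs (Finite (Fin _))
  set M := P.deciderCode i o with hM
  set B := p.eval x.length + x.length with hB
  set D := (Fintype.card κ + 1) * B + 1 with hD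
  have hp : Polynomial.eval x.length ((Fintype.card κ + 1 : ℕ) * (p + .X) + 1) = D := by
    simp [hD, hB]
  have hinit : initList (P.decider i o).tm (x.map (P.decider i o).inputAlphabet.symm) =
      ⟨some none, none, inputStk i _ x []⟩ := by
    simp only [initList, decider]
    congr 1
    funext k
    rcases k with (_ | _) | j
    · exact List.map_id x
    · simp [inputStk]
    · simp [inputStk]
  have hxD : x.length ≤ D := by
    have : B ≤ (Fintype.card κ + 1) * B := Nat.le_mul_of_pos_left _ (by simp)
    omega
  have hmono : ∀ {c c'}, BStep M (Fintype.card κ * B) c c' → BStep M D c c' := by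
    refine fun h => ⟨h.1.trans ?_, h.2⟩
    have : Fintype.card κ * B ≤ (Fintype.card κ + 1) * B := Nat.mul_le_mul_right _ (by simp)
    omega
  obtain ⟨v, r₁⟩ := reaches_inputStk P i o D x [] none (by simpa using hxD)
  rw [List.append_nil] at r₁
  set y : List (Fin (P.maxSym + 2)) := (x.map fun b => if b then 1 else 0).reverse with hy
  have hyx : y.map Fin.val = (x.map fun b => if b then 1 else 0).reverse := by
    rw [hy, List.map_reverse, List.map_map]
    congr 2
    funext b
    cases b <;> rfl
  have hylen : y.length = x.length := by simp [hy]
  obtain ⟨v', S', hS', r₂⟩ := ((h x).mono (B' := B) (by omega)).reaches (M := M) some _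
    (fun i => rfl) (by omega) none (inputStk i _ [] y) ⟨fun j => by
      rcases eq_or_ne j i with rfl | hj
      · simpa [inputStk] using hyx
      · simp [inputStk, hj], fun b => by cases b <;> rfl⟩ (fun j => by
      rcases eq_or_ne j i with rfl | hj
      · simp [hB]
      · simp [hj])
  have hstep : BStep M D ⟨some none, v, inputStk i _ [] y⟩ (stepAux (P.compile P.maxSym some
      (.pop (.inr o) (fun _ s => s) <| .push (.inl true) (fun v => decide (v = some 1)) <|
        .load (fun _ => none) .halt)) none (inputStk i _ [] y)) := by
    refine ⟨(sum_length_inputStk i _ _ _).trans_le (by simpa [hylen] using hxD), ?_⟩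
    simp only [TM2.step, hM, deciderCode, Option.elim, stepAux, inputStk, List.head?_nil,
      Option.map_none, Option.isSome_none, cond_false, Option.mem_def, Option.some.injEq]
    congr 1
    funext k
    rcases k with (_ | _) | j
    · simp [inputStk]
    · simp [inputStk]
    · simp [inputStk]
  have r := r₁.trans (.head hstep (ReflTransGen.mono (fun _ _ => hmono) _ _ r₂))
  set c := stepAux (Stmt.pop (.inr o) (fun _ s => s) <|
    Stmt.push (.inl true) (fun v => decide (v = some 1)) <|
        Stmt.load (fun _ => none) (Stmt.halt : CStmt κ P.maxSym (Option P.Pos))) v' S' with hc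
  -- The last pop empties register `o`, all others are empty already, and `load` resets the internal
  -- state, as the halting configuration demands.
  have hc' : c = haltList (P.decider i o).tm
      ([charFun {x | f x = true} x].map (P.decider i o).outputAlphabet.symm) := by
    simp only [haltList, decider, hc, stepAux]
    congr 1
    have ho : (S' (.inr o)).map Fin.val = [if f x then 1 else 0] := by simpa using hS'.1 o
    obtain ⟨s, hs, hs'⟩ : ∃ s, S' (.inr o) = [s] ∧ s.val = if f x then 1 else 0 := by
      rcases hl : S' (.inr o) with _ | ⟨s, _ | _⟩ <;> simp_all
    have hs1 : decide (s = 1) = f x := by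
      rw [Bool.eq_iff_iff, decide_eq_true_iff, Fin.ext_iff, hs']
      cases f x <;> simp
    funext k
    rcases k with (_ | _) | j
    · simp [hS'.2]
    · simp only [hS'.2, hs, hs1, charFun, List.head?_cons, Option.some.injEq, update_self,
        ne_eq, reduceCtorEq, not_false_eq_true, update_of_ne, Set.mem_ofPred_eq, Bool.decide_eq_true]
      rfl
    · rcases eq_or_ne j o with rfl | hj
      · simp [hs]
      · simpa [hj] using hS'.1 j
  have hcs : ∑ k, (c.stk k).length ≤ D := by
    rw [hc', Finset.sum_eq_single (Sum.inl true)]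
    · exact Nat.le_add_left _ _
    · rintro k - hk
      simp [haltList, decider, hk]
    · simp
  have hcn : TM2.step M c = none := by rw [hc']; rfl
  constructor
  · rw [TM2Outputs, Option.map_some, ← hc', hinit]
    exact nonempty_evalsTo (ReflTransGen.mono (fun _ _ h => h.2) _ _ r)
  · rw [hp, hinit]
    exact fun c' hc' => le_of_reaches (s := fun c : Cfg (Alph κ P.maxSym) (Option P.Pos)
      (Option (Fin (P.maxSym + 2))) => ∑ k, (c.stk k).length) r hcs hcn hc'

end Prog
end

noncomputable section

/-! ### Functions computable in polynomial space -/

/-- A finite type of symbols. -/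
class FinSym (A : Type) where
  finite : Finite A
  sym : A → ℕ
  inj : Function.Injective sym

attribute [instance] FinSym.finite

/-- Every finite type is a type of symbols. -/
@[reducible]
def FinSym.ofFinite (A : Type) [h : Finite A] : FinSym A where
  finite := h
  sym a := (Finite.equivFin A a).val
  inj := Fin.val_injective.comp (Finite.equivFin A).injective

instance : FinSym Bool where
  finite := inferInstance
  sym b := if b then 1 else 0
  inj a b := by cases a <;> cases b <;> simp

instance (A : Type) [FinSym A] : FinSym (Option A) where
  finite := inferInstance
  sym o := o.elim 0 fun a => FinSym.sym a + 1
  inj a b := by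
    cases a <;> cases b <;> simp
    exact fun h => FinSym.inj h

/-- Types whose elements are stored in finitely many registers. -/
class RegRep (α : Type) where
  Reg : Type
  fin : Fintype Reg
  dec : DecidableEq Reg
  enc : α → Reg → List ℕ

attribute [reducible] RegRep.fin RegRep.dec
attribute [instance] RegRep.fin RegRep.dec

open RegRep Function Relation

instance (A : Type) [FinSym A] : RegRep A where
  Reg := Unit
  fin := inferInstance
  dec := inferInstance
  enc a _ := [FinSym.sym a]

instance (A : Type) [FinSym A] : RegRep (List A) where
  Reg := Unit
  fin := inferInstance
  dec := inferInstance
  enc l _ := l.map FinSym.sym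

instance (α β : Type) [RegRep α] [RegRep β] : RegRep (α × β) where
  Reg := Reg α ⊕ Reg β
  fin := inferInstance
  dec := inferInstance
  enc a := Sum.elim (enc a.1) (enc a.2)

instance (ι : Type) (α : ι → Type) [Fintype ι] [DecidableEq ι] [∀ i, RegRep (α i)] :
    RegRep (∀ i, α i) where
  Reg := Σ i, Reg (α i)
  fin := inferInstance
  dec := inferInstance
  enc a r := enc (a r.1) r.2

/-- The number of symbols that an element occupies. -/
def size {α : Type} [RegRep α] (a : α) : ℕ := ∑ r, (enc a r).length

section Size

variable {α β A : Type} [RegRep α] [RegRep β] [FinSym A]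

@[simp] theorem size_prod (a : α × β) : size a = size a.1 + size a.2 := by
  simp [size, enc, Reg, Fintype.sum_sum_type]

@[simp] theorem size_list (l : List A) : size l = l.length := by
  simp [size, enc, Reg]

@[simp] theorem size_sym (a : A) : size a = 1 := by
  simp [size, enc, Reg]

@[simp] theorem size_pi {ι : Type} {α : ι → Type} [Fintype ι] [DecidableEq ι] [∀ i, RegRep (α i)]
    (a : ∀ i, α i) : size a = ∑ i, size (a i) := by
  simp [size, enc, Reg, Fintype.sum_sigma]

theorem length_enc_le (a : α) (r : Reg α) : (enc a r).length ≤ size a :=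
  Finset.single_le_sum (f := fun r => (enc a r).length) (fun _ _ => Nat.zero_le _)
    (Finset.mem_univ r)

theorem eval_le_eval (p : Polynomial ℕ) {m n : ℕ} (h : m ≤ n) : p.eval m ≤ p.eval n := by
  rw [Polynomial.eval_eq_sum_range, Polynomial.eval_eq_sum_range]
  exact Finset.sum_le_sum fun i _ => Nat.mul_le_mul_left _ (Nat.pow_le_pow_left h i)

end Size

/-- `f` is computed by a while-program within polynomial space: the input registers are preserved,
the result is written to separate registers, and all others are empty before and after. -/
def PS {α β : Type} [RegRep α] [RegRep β] (f : α → β) : Prop :=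
  ∃ (κ : Type) (_ : Fintype κ) (_ : DecidableEq κ) (P : Prog (Reg α ⊕ Reg β ⊕ κ))
    (p : Polynomial ℕ), ∀ a, P.Exec (p.eval (size a))
      (Sum.elim (enc a) fun _ => []) (Sum.elim (enc a) (Sum.elim (enc (f a)) fun _ => []))

/-! ### Clearing and copying registers. -/

namespace Prog

variable {κ ι : Type} [DecidableEq κ]

/-- Empties the registers in a list. -/
def clearList : List κ → Prog κ
  | [] => skip
  | k :: l => seq (loop k Option.isSome (pop k)) (clearList l)

theorem Exec.clearOne {B : ℕ} {k : κ} : ∀ {x : List ℕ} {τ τ' : κ → List ℕ}, τ k = x → τ' k = [] →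
    (∀ j, j ≠ k → τ' j = τ j) → Exec B (.loop k Option.isSome (.pop k)) τ τ'
  | [], τ, τ', h₁, h₂, h₃ => by
    have : τ' = τ := by
      funext j
      by_cases hj : j = k
      · rw [hj, h₁, h₂]
      · exact h₃ j hj
    rw [this]
    exact .loop_exit (by simp [h₁])
  | a :: x, τ, τ', h₁, h₂, h₃ => by
    refine .loop_continue (by simp [h₁]) (.pop _ _) (clearOne (x := x) (by simp [h₁]) h₂ ?_)
    intro j hj
    rw [h₃ j hj, update_of_ne hj]

theorem Exec.clearList {B : ℕ} : ∀ {l : List κ} {τ τ' : κ → List ℕ}, (∀ k ∈ l, τ' k = []) →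
    (∀ k, k ∉ l → τ' k = τ k) → Exec B (Prog.clearList l) τ τ'
  | [], τ, τ', _, h => by
    rw [show τ' = τ from funext fun k => h k (by simp)]
    exact .skip _
  | k :: l, τ, τ', h₁, h₂ => by
    refine .seq (.clearOne rfl (τ' := update τ k []) (by simp) fun j hj => update_of_ne hj _ _)
      (clearList (fun j hj => h₁ j (by simp [hj])) fun j hj => ?_)
    rcases eq_or_ne j k with rfl | hjk
    · rw [h₁ _ (by simp), update_self]
    · rw [update_of_ne hjk, h₂ _ (by simp [hj, hjk])]

/-- Empties the registers in the range of `e`. -/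
def clear [Fintype ι] (e : ι → κ) : Prog κ := clearList (Finset.univ.toList.map e)

theorem Exec.clear [Fintype ι] {e : ι → κ} {B : ℕ} {τ τ' : κ → List ℕ} (h : ∀ i, τ' (e i) = [])
    (hoff : ∀ j, (∀ i, e i ≠ j) → τ' j = τ j) : Exec B (Prog.clear e) τ τ' :=
  .clearList (by simpa using h) fun k hk => hoff k (by simpa using hk)

/-- Copies register `v` to `w`, by means of the register `t`. -/
def copy (v w t : κ) : Prog κ :=
  seq (loop v Option.isSome (seq (top v t) (pop v)))
    (loop t Option.isSome (seq (top t v) (seq (top t w) (pop t))))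

/-- First loop of `copy`: `v` is moved to `t` in reverse. The second loop moves it back, restoring
the order, and duplicates it to `w` on the way. -/
theorem Exec.copyFst {B : ℕ} {v t : κ} (hvt : v ≠ t) : ∀ (x : List ℕ) (τ : κ → List ℕ), τ v = x →
    x.length + (τ t).length ≤ B → Exec B (.loop v Option.isSome (.seq (.top v t) (.pop v))) τ
      (update (update τ v []) t (x.reverse ++ τ t))
  | [], τ, h, _ => by
    rw [show update τ v [] = τ by rw [← h, update_eq_self], List.reverse_nil, List.nil_append,
      update_eq_self]
    exact .loop_exit (by simp [h])
  | a :: x, τ, h, hB => by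
    simp only [List.length_cons] at hB
    have := copyFst (B := B) hvt x (update (update τ t (a :: τ t)) v x) (by simp)
      (by simp [hvt.symm]; omega)
    refine .loop_continue (by simp [h]) (.seq (.top τ v t a x h (by omega)) (.pop _ _)) ?_
    rw [update_of_ne hvt, h, List.tail_cons]
    convert this using 1
    funext j
    by_cases hv : j = v <;> by_cases ht : j = t <;> simp_all [update_apply]

theorem Exec.copySnd {B : ℕ} {v w t : κ} (hvt : v ≠ t) (hwt : w ≠ t) (hvw : v ≠ w) :
    ∀ (x : List ℕ) (τ : κ → List ℕ), τ t = x → x.length + (τ v).length ≤ B →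
      x.length + (τ w).length ≤ B →
      Exec B (.loop t Option.isSome (.seq (.top t v) (.seq (.top t w) (.pop t)))) τ
        (update (update (update τ t []) v (x.reverse ++ τ v)) w (x.reverse ++ τ w))
  | [], τ, h, _, _ => by
    rw [show update τ t [] = τ by rw [← h, update_eq_self], List.reverse_nil, List.nil_append,
      List.nil_append, update_eq_self, update_eq_self]
    exact .loop_exit (by simp [h])
  | a :: x, τ, h, hB, hB' => by
    simp only [List.length_cons] at hB hB'
    have := copySnd (B := B) hvt hwt hvw x (update (update (update τ v (a :: τ v)) w (a :: τ w)) t x)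
      (by simp) (by simp [hvt, hvw]; omega) (by simp [hwt]; omega)
    refine .loop_continue (by simp [h]) (.seq (.top τ t v a x h (by omega)) (.seq (.top _ t w a x ?_ ?_)
      (.pop _ _))) ?_
    · rw [update_of_ne hvt.symm, h]
    · rw [update_of_ne hvw.symm]
      omega
    · rw [update_of_ne hwt.symm, update_of_ne hvt.symm, h, List.tail_cons, update_of_ne hvw.symm]
      convert this using 1
      funext j
      by_cases hv : j = v <;> by_cases ht : j = t <;> by_cases hw : j = w <;>
        simp_all [update_apply]

theorem Exec.copy {B : ℕ} {v w t : κ} (hvt : v ≠ t) (hwt : w ≠ t) (hvw : v ≠ w) {τ : κ → List ℕ}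
    (ht : τ t = []) (hw : τ w = []) (hB : (τ v).length ≤ B) :
    Exec B (Prog.copy v w t) τ (update τ w (τ v)) := by
  refine .seq (.copyFst hvt _ τ rfl (by simpa [ht] using hB)) ?_
  have := Exec.copySnd (B := B) hvt hwt hvw (τ v).reverse
    (update (update τ v []) t ((τ v).reverse ++ τ t)) (by simp [ht])
    (by simpa [hvt] using hB) (by simpa [hwt, hvw.symm, hw] using hB)
  convert this using 1
  funext j
  by_cases hv : j = v <;> by_cases ht : j = t <;> by_cases hw : j = w <;>
    simp_all [update_apply]

end Prog

/-! ### Composition and pairing. -/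

namespace PS

open Prog

variable {α β γ δ σ A : Type} [RegRep α] [RegRep β] [RegRep γ] [RegRep δ] [RegRep σ] [FinSym A]

/-- A function that only copies registers. -/
theorem rewire {f : α → β} (s : Reg β → Reg α) (h : ∀ a r, enc (f a) r = enc a (s r)) : PS f := by
  refine ⟨Unit, inferInstance, inferInstance, (Finset.univ.toList : List (Reg β)).foldr
    (fun r P => .seq P (copy (.inl (s r)) (.inr (.inl r)) (.inr (.inr ())))) .skip, .X, fun a => ?_⟩
  -- Induction on the list of output registers copied so far; without duplicates, each target is
  -- still empty when its turn comes.
  have key : ∀ l : List (Reg β), l.Nodup → Exec (size a) (l.foldr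
      (fun r P => .seq P (copy (.inl (s r)) (.inr (.inl r)) (.inr (.inr ())))) .skip)
      (Sum.elim (enc a) fun _ => [])
      (Sum.elim (enc a) (Sum.elim (fun r => if r ∈ l then enc (f a) r else [])
        fun _ : Unit => [])) := by
    intro l
    induction l with
    | nil =>
      intro _
      rw [List.foldr_nil]
      convert Exec.skip (κ := Reg α ⊕ Reg β ⊕ Unit) (B := size a) _ using 1
      funext i
      rcases i with _ | _ <;> simp
    | cons r l ih =>
      intro hl
      rw [List.nodup_cons] at hl
      refine .seq (ih hl.2) ?_
      convert Exec.copy (v := Sum.inl (s r)) (w := Sum.inr (Sum.inl r)) (t := Sum.inr (Sum.inr ())) (by simp)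
        (by simp) (by simp) ?_ ?_ ?_ using 1
      · funext i
        rcases i with i | i | i
        · simp
        · rcases eq_or_ne i r with rfl | hi
          · simp [h]
          · rw [update_of_ne (by simpa using hi)]
            simp [hi]
        · simp
      · simp
      · simp [hl.1]
      · exact length_enc_le a _
  rw [Polynomial.eval_X]
  simpa using key Finset.univ.toList (Finset.nodup_toList _)

theorem id : PS (fun a : α => a) := rewire (fun r => r) fun _ _ => rfl

theorem fst_ : PS (Prod.fst : α × β → α) := rewire .inl fun _ _ => rfl

theorem snd_ : PS (Prod.snd : α × β → β) := rewire .inr fun _ _ => rfl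

theorem apply_ {ι : Type} {α : ι → Type} [Fintype ι] [DecidableEq ι] [∀ i, RegRep (α i)] (i : ι) :
    PS (fun a : ∀ i, α i => a i) :=
  rewire (fun r => ⟨i, r⟩) fun _ _ => rfl

/-- The output of a polynomial-space function has polynomial size. -/
theorem exists_size_le {f : α → β} (hf : PS f) :
    ∃ p : Polynomial ℕ, ∀ a, size (f a) ≤ p.eval (size a) := by
  obtain ⟨κ, _, _, P, p, h⟩ := hf
  -- The execution bound limits only pushes; the summand `.X` covers the initial contents of the
  -- input registers.
  refine ⟨(Fintype.card (Reg β) : ℕ) * (p + .X), fun a => ?_⟩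
  have key := ((h a).mono (Nat.le_add_right _ (size a))).length_le ?_
  · refine (Finset.sum_le_card_nsmul _ _ _ fun r _ => key (.inr (.inl r))).trans ?_
    simp
  · rintro (r | r)
    · exact (length_enc_le a r).trans (Nat.le_add_left _ _)
    · exact Nat.zero_le _

/-- The intermediate value lives in work registers that are cleared at the end. Its size is
polynomial, so the space used by `g` is polynomial in the original input. -/
theorem comp {g : β → γ} {f : α → β} (hg : PS g) (hf : PS f) : PS (fun a => g (f a)) := by
  obtain ⟨q, hq⟩ := hf.exists_size_le
  obtain ⟨κ₁, _, _, P₁, p₁, h₁⟩ := hf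
  obtain ⟨κ₂, _, _, P₂, p₂, h₂⟩ := hg
  let e₁ : Reg α ⊕ Reg β ⊕ κ₁ → Reg α ⊕ Reg γ ⊕ (Reg β ⊕ κ₁ ⊕ κ₂) :=
    Sum.elim .inl (Sum.elim (fun r => .inr (.inr (.inl r))) fun k => .inr (.inr (.inr (.inl k))))
  let e₂ : Reg β ⊕ Reg γ ⊕ κ₂ → Reg α ⊕ Reg γ ⊕ (Reg β ⊕ κ₁ ⊕ κ₂) :=
    Sum.elim (fun r => .inr (.inr (.inl r))) (Sum.elim (fun r => .inr (.inl r))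
      fun k => .inr (.inr (.inr (.inr k))))
  let e₃ : Reg β → Reg α ⊕ Reg γ ⊕ (Reg β ⊕ κ₁ ⊕ κ₂) := fun r => .inr (.inr (.inl r))
  have he₁ : Injective e₁ := by rintro (_ | _ | _) (_ | _ | _) h <;> simp_all [e₁]
  have he₂ : Injective e₂ := by rintro (_ | _ | _) (_ | _ | _) h <;> simp_all [e₂]
  refine ⟨_, inferInstance, inferInstance, .seq (P₁.map e₁) (.seq (P₂.map e₂) (clear e₃)),
    p₁ + p₂.comp q, fun a => ?_⟩
  rw [Polynomial.eval_add, Polynomial.eval_comp]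
  have hB := eval_le_eval p₂ (hq a)
  refine .seq (((h₁ a).mono (Nat.le_add_right _ _)).map he₁ (τ' := Sum.elim (enc a)
    (Sum.elim (fun _ => []) (Sum.elim (enc (f a)) fun _ => []))) ?_ ?_ ?_)
    (.seq (((h₂ (f a)).mono (hB.trans (Nat.le_add_left _ _))).map he₂ (τ' := Sum.elim (enc a)
    (Sum.elim (enc (g (f a))) (Sum.elim (enc (f a)) fun _ => []))) ?_ ?_ ?_) (.clear ?_ ?_))
  · rintro (_ | _ | _) <;> rfl
  · rintro (_ | _ | _) <;> rfl
  · rintro (_ | _ | _ | _ | _) hj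
    all_goals first | rfl | exact (hj (.inl _) rfl).elim | exact (hj (.inr (.inl _)) rfl).elim
  · rintro (_ | _ | _) <;> rfl
  · rintro (_ | _ | _) <;> rfl
  · rintro (_ | _ | _ | _ | _) hj
    all_goals first | rfl | exact (hj (.inl _) rfl).elim | exact (hj (.inr (.inl _)) rfl).elim
  · exact fun _ => rfl
  · rintro (_ | _ | _ | _ | _) hj
    all_goals first | rfl | exact (hj _ rfl).elim

theorem pair {f : α → β} {g : α → γ} (hf : PS f) (hg : PS g) : PS (fun a => (f a, g a)) := by
  obtain ⟨κ₁, _, _, P₁, p₁, h₁⟩ := hf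
  obtain ⟨κ₂, _, _, P₂, p₂, h₂⟩ := hg
  let e₁ : Reg α ⊕ Reg β ⊕ κ₁ → Reg α ⊕ (Reg β ⊕ Reg γ) ⊕ (κ₁ ⊕ κ₂) :=
    Sum.elim .inl (Sum.elim (fun r => .inr (.inl (.inl r))) fun k => .inr (.inr (.inl k)))
  let e₂ : Reg α ⊕ Reg γ ⊕ κ₂ → Reg α ⊕ (Reg β ⊕ Reg γ) ⊕ (κ₁ ⊕ κ₂) :=
    Sum.elim .inl (Sum.elim (fun r => .inr (.inl (.inr r))) fun k => .inr (.inr (.inr k)))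
  have he₁ : Injective e₁ := by rintro (_ | _ | _) (_ | _ | _) h <;> simp_all [e₁]
  have he₂ : Injective e₂ := by rintro (_ | _ | _) (_ | _ | _) h <;> simp_all [e₂]
  refine ⟨κ₁ ⊕ κ₂, inferInstance, inferInstance, .seq (P₁.map e₁) (P₂.map e₂), p₁ + p₂,
    fun a => ?_⟩
  rw [Polynomial.eval_add]
  refine .seq (((h₁ a).mono (Nat.le_add_right _ _)).map he₁ (τ' := Sum.elim (enc a)
    (Sum.elim (Sum.elim (enc (f a)) fun _ => []) fun _ => [])) ?_ ?_ ?_)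
    (((h₂ a).mono (Nat.le_add_left _ _)).map he₂ ?_ ?_ ?_)
  · rintro (_ | _ | _) <;> rfl
  · rintro (_ | _ | _) <;> rfl
  · rintro (_ | (_ | _) | _ | _) hj
    all_goals first | rfl | exact (hj (.inl _) rfl).elim | exact (hj (.inr (.inl _)) rfl).elim
  · rintro (_ | _ | _) <;> rfl
  · rintro (_ | _ | _) <;> rfl
  · rintro (_ | (_ | _) | _ | _) hj
    all_goals first | rfl | exact (hj (.inl _) rfl).elim | exact (hj (.inr (.inl _)) rfl).elim

theorem fst {f : α → β × γ} (hf : PS f) : PS (fun a => (f a).1) := fst_.comp hf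

theorem snd {f : α → β × γ} (hf : PS f) : PS (fun a => (f a).2) := snd_.comp hf

end PS

end

/-! ### Tests, constants, products, branching and loops. -/

noncomputable section

open RegRep Function Relation

namespace Prog

variable {κ : Type} [DecidableEq κ] {B : ℕ} {τ τ' : κ → List ℕ}

theorem Exec.skip_of_eq (h : τ' = τ) : Exec B .skip τ τ' := h ▸ .skip _

theorem Exec.push_of_eq {k : κ} {a : ℕ} (hB : (τ k).length + 1 ≤ B)
    (h : τ' = update τ k (a :: τ k)) : Exec B (.push k a) τ τ' := h ▸ .push _ _ _ hB

theorem Exec.top_of_eq {k w : κ} {a : ℕ} {l : List ℕ} (hk : τ k = a :: l)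
    (hB : (τ w).length + 1 ≤ B) (h : τ' = update τ w (a :: τ w)) : Exec B (.top k w) τ τ' :=
  h ▸ .top _ _ _ _ _ hk hB

theorem Exec.pop_of_eq {k : κ} (h : τ' = update τ k (τ k).tail) : Exec B (.pop k) τ τ' :=
  h ▸ .pop _ _

end Prog

namespace PS

open Prog

variable {α β γ δ σ A : Type} [RegRep α] [RegRep β] [RegRep γ] [RegRep δ] [RegRep σ] [FinSym A]

/-- A test of the top symbol of a register. -/
theorem test {f : α → Bool} (r : Reg α) (c : Option ℕ → Bool)
    (h : ∀ a, f a = c (enc a r).head?) : PS f := by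
  refine ⟨Empty, inferInstance, inferInstance, .ite (.inl r) c (.push (.inr (.inl ())) 1)
    (.push (.inr (.inl ())) 0), 1, fun a => ?_⟩
  have key : ∀ n : ℕ, Exec 1 (.push (.inr (.inl ())) n) (Sum.elim (enc a) fun _ => [])
      (Sum.elim (enc a) (Sum.elim (fun _ : Unit => [n]) fun _ : Empty => [])) := by
    intro n
    refine .push_of_eq (by simp) ?_
    funext i
    rcases i with i | i | i
    · simp
    · simp
    · exact i.elim
  rw [Polynomial.eval_one]
  cases hc : f a
  · exact .ite_false (by rw [← hc]; exact (h a).symm) (key 0)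
  · exact .ite_true (by rw [← hc]; exact (h a).symm) (key 1)

theorem const (b : A) : PS (fun _ : α => b) := by
  refine ⟨Empty, inferInstance, inferInstance, .push (.inr (.inl ())) (FinSym.sym b), 1,
    fun a => ?_⟩
  rw [Polynomial.eval_one]
  refine .push_of_eq (by simp) ?_
  funext i
  rcases i with i | i | i
  · simp
  · cases i
    rfl
  · exact i.elim

theorem nil : PS (fun _ : α => ([] : List A)) := by
  refine ⟨Empty, inferInstance, inferInstance, .skip, 1, fun a => ?_⟩
  refine .skip_of_eq ?_
  funext i
  rcases i with i | i | i <;> simp [enc]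

theorem of_isEmpty [IsEmpty α] (f : α → β) : PS f :=
  ⟨Empty, inferInstance, inferInstance, .skip, 1, fun a => isEmptyElim a⟩

theorem cons_ : PS (fun p : A × List A => p.1 :: p.2) := by
  refine ⟨Unit, inferInstance, inferInstance, .seq
    (copy (.inl (.inr ())) (.inr (.inl ())) (.inr (.inr ()))) (.top (.inl (.inl ())) (.inr (.inl ()))),
    .X + 1, fun ⟨a, l⟩ => ?_⟩
  refine .seq (.copy (by simp) (by simp) (by simp) (by simp) (by simp) ?_) ?_
  · simp [enc]
    omega
  · refine .top_of_eq (a := FinSym.sym a) (l := []) rfl ?_ ?_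
    · simp [enc]
    · funext i
      rcases i with (i | i) | i | i <;> cases i <;> rfl

theorem tail_ : PS (List.tail : List A → List A) := by
  refine ⟨Unit, inferInstance, inferInstance, .seq
    (copy (.inl ()) (.inr (.inl ())) (.inr (.inr ()))) (.pop (.inr (.inl ()))), .X, fun l => ?_⟩
  refine .seq (.copy (by simp) (by simp) (by simp) (by simp) (by simp) ?_) ?_
  · simp [enc]
  · refine .pop_of_eq ?_
    funext i
    rcases i with i | i | i <;> cases i
    · rfl
    · exact List.map_tail
    · rfl

/-- The component programs run one after another, sharing only the preserved input registers. -/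
theorem pi {ι : Type} {β : ι → Type} [Fintype ι] [DecidableEq ι] [∀ i, RegRep (β i)]
    {f : α → ∀ i, β i} (h : ∀ i, PS (fun a => f a i)) : PS f := by
  choose κ h₁ h₂ P p h using h
  let e : ∀ i, Reg α ⊕ Reg (β i) ⊕ κ i → Reg α ⊕ (Σ i, Reg (β i)) ⊕ (Σ i, κ i) := fun i =>
    Sum.elim .inl (Sum.elim (fun r => .inr (.inl ⟨i, r⟩)) fun k => .inr (.inr ⟨i, k⟩))
  have he : ∀ i, Injective (e i) := by
    rintro i (_ | _ | _) (_ | _ | _) h <;> simp_all [e]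
  refine ⟨Σ i, κ i, inferInstance, inferInstance, (Finset.univ.toList : List ι).foldr
    (fun i Q => .seq Q ((P i).map (e i))) .skip, ∑ i, p i, fun a => ?_⟩
  have key : ∀ l : List ι, l.Nodup → Exec ((∑ i, p i).eval (size a)) (l.foldr
      (fun i Q => .seq Q ((P i).map (e i))) .skip)
      (Sum.elim (enc a) fun _ => [])
      (Sum.elim (enc a) (Sum.elim (fun r : Σ i, Reg (β i) => if r.1 ∈ l then enc (f a) r else [])
        fun _ => [])) := by
    intro l
    induction l with
    | nil =>
      intro _
      rw [List.foldr_nil]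
      refine .skip_of_eq ?_
      funext i
      rcases i with _ | _ <;> simp
    | cons i l ih =>
      intro hl
      rw [List.nodup_cons] at hl
      refine .seq (ih hl.2) (((h i a).mono ?_).map (he i) ?_ ?_ ?_)
      · rw [Polynomial.eval_finsetSum]
        exact Finset.single_le_sum (f := fun i => (p i).eval (size a)) (fun _ _ => Nat.zero_le _)
          (Finset.mem_univ i)
      · rintro (_ | _ | _)
        · rfl
        · simp [e, hl.1]
        · rfl
      · rintro (_ | _ | _)
        · rfl
        · simp [e, enc]
        · rfl
      · rintro (_ | ⟨j, r⟩ | _) hj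
        · rfl
        · have : j ≠ i := by
            rintro rfl
            exact hj (.inr (.inl r)) rfl
          simp [this]
        · rfl
  have := key Finset.univ.toList (Finset.nodup_toList _)
  simp only [Finset.mem_toList, Finset.mem_univ, if_true] at this
  exact this

/-- The branches may share their output registers because only one of them runs; the value of `c` is
kept in a flag that is cleared afterwards. -/
theorem ite {c : α → Bool} {f g : α → β} (hc : PS c) (hf : PS f) (hg : PS g) :
    PS (fun a => if c a then f a else g a) := by
  obtain ⟨κ₁, _, _, P₁, p₁, h₁⟩ := hc
  obtain ⟨κ₂, _, _, P₂, p₂, h₂⟩ := hf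
  obtain ⟨κ₃, _, _, P₃, p₃, h₃⟩ := hg
  let e₁ : Reg α ⊕ Unit ⊕ κ₁ → Reg α ⊕ Reg β ⊕ (Unit ⊕ κ₁ ⊕ κ₂ ⊕ κ₃) :=
    Sum.elim .inl (Sum.elim (fun _ => .inr (.inr (.inl ()))) fun k => .inr (.inr (.inr (.inl k))))
  let e₂ : Reg α ⊕ Reg β ⊕ κ₂ → Reg α ⊕ Reg β ⊕ (Unit ⊕ κ₁ ⊕ κ₂ ⊕ κ₃) :=
    Sum.elim .inl (Sum.elim (fun r => .inr (.inl r)) fun k => .inr (.inr (.inr (.inr (.inl k)))))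
  let e₃ : Reg α ⊕ Reg β ⊕ κ₃ → Reg α ⊕ Reg β ⊕ (Unit ⊕ κ₁ ⊕ κ₂ ⊕ κ₃) :=
    Sum.elim .inl (Sum.elim (fun r => .inr (.inl r)) fun k => .inr (.inr (.inr (.inr (.inr k)))))
  let e₄ : Unit → Reg α ⊕ Reg β ⊕ (Unit ⊕ κ₁ ⊕ κ₂ ⊕ κ₃) := fun _ => .inr (.inr (.inl ()))
  have he₁ : Injective e₁ := by rintro (_ | _ | _) (_ | _ | _) h <;> simp_all [e₁]
  have he₂ : Injective e₂ := by rintro (_ | _ | _) (_ | _ | _) h <;> simp_all [e₂]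
  have he₃ : Injective e₃ := by rintro (_ | _ | _) (_ | _ | _) h <;> simp_all [e₃]
  refine ⟨_, inferInstance, inferInstance, .seq (P₁.map e₁) (.seq
    (.ite (e₄ ()) (fun o => o == some 1) (P₂.map e₂) (P₃.map e₃)) (clear e₄)),
    p₁ + p₂ + p₃, fun a => ?_⟩
  rw [Polynomial.eval_add, Polynomial.eval_add]
  have clr : ∀ b : β, Exec (p₁.eval (size a) + p₂.eval (size a) + p₃.eval (size a)) (clear e₄)
      (Sum.elim (enc a) (Sum.elim (enc b) (Sum.elim (enc (c a)) fun _ => [])))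
      (Sum.elim (enc a) (Sum.elim (enc b) fun _ => [])) := by
    refine fun b => .clear (fun _ => rfl) ?_
    rintro (_ | _ | _ | _) hj
    all_goals first | rfl | exact (hj () rfl).elim
  refine .seq (((h₁ a).mono (by omega)).map he₁ (τ' := Sum.elim (enc a)
    (Sum.elim (fun _ => []) (Sum.elim (enc (c a)) fun _ => []))) ?_ ?_ ?_) (.seq ?_ (clr _))
  · rintro (_ | _ | _) <;> rfl
  · rintro (_ | _ | _) <;> rfl
  · rintro (_ | _ | _ | _ | _) hj
    all_goals first | rfl | exact (hj (.inr (.inl ())) rfl).elim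
  · cases hca : c a
    · beta_reduce
      rw [show (if c a then f a else g a) = g a by simp [hca]]
      refine .ite_false (by simp [e₄, enc, FinSym.sym]) (((h₃ a).mono (by omega)).map he₃ ?_ ?_ ?_)
      · rintro (_ | _ | _) <;> rfl
      · rintro (_ | _ | _) <;> rfl
      · rintro (_ | _ | _ | _ | _) hj
        all_goals first | rfl | exact (hj (.inr (.inl ())) rfl).elim | exact (hj (.inr (.inl _)) rfl).elim
    · beta_reduce
      rw [show (if c a then f a else g a) = f a by simp [hca]]
      refine .ite_true (by simp [e₄, enc, FinSym.sym]) (((h₂ a).mono (by omega)).map he₂ ?_ ?_ ?_)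
      · rintro (_ | _ | _) <;> rfl
      · rintro (_ | _ | _) <;> rfl
      · rintro (_ | _ | _ | _ | _) hj
        all_goals first | rfl | exact (hj (.inr (.inl ())) rfl).elim | exact (hj (.inr (.inl _)) rfl).elim

set_option synthInstance.maxSize 1000 in
set_option synthInstance.maxHeartbeats 100000 in
/-- While-loops whose states stay of polynomial size until they terminate. -/
theorem while_ {g : α → σ} {f : σ → σ} {c : σ → Bool} {r : α → σ} (hg : PS g) (hf : PS f)
    (hc : PS c) (p : Polynomial ℕ)
    (hrun : ∀ a, ReflTransGen (fun s s' => c s = true ∧ s' = f s ∧ size s ≤ p.eval (size a))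
      (g a) (r a)) (hexit : ∀ a, c (r a) = false) : PS r := by
  obtain ⟨qf, hqf⟩ := hf.exists_size_le
  obtain ⟨qg, hqg⟩ := hg.exists_size_le
  obtain ⟨κ₁, _, _, P₁, p₁, h₁⟩ := hg
  obtain ⟨κ₂, _, _, P₂, p₂, h₂⟩ := hf
  obtain ⟨κ₃, _, _, P₃, p₃, h₃⟩ := hc
  -- The program for the identity copies the new state from the temporary registers back to the
  -- state registers.
  obtain ⟨κ₄, _, _, P₄, p₄, h₄⟩ := PS.id (α := σ)
  let e₁ : Reg α ⊕ Reg σ ⊕ κ₁ →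
      Reg α ⊕ Reg σ ⊕ Unit ⊕ Reg σ ⊕ κ₁ ⊕ κ₂ ⊕ κ₃ ⊕ κ₄ := Sum.elim .inl (Sum.elim (fun r => .inr (.inl r))
    fun k => .inr (.inr (.inr (.inr (.inl k)))))
  let e₂ : Reg σ ⊕ Reg σ ⊕ κ₂ →
      Reg α ⊕ Reg σ ⊕ Unit ⊕ Reg σ ⊕ κ₁ ⊕ κ₂ ⊕ κ₃ ⊕ κ₄ := Sum.elim (fun r => .inr (.inl r))
    (Sum.elim (fun r => .inr (.inr (.inr (.inl r))))
    fun k => .inr (.inr (.inr (.inr (.inr (.inl k))))))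
  let e₃ : Reg σ ⊕ Unit ⊕ κ₃ →
      Reg α ⊕ Reg σ ⊕ Unit ⊕ Reg σ ⊕ κ₁ ⊕ κ₂ ⊕ κ₃ ⊕ κ₄ := Sum.elim (fun r => .inr (.inl r))
    (Sum.elim (fun _ => .inr (.inr (.inl ())))
    fun k => .inr (.inr (.inr (.inr (.inr (.inr (.inl k)))))))
  let e₄ : Reg σ ⊕ Reg σ ⊕ κ₄ →
      Reg α ⊕ Reg σ ⊕ Unit ⊕ Reg σ ⊕ κ₁ ⊕ κ₂ ⊕ κ₃ ⊕ κ₄ := Sum.elim (fun r => .inr (.inr (.inr (.inl r))))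
    (Sum.elim (fun r => .inr (.inl r))
    fun k => .inr (.inr (.inr (.inr (.inr (.inr (.inr k)))))))
  let eflag : Unit → Reg α ⊕ Reg σ ⊕ Unit ⊕ Reg σ ⊕ κ₁ ⊕ κ₂ ⊕ κ₃ ⊕ κ₄ := fun _ => .inr (.inr (.inl ()))
  let estate : Reg σ → Reg α ⊕ Reg σ ⊕ Unit ⊕ Reg σ ⊕ κ₁ ⊕ κ₂ ⊕ κ₃ ⊕ κ₄ := fun r => .inr (.inl r)
  let etmp : Reg σ → Reg α ⊕ Reg σ ⊕ Unit ⊕ Reg σ ⊕ κ₁ ⊕ κ₂ ⊕ κ₃ ⊕ κ₄ := fun r => .inr (.inr (.inr (.inl r)))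
  have he₁ : Injective e₁ := by rintro (_ | _ | _) (_ | _ | _) h <;> simp_all [e₁]
  have he₂ : Injective e₂ := by rintro (_ | _ | _) (_ | _ | _) h <;> simp_all [e₂]
  have he₃ : Injective e₃ := by rintro (_ | _ | _) (_ | _ | _) h <;> simp_all [e₃]
  have he₄ : Injective e₄ := by rintro (_ | _ | _) (_ | _ | _) h <;> simp_all [e₄]
  let st : α → σ → (Unit → List ℕ) → (Reg σ → List ℕ) →
      Reg α ⊕ Reg σ ⊕ Unit ⊕ Reg σ ⊕ κ₁ ⊕ κ₂ ⊕ κ₃ ⊕ κ₄ → List ℕ := fun a s b t =>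
    Sum.elim (enc a) (Sum.elim (enc s) (Sum.elim b (Sum.elim t fun _ => [])))
  -- The loop body clears the flag, computes the next state in temporary registers, overwrites the
  -- state and tests again. Only states that are left by a step are bounded by `p`; their successors
  -- are bounded by `qf.comp p`, and an initial state that is already final by `qg`.
  refine ⟨_, inferInstance, inferInstance, .seq (P₁.map e₁) (.seq (P₃.map e₃) (.seq
    (.loop (eflag ()) (fun o => o == some 1) (.seq (clear eflag) (.seq (P₂.map e₂)
      (.seq (clear estate) (.seq (P₄.map e₄) (.seq (clear etmp) (P₃.map e₃))))))) (clear eflag))),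
    p₁ + p₃.comp qg + (p₂.comp p + p₄.comp (qf.comp p) + p₃.comp (qf.comp p)), fun a => ?_⟩
  set B := (p₁ + p₃.comp qg + (p₂.comp p + p₄.comp (qf.comp p) +
    p₃.comp (qf.comp p))).eval (size a) with hB
  simp only [Polynomial.eval_add, Polynomial.eval_comp] at hB
  have hcond : ∀ s, p₃.eval (size s) ≤ B → Exec B (P₃.map e₃) (st a s (fun _ => []) fun _ => [])
      (st a s (enc (c s)) fun _ => []) := by
    refine fun s hs => ((h₃ s).mono hs).map he₃ ?_ ?_ ?_
    · rintro (_ | _ | _) <;> rfl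
    · rintro (_ | _ | _) <;> rfl
    · rintro (_ | _ | _ | _ | _ | _ | _ | _) hj
      all_goals first | rfl | exact (hj (.inr (.inl ())) rfl).elim
  have hflag : ∀ s b, Exec B (clear eflag) (st a s b fun _ => [])
      (st a s (fun _ => []) fun _ => []) := by
    refine fun s b => .clear (fun _ => rfl) ?_
    rintro (_ | _ | _ | _ | _ | _ | _ | _) hj
    all_goals first | rfl | exact (hj () rfl).elim
  have hloop : Exec B (.loop (eflag ()) (fun o => o == some 1) (.seq (clear eflag) (.seq (P₂.map e₂)
      (.seq (clear estate) (.seq (P₄.map e₄) (.seq (clear etmp) (P₃.map e₃)))))))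
      (st a (g a) (enc (c (g a))) fun _ => []) (st a (r a) (enc (c (r a))) fun _ => []) := by
    have hga := hrun a
    generalize g a = s₀ at hga ⊢
    induction hga using ReflTransGen.head_induction_on with
    | refl =>
      rw [hexit]
      exact .loop_exit (by simp [eflag, st, enc, FinSym.sym])
    | @head s s' hs _ ih =>
      obtain ⟨hcs, rfl, hsize⟩ := hs
      have b₂ := eval_le_eval p₂ hsize
      have b₃ := eval_le_eval p₃ ((hqf s).trans (eval_le_eval qf hsize))
      have b₄ := eval_le_eval p₄ ((hqf s).trans (eval_le_eval qf hsize))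
      refine .loop_continue (by simp [eflag, st, enc, FinSym.sym, hcs]) (.seq (hflag _ _) (.seq
        (((h₂ s).mono (b₂.trans (by omega))).map he₂
          (τ' := st a s (fun _ => []) (enc (f s))) ?_ ?_ ?_)
        (.seq (.clear (τ' := Sum.elim (enc a) (Sum.elim (fun _ => []) (Sum.elim (fun _ => [])
          (Sum.elim (enc (f s)) fun _ => [])))) ?_ ?_) (.seq
        (((h₄ (f s)).mono (b₄.trans (by omega))).map he₄
          (τ' := st a (f s) (fun _ => []) (enc (f s))) ?_ ?_ ?_)
        (.seq (.clear (τ' := st a (f s) (fun _ => []) (fun _ => [])) ?_ ?_)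
          (hcond _ (b₃.trans (by omega)))))))) ih
      · rintro (_ | _ | _) <;> rfl
      · rintro (_ | _ | _) <;> rfl
      · rintro (_ | _ | _ | _ | _ | _ | _ | _) hj
        all_goals first | rfl | exact (hj (.inr (.inl ())) rfl).elim | exact (hj (.inr (.inl _)) rfl).elim
      · exact fun _ => rfl
      · rintro (_ | _ | _ | _ | _ | _ | _ | _) hj
        all_goals first | rfl | exact (hj () rfl).elim | exact (hj _ rfl).elim
      · rintro (_ | _ | _) <;> rfl
      · rintro (_ | _ | _) <;> rfl
      · rintro (_ | _ | _ | _ | _ | _ | _ | _) hj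
        all_goals first | rfl | exact (hj (.inr (.inl ())) rfl).elim | exact (hj (.inr (.inl _)) rfl).elim
      · exact fun _ => rfl
      · rintro (_ | _ | _ | _ | _ | _ | _ | _) hj
        all_goals first | rfl | exact (hj () rfl).elim | exact (hj _ rfl).elim
  have b₃ := eval_le_eval p₃ (hqg a)
  refine .seq (((h₁ a).mono (by omega)).map he₁ (τ' := st a (g a) (fun _ => []) fun _ => [])
    ?_ ?_ ?_) (.seq (hcond _ (b₃.trans (by omega))) (.seq hloop ?_))
  · rintro (_ | _ | _) <;> rfl
  · rintro (_ | _ | _) <;> rfl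
  · rintro (_ | _ | _ | _ | _ | _ | _ | _) hj
    all_goals first | rfl | exact (hj (.inr (.inl ())) rfl).elim | exact (hj (.inr (.inl _)) rfl).elim
  · convert hflag (r a) (enc (c (r a))) using 1
    funext i
    rcases i with _ | _ | _ | _ | _ | _ | _ | _ <;> rfl

end PS

end

/-! ### Case distinctions, folds and list operations. -/

noncomputable section

open RegRep Function Relation

namespace PS

variable {α β γ δ σ A A' : Type} [RegRep α] [RegRep β] [RegRep γ] [RegRep δ] [RegRep σ]
  [FinSym A] [FinSym A']

theorem cons {x : α → A} {l : α → List A} (hx : PS x) (hl : PS l) : PS (fun a => x a :: l a) :=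
  cons_.comp (hx.pair hl)

theorem tail {l : α → List A} (hl : PS l) : PS (fun a => (l a).tail) := tail_.comp hl

/-- No computability of `c` is needed: programs may use any test of the top symbol, and the encoding
of symbols is injective. -/
theorem test_sym (c : A → Bool) {x : α → A} (hx : PS x) : PS (fun a => c (x a)) := by
  classical
  refine comp (g := c) (test () (fun o => decide (∃ a, o = some (FinSym.sym a) ∧ c a)) ?_) hx
  intro a
  rw [Bool.eq_iff_iff, decide_eq_true_iff]
  refine ⟨fun h => ⟨a, rfl, h⟩, ?_⟩
  rintro ⟨b, hb, h⟩
  rw [FinSym.inj (Option.some.inj hb)]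
  exact h

theorem test_head (c : Option A → Bool) {l : α → List A} (hl : PS l) :
    PS (fun a => c (l a).head?) := by
  classical
  refine comp (g := fun l : List A => c l.head?)
    (test () (fun o => decide (∃ o', o = Option.map FinSym.sym o' ∧ c o')) ?_) hl
  intro l
  rw [Bool.eq_iff_iff, decide_eq_true_iff]
  have : (enc l ()).head? = l.head?.map FinSym.sym := List.head?_map
  rw [this]
  refine ⟨fun h => ⟨_, rfl, h⟩, ?_⟩
  rintro ⟨b, hb, h⟩
  rwa [Option.map_injective FinSym.inj hb]

/-- Case distinction over a finite type. -/
theorem cases_of_test {ι : Type} [Finite ι] [DecidableEq ι] {x : α → ι} {F : ι → α → β}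
    (hx : ∀ i, PS (fun a => decide (x a = i))) (hF : ∀ i, PS (F i)) :
    PS (fun a => F (x a) a) := by
  cases nonempty_fintype ι
  rcases isEmpty_or_nonempty ι with h | ⟨⟨i₀⟩⟩
  · have : IsEmpty α := ⟨fun a => h.elim (x a)⟩
    exact of_isEmpty _
  -- The values are tested one by one; `i₀` only supplies a default for values outside `s`.
  · have key : ∀ s : Finset ι, PS (fun a => if x a ∈ s then F (x a) a else F i₀ a) := by
      intro s
      induction s using Finset.induction_on with
      | empty => simpa using hF i₀
      | insert i s _ ih =>
        convert ite (hx i) (hF i) ih using 2 with a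
        by_cases h : x a = i
        · subst h
          simp
        · simp [h]
    simpa using key Finset.univ

theorem cases {x : α → A} {F : A → α → β} (hx : PS x) (hF : ∀ i, PS (F i)) :
    PS (fun a => F (x a) a) := by
  classical
  exact cases_of_test (fun i => test_sym (fun y => decide (y = i)) hx) hF

theorem map_sym (h : A → A') {x : α → A} (hx : PS x) : PS (fun a => h (x a)) :=
  cases (F := fun x _ => h x) hx fun _ => const _

theorem map_sym₂ {A'' : Type} [FinSym A''] (h : A → A' → A'') {x : α → A} {y : α → A'} (hx : PS x)
    (hy : PS y) : PS (fun a => h (x a) (y a)) :=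
  cases (F := fun x a => h x (y a)) hx fun _ => map_sym _ hy

theorem head? {l : α → List A} (hl : PS l) : PS (fun a => (l a).head?) := by
  classical
  exact cases_of_test (F := fun o _ => o) (fun i => test_head (fun o => decide (o = i)) hl)
    fun _ => const _

/-- Folds over a list, whose intermediate results have polynomial size. -/
theorem foldl {l : α → List A} {s : α → σ} {F : α → σ → A → σ} (hl : PS l) (hs : PS s)
    (hF : ∀ x, PS (fun p : α × σ => F p.1 p.2 x)) (p : Polynomial ℕ)
    (hp : ∀ a l', l' <+: l a → size (l'.foldl (F a) (s a)) ≤ p.eval (size a)) :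
    PS (fun a => (l a).foldl (F a) (s a)) := by
  obtain ⟨q, hq⟩ := hl.exists_size_le
  -- A loop body sees nothing but its state, so the input `a` is carried along in it.
  let step : (α × σ) × List A → (α × σ) × List A := fun t =>
    ((t.1.1, t.2.head?.elim t.1.2 fun x => F t.1.1 t.1.2 x), t.2.tail)
  have hstep : PS step := by
    refine pair (pair (fst (fst .id)) ?_) (tail (snd .id))
    refine cases (x := fun t : (α × σ) × List A => t.2.head?)
      (F := fun o t => o.elim t.1.2 fun x => F t.1.1 t.1.2 x) (head? (snd .id)) ?_
    rintro (_ | x)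
    · exact snd (fst .id)
    · exact (hF x).comp (fst .id)
  have := while_ (g := fun a => ((a, s a), l a)) (f := step) (c := fun t => t.2.head?.isSome)
    (r := fun a => ((a, (l a).foldl (F a) (s a)), [])) ((id.pair hs).pair hl) hstep
    (test_head Option.isSome (snd .id)) (.X + p + q) (fun a => ?_) (fun a => rfl)
  · exact snd (fst this)
  · have key : ∀ l₂ l₁, l₁ ++ l₂ = l a → ReflTransGen (fun t t' : (α × σ) × List A =>
        t.2.head?.isSome = true ∧ t' = step t ∧ size t ≤ (.X + p + q).eval (size a))
        ((a, l₁.foldl (F a) (s a)), l₂) ((a, (l a).foldl (F a) (s a)), []) := by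
      intro l₂
      induction l₂ with
      | nil =>
        intro l₁ h
        rw [← h, List.append_nil]
      | cons x l₂ ih =>
        intro l₁ h
        refine .head ⟨rfl, rfl, ?_⟩ ?_
        · have h₁ := hp a l₁ ⟨_, h⟩
          have h₂ := hq a
          rw [size_list] at h₂
          have h₃ : (x :: l₂).length ≤ (l a).length := by
            rw [← h, List.length_append]
            exact Nat.le_add_left _ _
          rw [size_prod, size_prod, size_list]
          simp only [Polynomial.eval_add, Polynomial.eval_X]
          omega
        · have := ih (l₁ ++ [x]) (by simpa using h)
          simpa [step] using this
    exact key (l a) [] rfl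

/-- Folds over a list, each step of which increases the size by a polynomial at most. -/
theorem foldl_of_le {l : α → List A} {s : α → σ} {F : α → σ → A → σ} (hl : PS l) (hs : PS s)
    (hF : ∀ x, PS (fun p : α × σ => F p.1 p.2 x)) (p : Polynomial ℕ)
    (hp : ∀ a s x, size (F a s x) ≤ size s + p.eval (size a)) :
    PS (fun a => (l a).foldl (F a) (s a)) := by
  obtain ⟨q₁, hq₁⟩ := hl.exists_size_le
  obtain ⟨q₂, hq₂⟩ := hs.exists_size_le
  refine foldl hl hs hF (q₂ + q₁ * p) fun a l' hl' => ?_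
  have key : ∀ (l' : List A) t, size (l'.foldl (F a) t) ≤ size t + l'.length * p.eval (size a) := by
    intro l'
    induction l' with
    | nil => simp
    | cons x l' ih =>
      intro t
      have h₁ := ih (F a t x)
      have h₂ := hp a t x
      simp only [List.foldl_cons, List.length_cons]
      linarith
  have h₁ := hl'.length_le
  have h₂ := hq₁ a
  rw [size_list] at h₂
  have h₃ := Nat.mul_le_mul_right (p.eval (size a)) (h₁.trans h₂)
  have := key l' (s a)
  have := hq₂ a
  simp only [Polynomial.eval_add, Polynomial.eval_mul]
  omega

theorem and {x y : α → Bool} (hx : PS x) (hy : PS y) : PS (fun a => x a && y a) :=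
  map_sym₂ _ hx hy

theorem reverse {l : α → List A} (hl : PS l) : PS (fun a => (l a).reverse) := by
  have := foldl_of_le (F := fun _ s x => x :: s) hl nil (fun x => (const x).cons (snd .id)) 1
    (by simp)
  simpa using this

theorem append {l₁ l₂ : α → List A} (h₁ : PS l₁) (h₂ : PS l₂) : PS (fun a => l₁ a ++ l₂ a) := by
  have := foldl_of_le (F := fun _ s x => x :: s) h₁.reverse h₂ (fun x => (const x).cons (snd .id)) 1
    (by simp)
  convert this using 2 with a
  simp

/-- `splitRev n l` splits off the first `n` elements of a list, in reverse order. -/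
theorem splitRev {u : α → List A'} {l : α → List A} (hu : PS u) (hl : PS l) :
    PS (fun a => (((l a).take (u a).length).reverse, (l a).drop (u a).length)) := by
  have := foldl_of_le (σ := List A × List A) (F := fun _ s (_ : A') =>
    (s.2.head?.elim s.1 fun x => x :: s.1, s.2.tail)) hu (nil.pair hl) (fun x => ?_) 1 ?_
  · convert this using 2 with a
    have key : ∀ (u : List A') (l₁ l₂ : List A), u.foldl (fun s (_ : A') =>
        (s.2.head?.elim s.1 fun x => x :: s.1, s.2.tail)) (l₁, l₂) =
        ((l₂.take u.length).reverse ++ l₁, l₂.drop u.length) := by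
      intro u
      induction u with
      | nil => simp
      | cons x u ih =>
        intro l₁ l₂
        cases l₂ <;> simp [ih]
    rw [key, List.append_nil]
  · refine pair ?_ (tail (snd (snd .id)))
    refine cases (x := fun p : α × List A × List A => p.2.2.head?)
      (F := fun o p => o.elim p.2.1 fun x => x :: p.2.1) (head? (snd (snd .id))) ?_
    rintro (_ | x)
    · exact fst (snd .id)
    · exact (const x).cons (fst (snd .id))
  · rintro _ ⟨l₁, _ | ⟨x, l₂⟩⟩ _ <;> simp
    omega

theorem take {u : α → List A'} {l : α → List A} (hu : PS u) (hl : PS l) :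
    PS (fun a => (l a).take (u a).length) := by
  simpa using (fst (splitRev hu hl)).reverse

theorem drop {u : α → List A'} {l : α → List A} (hu : PS u) (hl : PS l) :
    PS (fun a => (l a).drop (u a).length) := snd (splitRev hu hl)

/-- The fold over `l₁` consumes `l₂` in step with it. A too short `l₂` fails the comparison of
heads, and a too long one leaves a remainder, which is tested at the end. -/
theorem beqList [DecidableEq A] {l₁ l₂ : α → List A} (h₁ : PS l₁) (h₂ : PS l₂) :
    PS (fun a => decide (l₁ a = l₂ a)) := by
  have := foldl_of_le (σ := Bool × List A) (F := fun _ s (x : A) =>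
    (s.1 && decide (s.2.head? = some x), s.2.tail)) h₁ ((const true).pair h₂) (fun x => ?_) 1 ?_
  · convert (fst this).and (test_head (fun o => !o.isSome) (snd this)) using 2 with a
    have key : ∀ (l₁ l₂ : List A) b, ((l₁.foldl (fun s (x : A) =>
        (s.1 && decide (s.2.head? = some x), s.2.tail)) (b, l₂)).1 && !((l₁.foldl (fun s (x : A) =>
        (s.1 && decide (s.2.head? = some x), s.2.tail)) (b, l₂)).2.head?).isSome) =
        (b && decide (l₁ = l₂)) := by
      intro l₁
      induction l₁ with
      | nil =>
        intro l₂ b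
        cases l₂ <;> simp
      | cons x l₁ ih =>
        intro l₂ b
        rw [List.foldl_cons, ih]
        rcases l₂ with _ | ⟨y, l₂⟩
        · simp
        · by_cases h : y = x
          · simp [h]
          · simp [h, Ne.symm h]
    exact (by simpa using (key (l₁ a) (l₂ a) true).symm)
  · exact (and (fst (snd .id)) (test_head (fun o => decide (o = some x)) (snd (snd .id)))).pair
      (tail (snd (snd .id)))
  · rintro _ ⟨b, l⟩ _
    simp
    omega

theorem map (h : A → A') {l : α → List A} (hl : PS l) : PS (fun a => (l a).map h) := by
  have := foldl_of_le (F := fun _ s (x : A) => h x :: s) hl nil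
    (fun x => (const (h x)).cons (snd .id)) 1 (by simp)
  convert this.reverse using 2 with a
  rw [← List.foldl_map (f := h) (g := fun s x => x :: s)]
  simp

theorem constList (l : List A) : PS (fun _ : α => l) := by
  induction l with
  | nil => exact nil
  | cons x l ih => exact (const x).cons ih

/-- Supplies polynomial clocks in unary. Raising the degree of a monomial means repeating its string
once for every symbol of `l`. -/
theorem replicate_eval (p : Polynomial ℕ) {l : α → List A} (hl : PS l) :
    PS (fun a => List.replicate (p.eval (l a).length) true) := by
  induction p using Polynomial.induction_on with
  | C n => simpa using constList (List.replicate n true)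
  | add p q hp hq => simpa [← List.replicate_append_replicate] using hp.append hq
  | monomial n m h =>
    obtain ⟨q, hq⟩ := h.exists_size_le
    have := foldl_of_le (l := l) (s := fun _ => []) (F := fun a s (_ : A) =>
      List.replicate ((Polynomial.C m * .X ^ n).eval (l a).length) true ++ s) hl nil
      (fun x => (h.comp (fst .id)).append (snd .id)) q (fun a s x => ?_)
    · convert this using 2 with a
      have key : ∀ (u : List A) (k : ℕ) (s : List Bool),
          u.foldl (fun s _ => List.replicate k true ++ s) s =
          List.replicate (k * u.length) true ++ s := by
        intro u
        induction u with
        | nil => simp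
        | cons x u ih =>
          intro k s
          rw [List.foldl_cons, ih, ← List.append_assoc, List.replicate_append_replicate]
          rfl
      rw [key, List.append_nil]
      congr 1
      simp [pow_succ, mul_assoc]
    · have := hq a
      rw [size_list, List.length_replicate] at this
      rw [size_list, size_list, List.length_append, List.length_replicate]
      omega

end PS

end

noncomputable section

open RegRep Function Relation Turing Turing.TM2

/-! ### Simulation of stack machines -/

namespace StackSim

variable {K : Type} [DecidableEq K] {Γ : K → Type} {Λ σ : Type}

/-- The symbols that a statement may push on a stack. -/
def pushed : Stmt Γ Λ σ → ∀ k, Set (Γ k)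
  | .push k' f q, k => pushed q k ∪ if h : k' = k then Set.range fun v => h ▸ f v else ∅
  | .peek _ _ q, k | .pop _ _ q, k | .load _ q, k => pushed q k
  | .branch _ q₁ q₂, k => pushed q₁ k ∪ pushed q₂ k
  | .goto _, _ | .halt, _ => ∅

theorem finite_pushed [Finite σ] (k : K) : ∀ q : Stmt Γ Λ σ, (pushed q k).Finite
  | .push k' f q => by
    rw [pushed]
    refine (finite_pushed k q).union ?_
    split_ifs with h
    · exact Set.finite_range _
    · exact Set.finite_empty
  | .peek _ _ q | .pop _ _ q | .load _ q => finite_pushed k q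
  | .branch _ q₁ q₂ => (finite_pushed k q₁).union (finite_pushed k q₂)
  | .goto _ | .halt => Set.finite_empty

/-- The number of pushes in a statement. -/
def pushCount : Stmt Γ Λ σ → ℕ
  | .push _ _ q => pushCount q + 1
  | .peek _ _ q | .pop _ _ q | .load _ q => pushCount q
  | .branch _ q₁ q₂ => pushCount q₁ + pushCount q₂
  | .goto _ | .halt => 0

variable (F : ∀ k, Set (Γ k))

/-- Configurations with symbols in given sets. -/
abbrev SCfg (Λ σ : Type) : Type := (Option Λ × σ) × ∀ k, List (F k)

variable {F}

/-- The underlying configuration of the machine. -/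
def real (s : SCfg F Λ σ) : Cfg Γ Λ σ := ⟨s.1.1, s.1.2, fun k => (s.2 k).map Subtype.val⟩

open Classical in
/-- Execution of a statement. -/
def simAux : Stmt Γ Λ σ → σ → (∀ k, List (F k)) → SCfg F Λ σ
  | .push k f q, v, T =>
    simAux q v (if h : f v ∈ F k then update T k (⟨f v, h⟩ :: T k) else T)
  | .peek k f q, v, T => simAux q (f v ((T k).head?.map Subtype.val)) T
  | .pop k f q, v, T => simAux q (f v ((T k).head?.map Subtype.val)) (update T k (T k).tail)
  | .load a q, v, T => simAux q (a v) T
  | .branch f q₁ q₂, v, T => if f v then simAux q₁ v T else simAux q₂ v T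
  | .goto f, v, T => ((some (f v), v), T)
  | .halt, v, T => ((none, v), T)

theorem real_simAux (q : Stmt Γ Λ σ) (hq : ∀ k, pushed q k ⊆ F k) (v : σ)
    (T : ∀ k, List (F k)) :
    real (simAux q v T) = stepAux q v fun k => (T k).map Subtype.val := by
  have hupd : ∀ (T : ∀ k, List (F k)) k (l : List (F k)),
      (fun j => (update T k l j).map Subtype.val) =
        update (fun j => (T j).map Subtype.val) k (l.map Subtype.val) := by
    intro T k l
    funext j
    rcases eq_or_ne j k with rfl | hj
    · simp
    · simp [hj]
  induction q generalizing v T with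
  | push k f q ih =>
    have h : f v ∈ F k := hq k (by
      rw [pushed]
      exact .inr (by simp))
    rw [simAux, ih (fun k => Set.subset_union_left.trans (hq k)), dif_pos h, hupd]
    rfl
  | peek k f q ih =>
    rw [simAux, ih hq, ← List.head?_map]
    rfl
  | pop k f q ih =>
    rw [simAux, ih hq, ← List.head?_map, hupd, List.map_tail]
    rfl
  | load a q ih =>
    rw [simAux, ih hq]
    rfl
  | branch f q₁ q₂ ih₁ ih₂ =>
    rw [simAux, stepAux]
    cases f v
    · exact ih₂ (fun k => Set.subset_union_right.trans (hq k)) _ _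
    · exact ih₁ (fun k => Set.subset_union_left.trans (hq k)) _ _
  | goto f => rfl
  | halt => rfl

section Rep

variable [Fintype K] [FinSym Λ] [FinSym σ] [∀ k, FinSym (F k)]

/-- The `2` accounts for the label and the internal state. -/
theorem size_simAux (q : Stmt Γ Λ σ) (v : σ) (T : ∀ k, List (F k)) :
    size (simAux q v T) ≤ size T + 2 + pushCount q := by
  have hupd : ∀ (T : ∀ k, List (F k)) k (l : List (F k)), l.length ≤ (T k).length + 1 →
      size (update T k l) ≤ size T + 1 := by
    intro T k l h
    rw [size_pi, size_pi, Finset.sum_eq_add_sum_sdiff_singleton_of_mem (Finset.mem_univ k),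
      Finset.sum_eq_add_sum_sdiff_singleton_of_mem (Finset.mem_univ k) (fun i => size (T i))]
    have : ∑ i ∈ Finset.univ \ {k}, size (update T k l i) = ∑ i ∈ Finset.univ \ {k}, size (T i) := by
      refine Finset.sum_congr rfl fun i hi => ?_
      rw [update_of_ne (by simpa using hi)]
    rw [this, update_self, size_list, size_list]
    omega
  have hupd' : ∀ (T : ∀ k, List (F k)) k, size (update T k (T k).tail) ≤ size T := by
    intro T k
    rw [size_pi, size_pi]
    refine Finset.sum_le_sum fun i _ => ?_
    rcases eq_or_ne i k with rfl | h
    · simp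
    · rw [update_of_ne h]
  induction q generalizing v T with
  | push k f q ih =>
    rw [simAux, pushCount]
    refine (ih _ _).trans ?_
    split_ifs with h
    · have := hupd T k (⟨f v, h⟩ :: T k) le_rfl
      omega
    · omega
  | peek k f q ih => exact ih _ _
  | pop k f q ih =>
    refine (ih _ _).trans ?_
    have := hupd' T k
    rw [pushCount]
    omega
  | load a q ih => exact ih _ _
  | branch f q₁ q₂ ih₁ ih₂ =>
    rw [simAux, pushCount]
    have := ih₁ v T
    have := ih₂ v T
    split_ifs <;> omega
  | goto f => simp [simAux, pushCount]; omega
  | halt => simp [simAux, pushCount]; omega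

theorem ps_update (k : K) {l : (∀ k, List (F k)) → List (F k)} (hl : PS l) :
    PS (fun T : ∀ k, List (F k) => update T k (l T)) := by
  refine PS.pi fun i => ?_
  rcases eq_or_ne i k with rfl | h
  · simpa using hl
  · simpa [h] using PS.apply_ i

/-- The internal state `v` is a parameter and not an input. Reading a symbol becomes a case
distinction over a finite alphabet, so the machine's own functions are only evaluated at constants.
-/
theorem ps_simAux (q : Stmt Γ Λ σ) (v : σ) : PS (simAux (F := F) q v) := by
  induction q generalizing v with
  | push k f q ih =>
    by_cases h : f v ∈ F k
    · have := (ih v).comp (ps_update k ((PS.const (⟨f v, h⟩ : F k)).cons (PS.apply_ k)))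
      rwa [show simAux (F := F) (.push k f q) v = fun T => simAux q v (update T k
        (⟨f v, h⟩ :: T k)) by funext T; rw [simAux, dif_pos h]]
    · rw [show simAux (F := F) (.push k f q) v = fun T => simAux q v T by
        funext T; rw [simAux, dif_neg h]]
      exact ih v
  | peek k f q ih =>
    exact PS.cases (x := fun T : ∀ k, List (F k) => (T k).head?)
      (F := fun o T => simAux q (f v (o.map Subtype.val)) T) (PS.head? (PS.apply_ k))
      fun o => ih _
  | pop k f q ih =>
    exact PS.cases (x := fun T : ∀ k, List (F k) => (T k).head?)
      (F := fun o T => simAux q (f v (o.map Subtype.val)) (update T k (T k).tail))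
      (PS.head? (PS.apply_ k)) fun o => (ih _).comp (ps_update k (PS.tail (PS.apply_ k)))
  | load a q ih => exact ih _
  | branch f q₁ q₂ ih₁ ih₂ =>
    cases h : f v
    · rw [show simAux (F := F) (.branch f q₁ q₂) v = simAux q₂ v by funext T; rw [simAux, h]; rfl]
      exact ih₂ v
    · rw [show simAux (F := F) (.branch f q₁ q₂) v = simAux q₁ v by funext T; rw [simAux, h]; rfl]
      exact ih₁ v
  | goto f => exact ((PS.const (some (f v))).pair (PS.const v)).pair .id
  | halt => exact ((PS.const none).pair (PS.const v)).pair .id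

variable (M : Λ → Stmt Γ Λ σ)

/-- One step of the machine; halted configurations are repeated. -/
def simStep (s : SCfg F Λ σ) : SCfg F Λ σ := s.1.1.elim s fun l => simAux (M l) s.1.2 s.2

theorem ps_simStep : PS (simStep (F := F) M) := by
  refine PS.cases (x := fun s : SCfg F Λ σ => s.1.1)
    (F := fun o s => o.elim s fun l => simAux (M l) s.1.2 s.2) (.fst (.fst .id)) ?_
  rintro (_ | l)
  · exact .id
  · exact PS.cases (x := fun s : SCfg F Λ σ => s.1.2) (F := fun v s => simAux (M l) v s.2)
      (.snd (.fst .id)) fun v => (ps_simAux (M l) v).comp (.snd .id)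

/-- Each step adds at most the total number of pushes in the code, so space is bounded by the
initial size plus a multiple of time. A machine that halts too early yields `none`, which
contradicts the final configuration `d`. -/
theorem reaches_of_iterate [Fintype Λ] (hM : ∀ l k, pushed (M l) k ⊆ F k) {B : ℕ} {d : Cfg Γ Λ σ} :
    ∀ (n : ℕ) (s : SCfg F Λ σ), size s + n * ∑ l, pushCount (M l) ≤ B →
      (flip Bind.bind (step M))^[n] (some (real s)) = some d →
      ∃ s', real s' = d ∧ ReflTransGen
        (fun s s' : SCfg F Λ σ => s.1.1.isSome = true ∧ s' = simStep M s ∧ size s ≤ B) s s'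
  | 0, s, _, h => ⟨s, Option.some.inj h, .refl⟩
  | n + 1, s, hB, h => by
    rw [iterate_succ_apply] at h
    obtain ⟨⟨_ | l, v⟩, T⟩ := s
    · have : ∀ n, (flip Bind.bind (step M))^[n] none = none := fun n => iterate_fixed rfl n
      change (flip Bind.bind (step M))^[n] none = some d at h
      rw [this] at h
      cases h
    · have hs : flip Bind.bind (step M) (some (real ((some l, v), T))) =
          some (real (simAux (M l) v T)) := by
        rw [real_simAux _ (hM l)]
        rfl
      rw [hs] at h
      have h₁ := size_simAux (M l) v T
      have h₂ : pushCount (M l) ≤ ∑ l, pushCount (M l) :=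
        Finset.single_le_sum (f := fun l => pushCount (M l)) (fun _ _ => Nat.zero_le _)
          (Finset.mem_univ l)
      simp only [size_prod, size_sym] at hB
      obtain ⟨s', hs', r⟩ := reaches_of_iterate hM n _ (by linarith) h
      refine ⟨s', hs', .head ⟨rfl, rfl, ?_⟩ r⟩
      simp only [size_prod, size_sym]
      exact (Nat.le_add_right _ _).trans hB

end Rep

end StackSim

open StackSim in
/-- Polynomial-time computable functions are computable in polynomial space. -/
theorem PS.of_polyTime {β : Type} {eb : β → List Bool} {f : List Bool → β}
    (h : TM2ComputableInPolyTime (_root_.id : List Bool → List Bool) eb f) :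
    PS (fun x => eb (f x)) := by
  obtain ⟨⟨tm, ei, eo⟩, time, hout⟩ := h
  dsimp only [_root_.id] at ei eo hout
  have := tm.kFin
  have := tm.ΛFin
  have := tm.σFin
  have := tm.Γk₀Fin
  -- The alphabets other than that of the input stack may be infinite. Only symbols that some
  -- statement pushes, or that belong to the input alphabet, can occur, and these are finitely many.
  let F : ∀ k, Set (tm.Γ k) := fun k => {x | (∃ l, x ∈ pushed (tm.m l) k) ∨ k = tm.k₀}
  have hF : ∀ k, (F k).Finite := by
    intro k
    rcases eq_or_ne k tm.k₀ with rfl | hk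
    · exact Set.toFinite _
    · refine (Set.finite_iUnion fun l => finite_pushed k (tm.m l)).subset fun x hx => ?_
      rcases hx with ⟨l, hl⟩ | hx
      · exact Set.mem_iUnion.2 ⟨l, hl⟩
      · exact (hk hx).elim
  let : ∀ k, FinSym (F k) := fun k => @FinSym.ofFinite _ (hF k)
  let := FinSym.ofFinite tm.Λ
  let := FinSym.ofFinite tm.σ
  let T₀ : List Bool → ∀ k, List (F k) := fun x k =>
    if hk : k = tm.k₀ then x.map fun b => ⟨hk ▸ ei.symm b, .inr hk⟩ else []
  have hT₀ : PS T₀ := by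
    refine PS.pi fun k => ?_
    by_cases hk : k = tm.k₀
    · simpa only [T₀, hk, dite_true] using PS.map _ .id
    · simpa only [T₀, hk, dite_false] using PS.nil
  let g : List Bool → SCfg F tm.Λ tm.σ := fun x => ((some tm.main, tm.initialState), T₀ x)
  have hg : PS g := ((PS.const _).pair (PS.const _)).pair hT₀
  have hreal : ∀ x, real (g x) = initList tm (x.map ei.invFun) := by
    intro x
    simp only [real, g, initList]
    congr 1
    funext k
    by_cases hk : k = tm.k₀
    · subst hk
      simp only [T₀, dite_true, List.map_map]
      rfl
    · simp [T₀, hk]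
  obtain ⟨q, hq⟩ := hg.exists_size_le
  let p : Polynomial ℕ := q + time * (∑ l, pushCount (tm.m l) : ℕ)
  have key : ∀ x, ∃ s' : SCfg F tm.Λ tm.σ, real s' = haltList tm ((eb (f x)).map eo.invFun) ∧
      ReflTransGen (fun s s' : SCfg F tm.Λ tm.σ => s.1.1.isSome = true ∧ s' = simStep tm.m s ∧
        size s ≤ p.eval (size x)) (g x) s' := by
    intro x
    obtain ⟨⟨n, hn⟩, hnt⟩ := hout x
    refine reaches_of_iterate tm.m (fun l k y hy => .inl ⟨l, hy⟩) n (g x) ?_ ?_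
    · have h₁ := hq x
      have h₂ := Nat.mul_le_mul_right (∑ l, pushCount (tm.m l)) hnt
      simp only [p, Polynomial.eval_add, Polynomial.eval_mul, size_list,
        Polynomial.eval_natCast] at h₁ h₂ ⊢
      exact Nat.add_le_add h₁ h₂
    · rw [hreal]
      exact hn
  choose r hr hrun using key
  have hps : PS r := PS.while_ (c := fun s : SCfg F tm.Λ tm.σ => s.1.1.isSome) hg
    (ps_simStep tm.m) (PS.map_sym _ (.fst (.fst .id))) p hrun fun x => by
      have : (r x).1.1 = none := congrArg Cfg.l (hr x)
      rw [this]
      rfl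
  have := PS.map (fun y : F tm.k₁ => eo y.1) ((PS.apply_ tm.k₁).comp (PS.snd hps))
  convert this using 2 with x
  have h₁ : ((r x).2 tm.k₁).map Subtype.val = _ := congrFun (congrArg Cfg.stk (hr x)) tm.k₁
  rw [show (fun y : F tm.k₁ => eo y.1) = eo ∘ Subtype.val from rfl, ← List.map_map, h₁]
  simp [haltList]

end

noncomputable section

open RegRep Function Relation

/-! ### Evaluation of quantified Boolean formulas -/

/-- The truth value of a quantified Boolean formula with quantifier prefix `qs` (`true` for `∃`)
and matrix `φ`; the values of the variables are pushed on a stack. -/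
def qeval (φ : List Bool → Bool) : List Bool → List Bool → Bool
  | [], y => φ y
  | q :: qs, y =>
    if q then qeval φ qs (false :: y) || qeval φ qs (true :: y)
    else qeval φ qs (false :: y) && qeval φ qs (true :: y)

/-- Values are pushed, so the variable quantified first is the last entry of `w`; hence `w` is split
at its end. -/
theorem qeval_exists (φ : List Bool → Bool) (n : ℕ) (qs y : List Bool) :
    qeval φ (List.replicate n true ++ qs) y = true ↔
      ∃ w : List Bool, w.length = n ∧ qeval φ qs (w ++ y) = true := by
  induction n generalizing y with
  | zero => simp
  | succ n ih =>
    simp only [List.replicate_succ, List.cons_append, qeval, if_true, Bool.or_eq_true, ih]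
    constructor
    · rintro (⟨w, rfl, h⟩ | ⟨w, rfl, h⟩)
      · exact ⟨w ++ [false], by simp, by simpa using h⟩
      · exact ⟨w ++ [true], by simp, by simpa using h⟩
    · rintro ⟨w, hw, h⟩
      obtain rfl | ⟨w', b, rfl⟩ := w.eq_nil_or_concat'
      · simp at hw
      · cases b
        · exact .inl ⟨w', by simpa using hw, by simpa using h⟩
        · exact .inr ⟨w', by simpa using hw, by simpa using h⟩

theorem qeval_forall (φ : List Bool → Bool) (n : ℕ) (qs y : List Bool) :
    qeval φ (List.replicate n false ++ qs) y = true ↔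
      ∀ w : List Bool, w.length = n → qeval φ qs (w ++ y) = true := by
  induction n generalizing y with
  | zero => simp
  | succ n ih =>
    simp only [List.replicate_succ, List.cons_append, qeval, Bool.false_eq_true, if_false,
      Bool.and_eq_true, ih]
    constructor
    · rintro ⟨h₁, h₂⟩ w hw
      obtain rfl | ⟨w', b, rfl⟩ := w.eq_nil_or_concat'
      · simp at hw
      · cases b
        · simpa using h₁ w' (by simpa using hw)
        · simpa using h₂ w' (by simpa using hw)
    · intro h
      exact ⟨fun w hw => by simpa using h (w ++ [false]) (by simpa using hw),
        fun w hw => by simpa using h (w ++ [true]) (by simpa using hw)⟩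

namespace QSearch

variable {α : Type} [RegRep α]

/-- States of the depth-first search: the remaining quantifiers, the quantifiers and the values of
the variables set so far, and the value of the subformula when the search returns. -/
abbrev State (α : Type) : Type := α × (List Bool × List Bool × List Bool) × Option Bool

variable (φ : α → List Bool → Bool)

/-- One step of the depth-first search. -/
def step (s : State α) : State α :=
  s.2.2.elim
    (s.2.1.1.head?.elim (s.1, s.2.1, some (φ s.1 s.2.1.2.2)) fun q =>
      (s.1, (s.2.1.1.tail, q :: s.2.1.2.1, false :: s.2.1.2.2), none))
    fun v => s.2.1.2.1.head?.elim s fun q =>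
      if v != q && s.2.1.2.2.head? != some true then
        (s.1, (s.2.1.1, s.2.1.2.1, true :: s.2.1.2.2.tail), none)
      else (s.1, (q :: s.2.1.1, s.2.1.2.1.tail, s.2.1.2.2.tail), some v)

theorem ps_step (hφ : PS fun p : α × List Bool => φ p.1 p.2) : PS (step φ) := by
  have h₁ : PS fun s : State α => s.1 := .fst .id
  have htodo : PS fun s : State α => s.2.1.1 := .fst (.fst (.snd .id))
  have hdq : PS fun s : State α => s.2.1.2.1 := .fst (.snd (.fst (.snd .id)))
  have hdb : PS fun s : State α => s.2.1.2.2 := .snd (.snd (.fst (.snd .id)))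
  refine PS.cases (x := fun s : State α => s.2.2) (F := fun o s => o.elim
    (s.2.1.1.head?.elim (s.1, s.2.1, some (φ s.1 s.2.1.2.2)) fun q =>
      (s.1, (s.2.1.1.tail, q :: s.2.1.2.1, false :: s.2.1.2.2), none))
    fun v => s.2.1.2.1.head?.elim s fun q =>
      if v != q && s.2.1.2.2.head? != some true then
        (s.1, (s.2.1.1, s.2.1.2.1, true :: s.2.1.2.2.tail), none)
      else (s.1, (q :: s.2.1.1, s.2.1.2.1.tail, s.2.1.2.2.tail), some v)) (.snd (.snd .id)) ?_
  rintro (_ | v)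
  · refine PS.cases (x := fun s : State α => s.2.1.1.head?) (F := fun o s => o.elim
      (s.1, s.2.1, some (φ s.1 s.2.1.2.2)) fun q =>
        (s.1, (s.2.1.1.tail, q :: s.2.1.2.1, false :: s.2.1.2.2), none)) htodo.head? ?_
    rintro (_ | q)
    · exact h₁.pair ((PS.fst (.snd .id)).pair (PS.map_sym some (hφ.comp (h₁.pair hdb))))
    · exact h₁.pair ((htodo.tail.pair (((PS.const q).cons hdq).pair
        ((PS.const false).cons hdb))).pair (PS.const none))
  · refine PS.cases (x := fun s : State α => s.2.1.2.1.head?) (F := fun o s => o.elim s fun q =>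
      if v != q && s.2.1.2.2.head? != some true then
        (s.1, (s.2.1.1, s.2.1.2.1, true :: s.2.1.2.2.tail), none)
      else (s.1, (q :: s.2.1.1, s.2.1.2.1.tail, s.2.1.2.2.tail), some v)) hdq.head? ?_
    rintro (_ | q)
    · exact .id
    · exact PS.ite (PS.test_head (fun o => v != q && o != some true) hdb)
        (h₁.pair ((htodo.pair (hdq.pair ((PS.const true).cons hdb.tail))).pair (PS.const none)))
        (h₁.pair ((((PS.const q).cons htodo).pair (hdq.tail.pair hdb.tail)).pair
          (PS.const (some v))))

/-- The search continues unless it returns from the outermost quantifier. -/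
def cond (s : State α) : Bool := s.2.2.isNone || s.2.1.2.1.head?.isSome

/-- The search stores one path of the tree: passing a quantifier moves it from the remaining to the
used ones and adds one bit, so the space is linear in the depth. -/
theorem reaches {B : ℕ} (a : α) : ∀ qs dq db : List Bool, dq.length = db.length →
    size a + 2 * (qs.length + dq.length) + 1 ≤ B →
    ReflTransGen (fun s s' => cond s = true ∧ s' = step φ s ∧ size s ≤ B)
      (a, (qs, dq, db), none) (a, (qs, dq, db), some (qeval (φ a) qs db))
  | [], dq, db, h, hB => by
    refine .single ⟨rfl, rfl, ?_⟩
    simp only [List.length_nil] at hB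
    simp only [size_prod, size_list, size_sym, List.length_nil]
    omega
  | q :: qs, dq, db, h, hB => by
    simp only [List.length_cons] at hB
    have h₀ := reaches (B := B) a qs (q :: dq) (false :: db) (by simpa using h)
      (by simp only [List.length_cons]; omega)
    have h₁ := reaches (B := B) a qs (q :: dq) (true :: db) (by simpa using h)
      (by simp only [List.length_cons]; omega)
    have hs : ∀ b (v : Option Bool), size (a, (qs, q :: dq, b :: db), v) ≤ B := by
      intro b v
      simp only [size_prod, size_list, size_sym, List.length_cons]
      omega
    have hs' : size (a, (q :: qs, dq, db), (none : Option Bool)) ≤ B := by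
      simp only [size_prod, size_list, size_sym, List.length_cons]
      omega
    refine .head ⟨rfl, rfl, hs'⟩ (.trans h₀ ?_)
    -- With `true` coding `∃`, a first branch whose value equals `q` already decides the quantifier.
    -- Otherwise the value is that of the second branch.
    by_cases hv : qeval (φ a) qs (false :: db) = q
    · refine .single ⟨rfl, ?_, hs _ _⟩
      have e₂ : qeval (φ a) (q :: qs) db = qeval (φ a) qs (false :: db) := by
        rw [qeval]
        cases q <;> simp_all
      simp [step, bne, hv, e₂]
    · refine .head ⟨rfl, rfl, hs _ _⟩ ?_
      have e₁ : step φ (a, (qs, q :: dq, false :: db), some (qeval (φ a) qs (false :: db))) =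
          (a, (qs, q :: dq, true :: db), none) := by
        simp [step, bne, hv]
      rw [e₁]
      refine .trans h₁ (.single ⟨rfl, ?_, hs _ _⟩)
      have e₂ : qeval (φ a) (q :: qs) db = qeval (φ a) qs (true :: db) := by
        rw [qeval]
        cases q <;> simp_all
      simp [step, e₂]

end QSearch

open QSearch in
/-- Quantified Boolean formulas can be evaluated in polynomial space. -/
theorem PS.qeval {α : Type} [RegRep α] {φ : α → List Bool → Bool} {qs : α → List Bool}
    (hφ : PS fun p : α × List Bool => φ p.1 p.2) (hqs : PS qs) :
    PS (fun a => qeval (φ a) (qs a) []) := by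
  obtain ⟨q, hq⟩ := hqs.exists_size_le
  have := PS.while_ (g := fun a => (a, (qs a, ([] : List Bool), ([] : List Bool)), none))
    (f := step φ) (c := cond)
    (r := fun a => (a, (qs a, [], []), some (_root_.qeval (φ a) (qs a) [])))
    (PS.id.pair ((hqs.pair (PS.nil.pair PS.nil)).pair (PS.const none))) (ps_step φ hφ)
    (PS.map_sym₂ (fun o o' : Option Bool => o.isNone || o'.isSome) (.snd (.snd .id))
      (PS.head? (.fst (.snd (.fst (.snd .id))))))
    (.X + 2 * q + 1) (fun a => reaches φ a (qs a) [] [] rfl ?_) (fun a => rfl)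
  · exact PS.map_sym (fun o : Option Bool => o.getD false) (.snd (.snd this))
  · have := hq a
    rw [size_list] at this
    simp only [Polynomial.eval_add, Polynomial.eval_mul, Polynomial.eval_X, Polynomial.eval_one,
      Polynomial.eval_ofNat, List.length_nil]
    omega

end

noncomputable section

/-! ### Acceptance probabilities -/

theorem StoqGate.act_act {Q : Type} [DecidableEq Q] (g : StoqGate Q) (b : Q → Bool) :
    g.act (g.act b) = b := by
  cases g with
  | x t => simp [StoqGate.act]
  | cnot c t h => simp [StoqGate.act, h]
  | toffoli c₁ c₂ t h₁₂ h₁ h₂ => simp [StoqGate.act, h₁, h₂]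

namespace StoqCircuit

variable (C : StoqCircuit 2)

theorem act_bijective : Function.Bijective C.act := by
  have : ∀ l : List (StoqGate C.Q), Function.Bijective fun b : C.Q → Bool =>
      l.foldl (fun b g => g.act b) b := by
    intro l
    induction l with
    | nil => exact Function.bijective_id
    | cons g l ih =>
      exact ih.comp (Function.Involutive.bijective g.act_act)
  exact this C.gates

/-- The circuit, conjugating the flip of the output bit. -/
def perm : Equiv.Perm (C.Q → Bool) :=
  (Equiv.ofBijective _ C.act_bijective).trans <|
    (Function.Involutive.toPerm (fun b => Function.update b C.out (!(b C.out)))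
      fun b => by simp).trans (Equiv.ofBijective _ C.act_bijective).symm

theorem act_perm (b : C.Q → Bool) :
    C.act (C.perm b) = Function.update (C.act b) C.out (!(C.act b C.out)) :=
  (Equiv.ofBijective _ C.act_bijective).apply_symm_apply _

/-- The right-hand side only runs the circuit forwards, which is how partners are recognised by the
string programs. -/
theorem perm_eq_iff (b b' : C.Q → Bool) :
    C.perm b = b' ↔ C.act b' = Function.update (C.act b) C.out (!(C.act b C.out)) := by
  rw [← C.act_perm, C.act_bijective.1.eq_iff, eq_comm]

theorem perm_perm (b : C.Q → Bool) : C.perm (C.perm b) = b := by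
  simp [perm_eq_iff, act_perm]

/-- The parts of a basis state: two witness registers, and two ancilla registers. -/
def split : (C.Q → Bool) ≃ ((Fin C.proofLen → Bool) × (Fin C.proofLen → Bool)) ×
    ((Fin C.zeros → Bool) × (Fin C.pluses → Bool)) where
  toFun b := ((fun i => b (.inl (0, i)), fun i => b (.inl (1, i))),
    (fun i => b (.inr (.inl i)), fun i => b (.inr (.inr i))))
  invFun x := Sum.elim (fun p => if p.1 = 0 then x.1.1 p.2 else x.1.2 p.2) (Sum.elim x.2.1 x.2.2)
  left_inv b := by
    funext q
    rcases q with ⟨j, i⟩ | i | i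
    · fin_cases j <;> simp
    · rfl
    · rfl
  right_inv x := by ext <;> simp

variable (ψ : Fin 2 → NonnegState C.proofLen)

theorem finalAmp_act (b : C.Q → Bool) : C.finalAmp ψ (C.act b) = C.initAmp ψ b := by
  simp [finalAmp, C.act_bijective.1.eq_iff]

theorem acceptProb_eq :
    C.acceptProb ψ = ∑ b, ((C.initAmp ψ b + C.initAmp ψ (C.perm b)) / 2) ^ 2 := by
  rw [acceptProb, ← (Equiv.ofBijective _ C.act_bijective).sum_comp]
  refine Finset.sum_congr rfl fun b _ => ?_
  rw [Equiv.ofBijective_apply, ← act_perm, finalAmp_act, finalAmp_act]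

/-- The basis states whose zero-initialized ancillas are zero. -/
def Clean (b : C.Q → Bool) : Prop := ∀ i, b (.inr (.inl i)) = false

theorem sqrt_sq_pow (n : ℕ) : ((1 / √2 : ℝ) ^ n) ^ 2 = (1 / 2) ^ n := by
  rw [← pow_mul, mul_comm, pow_mul, div_pow, one_pow, Real.sq_sqrt zero_le_two]

theorem sum_initAmp_sq : ∑ b, C.initAmp ψ b ^ 2 = 1 := by
  rw [← C.split.symm.sum_comp, Fintype.sum_prod_type]
  have h : ∀ x y, C.initAmp ψ (C.split.symm (x, y)) ^ 2 =
      ((ψ 0).amp x.1 ^ 2 * (ψ 1).amp x.2 ^ 2) * ((if y.1 = fun _ => false then 1 else 0) *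
        (1 / 2) ^ C.pluses) := by
    intro x y
    rw [initAmp, mul_pow, mul_pow, sqrt_sq_pow, Fin.prod_univ_two, mul_pow, mul_assoc]
    have : (∀ i, C.split.symm (x, y) (.inr (.inl i)) = false) ↔ y.1 = fun _ => false :=
      funext_iff.symm
    simp only [this]
    congr 2
    split_ifs <;> simp
  have hy : ∑ y : (Fin C.zeros → Bool) × (Fin C.pluses → Bool),
      ((if y.1 = fun _ => false then 1 else 0) * (1 / 2 : ℝ) ^ C.pluses) = 1 := by
    rw [Fintype.sum_prod_type]
    simp [Finset.sum_ite_eq']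
  simp only [h, ← Finset.mul_sum, hy, mul_one]
  rw [Fintype.sum_prod_type]
  simp only [← Finset.mul_sum, (ψ 1).norm_one, mul_one, (ψ 0).norm_one]

/-- Parallelogram identity: half-sums and half-differences have squares adding up to the average of
two squared norms, both equal to one because `C.perm` is a permutation. -/
theorem one_sub_acceptProb :
    1 - C.acceptProb ψ = ∑ b, ((C.initAmp ψ b - C.initAmp ψ (C.perm b)) / 2) ^ 2 := by
  have h₁ := C.sum_initAmp_sq ψ
  have h₂ : ∑ b, C.initAmp ψ (C.perm b) ^ 2 = 1 := by
    rw [← h₁]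
    exact Equiv.sum_comp C.perm fun b => C.initAmp ψ b ^ 2
  have h₃ : ∑ b, ((C.initAmp ψ b - C.initAmp ψ (C.perm b)) / 2) ^ 2 + C.acceptProb ψ =
      (∑ b, C.initAmp ψ b ^ 2 + ∑ b, C.initAmp ψ (C.perm b) ^ 2) / 2 := by
    rw [acceptProb_eq, ← Finset.sum_add_distrib, ← Finset.sum_add_distrib, Finset.sum_div]
    exact Finset.sum_congr rfl fun b _ => by ring
  rw [h₁, h₂] at h₃
  linarith

theorem sq_initAmp_sub_le (b : C.Q → Bool) :
    (C.initAmp ψ b - C.initAmp ψ (C.perm b)) ^ 2 ≤ 4 * (1 - C.acceptProb ψ) := by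
  rw [one_sub_acceptProb]
  have := Finset.single_le_sum (f := fun b => ((C.initAmp ψ b - C.initAmp ψ (C.perm b)) / 2) ^ 2)
    (fun _ _ => sq_nonneg _) (Finset.mem_univ b)
  rw [div_pow] at this
  linarith

/-! ### The rectangular closure of a basis state -/

/-- Agreement of the first witness register and the zero ancillas (for `false`), or of the second
witness register (for `true`). -/
def Same : Bool → (C.Q → Bool) → (C.Q → Bool) → Prop
  | false, b, b' => (∀ i, b (.inl (0, i)) = b' (.inl (0, i))) ∧
      ∀ i, b (.inr (.inl i)) = b' (.inr (.inl i))
  | true, b, b' => ∀ i, b (.inl (1, i)) = b' (.inl (1, i))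

/-- The two basis states agree or are matched by the circuit. -/
def Edge (b b' : C.Q → Bool) : Prop :=
  C.act b' = Function.update (C.act b) C.out (!(C.act b C.out)) ∨ b' = b

/-- The parts of basis states that are reached from the parts of `s` in `t` rounds. -/
def Der (s : C.Q → Bool) : ℕ → Bool → (C.Q → Bool) → Prop
  | 0, c, w => C.Same c w s
  | t + 1, c, w => ∃ z' z, C.Same c z' w ∧ C.Edge z z' ∧ ∀ c', Der s t c' z

/-- A basis state with a nonzero ancilla is reached in `t` rounds. -/
def Bad (s : C.Q → Bool) (t : ℕ) : Prop := ∃ w, ¬ C.Clean w ∧ ∀ c, C.Der s t c w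

variable {C}

theorem Same.refl (c : Bool) (b : C.Q → Bool) : C.Same c b b := by
  cases c
  · exact ⟨fun _ => rfl, fun _ => rfl⟩
  · exact fun _ => rfl

theorem Same.trans {c : Bool} {b₁ b₂ b₃ : C.Q → Bool} (h₁ : C.Same c b₁ b₂) (h₂ : C.Same c b₂ b₃) :
    C.Same c b₁ b₃ := by
  cases c
  · exact ⟨fun i => (h₁.1 i).trans (h₂.1 i), fun i => (h₁.2 i).trans (h₂.2 i)⟩
  · exact fun i => (h₁ i).trans (h₂ i)

theorem Same.symm {c : Bool} {b₁ b₂ : C.Q → Bool} (h : C.Same c b₁ b₂) : C.Same c b₂ b₁ := by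
  cases c
  · exact ⟨fun i => (h.1 i).symm, fun i => (h.2 i).symm⟩
  · exact fun i => (h i).symm

theorem edge_iff {b b' : C.Q → Bool} : C.Edge b b' ↔ C.perm b = b' ∨ b' = b := by
  rw [perm_eq_iff, Edge]

theorem Der.congr {s : C.Q → Bool} {t : ℕ} {c : Bool} {w w' : C.Q → Bool} (h : C.Der s t c w)
    (hw : C.Same c w w') : C.Der s t c w' := by
  cases t with
  | zero => exact hw.symm.trans h
  | succ t =>
    obtain ⟨z', z, h₁, h₂⟩ := h
    exact ⟨z', z, h₁.trans hw, h₂⟩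

theorem der_self (s : C.Q → Bool) (t : ℕ) (c : Bool) : C.Der s t c s := by
  induction t generalizing c with
  | zero => exact .refl c s
  | succ t ih => exact ⟨s, s, .refl c s, .inr rfl, ih⟩

/-- The two parts concern disjoint sets of qubits and can be prescribed independently; the plus
ancillas belong to neither. -/
theorem exists_same (b : Bool → C.Q → Bool) : ∃ z, ∀ c, C.Same c z (b c) := by
  refine ⟨C.split.symm ((fun i => b false (.inl (0, i)), fun i => b true (.inl (1, i))),
    (fun i => b false (.inr (.inl i)), fun _ => false)), ?_⟩
  rintro (_ | _)
  · exact ⟨fun _ => rfl, fun _ => rfl⟩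
  · exact fun _ => rfl

/-- `Edge` allows equality, so a part persists once it is completed to a basis state by a part of
`s`, which is derived in every round. -/
theorem Der.succ {s : C.Q → Bool} {t : ℕ} {c : Bool} {w : C.Q → Bool} (h : C.Der s t c w) :
    C.Der s (t + 1) c w := by
  obtain ⟨z, hz⟩ := C.exists_same fun c' => if c' = c then w else s
  refine ⟨z, z, by simpa using hz c, .inr rfl, fun c' => ?_⟩
  have := hz c'
  rcases eq_or_ne c' c with rfl | hc
  · rw [if_pos rfl] at this
    exact h.congr this.symm
  · rw [if_neg hc] at this
    exact (der_self s t c').congr this.symm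

theorem Bad.mono {s : C.Q → Bool} {t t' : ℕ} (h : C.Bad s t) (ht : t ≤ t') : C.Bad s t' := by
  induction t', ht using Nat.le_induction with
  | base => exact h
  | succ t' _ ih =>
    obtain ⟨w, hw, hd⟩ := ih
    exact ⟨w, hw, fun c => (hd c).succ⟩

/-! ### Completeness -/

theorem _root_.NonnegState.amp_le_one {l : ℕ} (ψ : NonnegState l) (x : Fin l → Bool) :
    ψ.amp x ≤ 1 := by
  have := Finset.single_le_sum (f := fun x => ψ.amp x ^ 2) (fun _ _ => sq_nonneg _)
    (Finset.mem_univ x)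
  rw [ψ.norm_one] at this
  exact (sq_le_one_iff₀ (ψ.nonneg x)).1 this

/-- Amplitudes are at most one, so if all were below `2 ^ (-l)`, so would be their `2 ^ l` squares,
whose sum is one. -/
theorem _root_.NonnegState.exists_le_amp {l : ℕ} (ψ : NonnegState l) :
    ∃ x, (1 / 2 : ℝ) ^ l ≤ ψ.amp x := by
  by_contra! h
  have : ∑ x : Fin l → Bool, ψ.amp x ^ 2 < ∑ _x : Fin l → Bool, (1 / 2 : ℝ) ^ l := by
    refine Finset.sum_lt_sum_of_nonempty Finset.univ_nonempty fun x _ => ?_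
    have h₁ := h x
    have h₂ := ψ.amp_le_one x
    have h₃ := ψ.nonneg x
    nlinarith
  rw [ψ.norm_one] at this
  simp at this

/-- The amplitude of one part of a basis state. -/
def partAmp (ψ : Fin 2 → NonnegState C.proofLen) : Bool → (C.Q → Bool) → ℝ
  | false, b => open Classical in if C.Clean b then (ψ 0).amp fun i => b (.inl (0, i)) else 0
  | true, b => (ψ 1).amp fun i => b (.inl (1, i))

/-- The plus ancillas contribute a constant only, so comparing partners amounts to comparing
products of two parts. -/
theorem initAmp_eq (b : C.Q → Bool) : C.initAmp ψ b =
    partAmp ψ false b * partAmp ψ true b * (1 / √2) ^ C.pluses := by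
  rw [initAmp, Fin.prod_univ_two, partAmp, partAmp]
  congr 1
  by_cases h : C.Clean b
  · have h' : ∀ i, b (.inr (.inl i)) = false := h
    rw [if_pos h, if_pos h', mul_one]
  · have h' : ¬ ∀ i, b (.inr (.inl i)) = false := h
    rw [if_neg h, if_neg h', mul_zero, zero_mul]

theorem partAmp_nonneg (c : Bool) (b : C.Q → Bool) : 0 ≤ partAmp ψ c b := by
  cases c
  · rw [partAmp]
    split_ifs
    · exact (ψ 0).nonneg _
    · exact le_rfl
  · exact (ψ 1).nonneg _

theorem partAmp_le_one (c : Bool) (b : C.Q → Bool) : partAmp ψ c b ≤ 1 := by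
  cases c
  · rw [partAmp]
    split_ifs
    · exact (ψ 0).amp_le_one _
    · exact zero_le_one
  · exact (ψ 1).amp_le_one _

theorem Same.partAmp_eq {c : Bool} {b b' : C.Q → Bool} (h : C.Same c b b') :
    partAmp ψ c b = partAmp ψ c b' := by
  cases c
  · have : C.Clean b ↔ C.Clean b' := forall_congr' fun i => by rw [h.2 i]
    simp only [partAmp, h.1]
    by_cases hb : C.Clean b
    · rw [if_pos hb, if_pos (this.1 hb)]
    · rw [if_neg hb, if_neg fun h => hb (this.2 h)]
  · simp only [partAmp, show ∀ i, b (.inl (1, i)) = b' (.inl (1, i)) from h]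

/-- Starting from likely strings for both registers, every part derived in `t` rounds has amplitude
at least `2 ^ (-L * 3 ^ t)`; an unclean state cannot have this, as its first part has amplitude
zero. -/
theorem exists_not_bad {ε : ℝ} {T : ℕ} (hψ : 1 - ε ≤ C.acceptProb ψ)
    (hε : ε ≤ (1 / 2) ^ (4 * ((C.proofLen + 1) * 3 ^ T) + 4 + C.pluses)) :
    ∃ s, C.Clean s ∧ ¬ C.Bad s T := by
  obtain ⟨x, hx⟩ := (ψ 0).exists_le_amp
  obtain ⟨y, hy⟩ := (ψ 1).exists_le_amp
  set s : C.Q → Bool := C.split.symm ((x, y), (fun _ => false, fun _ => false)) with hs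
  have hsc : C.Clean s := fun _ => rfl
  refine ⟨s, hsc, ?_⟩
  set L := C.proofLen + 1 with hL
  have hs0 : ∀ c, (1 / 2 : ℝ) ^ L ≤ partAmp ψ c s := by
    have hle : (1 / 2 : ℝ) ^ L ≤ (1 / 2) ^ C.proofLen :=
      pow_le_pow_of_le_one (by norm_num) (by norm_num) (Nat.le_succ _)
    rintro (_ | _)
    · rw [partAmp, if_pos hsc]
      exact hle.trans hx
    · exact hle.trans hy
  set κ : ℝ := (1 / √2) ^ C.pluses with hκ
  have hκ0 : 0 < κ := by positivity
  have hκ2 : κ ^ 2 = (1 / 2) ^ C.pluses := sqrt_sq_pow _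
  -- After division by `κ`, the products at partners differ by at most `e`, since `(κ * e) ^ 2` is
  -- four times the bound on `ε`. The exponent makes `e` half of the smallest product guaranteed in
  -- `T` rounds.
  set e : ℝ := (1 / 2) ^ (2 * (L * 3 ^ T) + 1) with he
  have hsub : ∀ b, C.initAmp ψ b - C.initAmp ψ (C.perm b) ≤ κ * e := by
    intro b
    have h₁ := C.sq_initAmp_sub_le ψ b
    have h₂ : (κ * e) ^ 2 = 4 * (1 / 2) ^ (4 * (L * 3 ^ T) + 4 + C.pluses) := by
      rw [mul_pow, hκ2, he]
      ring
    exact (le_abs_self _).trans (abs_le_of_sq_le_sq (by linarith) (by positivity))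
  have hstep : ∀ b b', C.Edge b b' →
      partAmp ψ false b * partAmp ψ true b - e ≤ partAmp ψ false b' * partAmp ψ true b' := by
    intro b b' hb
    rcases edge_iff.1 hb with rfl | rfl
    · have := hsub b
      rw [initAmp_eq, initAmp_eq, ← sub_mul, mul_comm] at this
      linarith [le_of_mul_le_mul_left this hκ0]
    · have : 0 ≤ e := by positivity
      linarith
  have hpart : ∀ c b, partAmp ψ false b * partAmp ψ true b ≤ partAmp ψ c b := by
    rintro (_ | _) b
    · exact mul_le_of_le_one_right (partAmp_nonneg ψ _ b) (partAmp_le_one ψ _ b)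
    · exact mul_le_of_le_one_left (partAmp_nonneg ψ _ b) (partAmp_le_one ψ _ b)
  have key : ∀ t ≤ T, ∀ c w, C.Der s t c w → (1 / 2 : ℝ) ^ (L * 3 ^ t) ≤ partAmp ψ c w := by
    intro t
    induction t with
    | zero =>
      intro _ c w h
      rw [pow_zero, mul_one, Same.partAmp_eq ψ h]
      exact hs0 c
    | succ t ih =>
      rintro ht c w ⟨z', z, hz', hz, hd⟩
      have h₁ := fun c' => ih (by omega) c' z (hd c')
      have h₂ : (1 / 2 : ℝ) ^ (L * 3 ^ t) * (1 / 2 : ℝ) ^ (L * 3 ^ t) ≤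
          partAmp ψ false z * partAmp ψ true z :=
        mul_le_mul (h₁ false) (h₁ true) (by positivity) (partAmp_nonneg ψ _ z)
      rw [← pow_add] at h₂
      have hpos : 0 < L * 3 ^ t := by positivity
      have hmono : L * 3 ^ t ≤ L * 3 ^ T :=
        Nat.mul_le_mul_left _ (Nat.pow_le_pow_right (by norm_num) (by omega))
      have h₃ : e ≤ (1 / 2 : ℝ) ^ (L * 3 ^ t + L * 3 ^ t + 1) :=
        pow_le_pow_of_le_one (by norm_num) (by norm_num) (by omega)
      have h₄ : (1 / 2 : ℝ) ^ (L * 3 ^ (t + 1)) ≤ (1 / 2 : ℝ) ^ (L * 3 ^ t + L * 3 ^ t + 1) :=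
        pow_le_pow_of_le_one (by norm_num) (by norm_num) (by rw [pow_succ, ← mul_assoc]; omega)
      -- With `M = L * 3 ^ t`, the product at `z` is at least `2 ^ (-2 * M)`. The loss of `e` leaves
      -- at least half of it, and `2 * M + 1 ≤ 3 * M` as `M` is positive: this is where the factor
      -- `3` comes from.
      have h₅ : (1 / 2 : ℝ) ^ (L * 3 ^ t + L * 3 ^ t) =
          2 * (1 / 2 : ℝ) ^ (L * 3 ^ t + L * 3 ^ t + 1) := by
        rw [pow_succ _ (L * 3 ^ t + L * 3 ^ t)]
        ring
      rw [← Same.partAmp_eq ψ hz']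
      linarith [hstep z z' hz, hpart c z']
  rintro ⟨w, hw, hd⟩
  have := key T le_rfl false w (hd false)
  rw [partAmp, if_neg hw] at this
  have h0 : (0 : ℝ) < (1 / 2) ^ (L * 3 ^ T) := by positivity
  linarith

/-! ### Soundness -/

/-- The uniform superposition of a nonempty set of basis states. -/
def _root_.NonnegState.uniform {l : ℕ} (S : Finset (Fin l → Bool)) (hS : S.Nonempty) :
    NonnegState l where
  amp x := if x ∈ S then 1 / √(S.card : ℝ) else 0
  nonneg x := by split_ifs <;> positivity
  norm_one := by
    have : (S.card : ℝ) ≠ 0 := by exact_mod_cast hS.card_pos.ne'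
    simp [ite_pow, Finset.sum_ite_mem, this]

variable (C) in
open Classical in
/-- The basis states that are reached in `t` rounds. -/
def reach (s : C.Q → Bool) (t : ℕ) : Finset (C.Q → Bool) :=
  Finset.univ.filter fun b => ∀ c, C.Der s t c b

theorem mem_reach {s b : C.Q → Bool} {t : ℕ} : b ∈ C.reach s t ↔ ∀ c, C.Der s t c b := by
  simp [reach]

/-- The witness is the uniform state on the derived strings of each register. The reached set is a
rectangle, and it equals the support because no unclean state has been reached. The bounds on `a`
reflect that each register has between `1` and `2 ^ C.proofLen` derived strings. -/
theorem exists_initAmp_eq {s : C.Q → Bool} {t : ℕ} (hs : C.Clean s) (h : ¬ C.Bad s t) :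
    ∃ (ψ : Fin 2 → NonnegState C.proofLen) (a : ℝ),
      (∀ b, C.initAmp ψ b = if b ∈ C.reach s t then a else 0) ∧
      (1 / 2) ^ (2 * C.proofLen + C.pluses) ≤ a ^ 2 ∧ a ^ 2 ≤ (1 / 2) ^ C.pluses := by
  classical
  -- The string is put in both registers so that one map serves for either part.
  let j : (Fin C.proofLen → Bool) → C.Q → Bool := fun u =>
    C.split.symm ((u, u), (fun _ => false, fun _ => false))
  let S : Bool → Finset (Fin C.proofLen → Bool) := fun c =>
    Finset.univ.filter fun u => C.Der s t c (j u)
  have hS₀ : ∀ b, C.Clean b → ((fun i => b (.inl (0, i))) ∈ S false ↔ C.Der s t false b) := by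
    intro b hb
    have hsame : C.Same false (j fun i => b (.inl (0, i))) b := ⟨fun _ => rfl, fun i => (hb i).symm⟩
    simp only [S, Finset.mem_filter, Finset.mem_univ, true_and]
    exact ⟨fun h => h.congr hsame, fun h => h.congr hsame.symm⟩
  have hS₁ : ∀ b, (fun i => b (.inl (1, i))) ∈ S true ↔ C.Der s t true b := by
    intro b
    have hsame : C.Same true (j fun i => b (.inl (1, i))) b := fun _ => rfl
    simp only [S, Finset.mem_filter, Finset.mem_univ, true_and]
    exact ⟨fun h => h.congr hsame, fun h => h.congr hsame.symm⟩
  have hne₀ : (S false).Nonempty := ⟨_, (hS₀ s hs).2 (der_self s t _)⟩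
  have hne₁ : (S true).Nonempty := ⟨_, (hS₁ s).2 (der_self s t _)⟩
  have hcard : ∀ c, ((S c).card : ℝ) ≤ 2 ^ C.proofLen := by
    intro c
    have := (S c).card_le_univ
    simp only [Fintype.card_pi, Fintype.card_bool, Finset.prod_const, Finset.card_univ,
      Fintype.card_fin] at this
    exact_mod_cast this
  have hpos₀ : (1 : ℝ) ≤ (S false).card := by exact_mod_cast hne₀.card_pos
  have hpos₁ : (1 : ℝ) ≤ (S true).card := by exact_mod_cast hne₁.card_pos
  have hsq : (1 / √((S false).card : ℝ) * (1 / √((S true).card : ℝ)) * (1 / √2) ^ C.pluses) ^ 2 =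
      1 / ((S false).card * (S true).card) * (1 / 2) ^ C.pluses := by
    rw [mul_pow, sqrt_sq_pow, mul_pow, div_pow, div_pow, Real.sq_sqrt (by positivity),
      Real.sq_sqrt (by positivity)]
    ring
  refine ⟨fun c => if c = 0 then .uniform _ hne₀ else .uniform _ hne₁,
    1 / √((S false).card : ℝ) * (1 / √((S true).card : ℝ)) * (1 / √2) ^ C.pluses, ?_, ?_, ?_⟩
  · intro b
    rw [initAmp, Fin.prod_univ_two, if_pos rfl, if_neg (by decide)]
    simp only [NonnegState.uniform, hS₁]
    by_cases hb : ∀ i, b (.inr (.inl i)) = false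
    · rw [if_pos hb, mul_one]
      simp only [hS₀ b hb, mem_reach, Bool.forall_bool]
      split_ifs <;> simp_all
    · rw [if_neg hb, if_neg fun hr => h ⟨b, hb, mem_reach.1 hr⟩]
      simp
  · rw [hsq, pow_add, pow_mul']
    gcongr
    rw [pow_two, ← one_div_mul_one_div, one_div_pow]
    gcongr
    · exact hcard _
    · exact hcard _
  · rw [hsq]
    refine mul_le_of_le_one_left (by positivity) ?_
    rw [div_le_one (by positivity)]
    nlinarith

/-- A uniform unit vector of amplitude `a` has a support of exactly `1 / a ^ 2` elements. -/
theorem card_reach_bounds {s : C.Q → Bool} {t : ℕ} (hs : C.Clean s) (h : ¬ C.Bad s t) :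
    (2 : ℝ) ^ C.pluses ≤ (C.reach s t).card ∧
      ((C.reach s t).card : ℝ) ≤ 2 ^ (2 * C.proofLen + C.pluses) := by
  obtain ⟨ψ, a, ha, ha₁, ha₂⟩ := exists_initAmp_eq hs h
  have h₁ := C.sum_initAmp_sq ψ
  simp only [ha, ite_pow, ne_eq, OfNat.ofNat_ne_zero, not_false_eq_true, zero_pow,
    Finset.sum_ite_mem, Finset.univ_inter, Finset.sum_const, nsmul_eq_mul] at h₁
  have hc : (0 : ℝ) ≤ (C.reach s t).card := by positivity
  constructor
  · have := mul_le_mul_of_nonneg_left ha₂ hc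
    rwa [h₁, one_div_pow, mul_one_div, one_le_div (by positivity)] at this
  · have := mul_le_mul_of_nonneg_left ha₁ hc
    rwa [h₁, one_div_pow, mul_one_div, div_le_one (by positivity)] at this

/-- For the uniform state on `Z`, rejection comes only from the elements whose partner lies outside
`Z`. A large rejection probability means many of them, and their partners are new elements in the
next round. -/
theorem card_reach_succ {s : C.Q → Bool} {t Q : ℕ} (hs : C.Clean s) (h : ¬ C.Bad s t)
    (hQ : ∀ ψ, C.acceptProb ψ ≤ 1 - 1 / Q) :
    (1 + 1 / Q : ℝ) * (C.reach s t).card ≤ (C.reach s (t + 1)).card := by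
  classical
  obtain ⟨ψ, a, ha, -, -⟩ := exists_initAmp_eq hs h
  set Z := C.reach s t with hZ
  have h₁ := C.sum_initAmp_sq ψ
  simp only [ha, ite_pow, ne_eq, OfNat.ofNat_ne_zero, not_false_eq_true, zero_pow,
    Finset.sum_ite_mem, Finset.univ_inter, Finset.sum_const, nsmul_eq_mul] at h₁
  set D := Z.filter fun b => C.perm b ∉ Z with hD
  -- Each boundary pair contributes `a ^ 2 / 4` at both of its ends.
  have h₂ : 1 - C.acceptProb ψ = a ^ 2 / 2 * D.card := by
    have hb : ∀ b, ((C.initAmp ψ b - C.initAmp ψ (C.perm b)) / 2) ^ 2 =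
        a ^ 2 / 4 * ((if b ∈ Z ∧ C.perm b ∉ Z then 1 else 0) +
          (if C.perm b ∈ Z ∧ C.perm (C.perm b) ∉ Z then 1 else 0)) := by
      intro b
      rw [ha, ha, perm_perm]
      by_cases h₁ : b ∈ Z <;> by_cases h₂ : C.perm b ∈ Z <;> simp [h₁, h₂] <;> ring
    rw [one_sub_acceptProb, Finset.sum_congr rfl fun b _ => hb b, ← Finset.mul_sum,
      Finset.sum_add_distrib, Equiv.sum_comp C.perm fun b =>
        if b ∈ Z ∧ C.perm b ∉ Z then (1 : ℝ) else 0, Finset.sum_boole]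
    have : (Finset.univ.filter fun b => b ∈ Z ∧ C.perm b ∉ Z) = D := by
      ext b
      simp [hD]
    rw [this]
    ring
  have h₃ : Disjoint Z (D.map C.perm.toEmbedding) := by
    rw [Finset.disjoint_right]
    simp +contextual [hD]
  have h₄ : Z ∪ D.map C.perm.toEmbedding ⊆ C.reach s (t + 1) := by
    intro b hb
    rw [Finset.mem_union, Finset.mem_map] at hb
    rw [mem_reach]
    rcases hb with hb | ⟨b, hb, rfl⟩
    · exact fun c => (mem_reach.1 hb c).succ
    · exact fun c => ⟨_, b, .refl _ _, edge_iff.2 (.inl rfl),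
        mem_reach.1 (Finset.mem_of_mem_filter b hb)⟩
  have h₅ := Finset.card_le_card h₄
  rw [Finset.card_union_of_disjoint h₃, Finset.card_map] at h₅
  have h₆ : (Z.card : ℝ) + D.card ≤ (C.reach s (t + 1)).card := by exact_mod_cast h₅
  -- The argument would give `2 / Q`; the factor two is dropped.
  have h₇ : (1 / Q : ℝ) * Z.card ≤ D.card := by
    have hz : (0 : ℝ) ≤ Z.card := by positivity
    have hd : (0 : ℝ) ≤ D.card := by positivity
    calc (1 / Q : ℝ) * Z.card ≤ (a ^ 2 / 2 * D.card) * Z.card :=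
          mul_le_mul_of_nonneg_right (by linarith [hQ ψ]) hz
      _ = D.card / 2 * (Z.card * a ^ 2) := by ring
      _ ≤ D.card := by rw [h₁]; linarith
  linarith

/-- Without a bad state the reached set would grow geometrically from at least `2 ^ C.pluses`
elements beyond its upper bound, which is larger by the factor `2 ^ (2 * C.proofLen)` only. -/
theorem bad_of_acceptProb_le {s : C.Q → Bool} {T Q : ℕ} (hs : C.Clean s) (hQ0 : 0 < Q)
    (hQ : ∀ ψ, C.acceptProb ψ ≤ 1 - 1 / Q) (hT : Q * (2 * C.proofLen + 1) ≤ T) : C.Bad s T := by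
  by_contra hb
  have hb' : ∀ t ≤ T, ¬ C.Bad s t := fun t ht h => hb (h.mono ht)
  have hgrow : ∀ t ≤ T, (1 + 1 / Q : ℝ) ^ t * 2 ^ C.pluses ≤ (C.reach s t).card := by
    intro t
    induction t with
    | zero => intro ht; simpa using (card_reach_bounds hs (hb' 0 ht)).1
    | succ t ih =>
      intro ht
      refine le_trans ?_ (card_reach_succ hs (hb' t (by omega)) hQ)
      rw [pow_succ', mul_assoc]
      exact mul_le_mul_of_nonneg_left (ih (by omega)) (by positivity)
  have h₁ := (hgrow _ hT).trans (card_reach_bounds hs (hb' _ hT)).2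
  have hQ' : (0 : ℝ) < Q := by exact_mod_cast hQ0
  -- Bernoulli's inequality: the set doubles in `Q` rounds.
  have h₂ : (2 : ℝ) ≤ (1 + 1 / Q) ^ Q := by
    refine le_trans ?_ (one_add_mul_le_pow (by have : (0 : ℝ) ≤ 1 / Q := by positivity
                                               linarith) Q)
    rw [mul_one_div_cancel hQ'.ne']
    norm_num
  rw [pow_mul, pow_add 2] at h₁
  have h₃ := le_of_mul_le_mul_right h₁ (by positivity)
  have h₄ := pow_le_pow_left₀ (by norm_num) h₂ (2 * C.proofLen + 1)
  have h₅ : (2 : ℝ) ^ (2 * C.proofLen) < 2 ^ (2 * C.proofLen + 1) :=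
    pow_lt_pow_right₀ (by norm_num) (by omega)
  linarith

end StoqCircuit

end

noncomputable section

open RegRep Function

/-! ### Circuits on strings -/

namespace StrCircuit

/-- The leading `true`s of a string. -/
def num (l : List Bool) : List Bool := l.takeWhile fun b => b

/-- What follows the leading unary number of a string. -/
def rest (l : List Bool) : List Bool := (l.drop (num l).length).tail

/-- Reads the code of a qubit: its position in a memory (in unary), and the rest of the string. The
memory consists of the first witness register, the zero ancillas, the second witness register and
the plus ancillas. -/
def readQubit (L Z l : List Bool) : List Bool × List Bool :=
  if (num l).head?.isNone then
    ((if (num (rest l)).head?.isNone then [] else L ++ Z) ++ num (rest (rest l)),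
      rest (rest (rest l)))
  else ((if (num l).tail.head?.isNone then L else L ++ Z ++ L) ++ num (rest l), rest (rest l))

/-- The bit of the memory at a position. -/
def getBit (mem p : List Bool) : Bool := (mem.drop p.length).head?.getD false

/-- Adds a bit to the memory at a position. -/
def addBit (b : Bool) (p mem : List Bool) : List Bool :=
  mem.set p.length (xor (getBit mem p) b)

/-- Reads the controls of a gate, and the conjunction of their values. -/
def readControls (L Z mem u l : List Bool) : Bool × List Bool :=
  u.foldl (fun t _ => (t.1 && getBit mem (readQubit L Z t.2).1, (readQubit L Z t.2).2)) (true, l)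

/-- Reads a gate and applies it to the memory. -/
def gateStep (L Z : List Bool) (s : List Bool × List Bool) : List Bool × List Bool :=
  if s.2.head?.isNone then s
  else
    (addBit (readControls L Z s.1 (num s.2) (rest s.2)).1
      (readQubit L Z (readControls L Z s.1 (num s.2) (rest s.2)).2).1 s.1,
      (readQubit L Z (readControls L Z s.1 (num s.2) (rest s.2)).2).2)

/-- Applies a list of gates. -/
def run (L Z G mem : List Bool) : List Bool :=
  (G.foldl (fun s _ => gateStep L Z s) (mem, G)).1

/-- A parsed circuit: its numbers of qubits of each type, its output position and its gates. -/
abbrev Ctx : Type := List Bool × List Bool × List Bool × List Bool × List Bool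

/-- Reads a circuit. -/
def parse (l : List Bool) : Ctx :=
  (num l, num (rest l), num (rest (rest l)),
    readQubit (num l) (num (rest l)) (rest (rest (rest l))))

/-- A string of the length of the memory. -/
def memLen (K : Ctx) : List Bool := K.1 ++ K.2.1 ++ K.1 ++ K.2.2.1

/-- The part of the memory with the first register and the zero ancillas, or with the second
register. -/
def part (K : Ctx) (c : Bool) (mem : List Bool) : List Bool :=
  if c then (mem.drop (K.1 ++ K.2.1).length).take K.1.length
  else mem.take (K.1 ++ K.2.1).length

/-- Whether the zero ancillas are zero. -/
def clean (K : Ctx) (mem : List Bool) : Bool :=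
  decide ((mem.drop K.1.length).take K.2.1.length =
    ((mem.map fun _ => false).drop K.1.length).take K.2.1.length)

/-- Whether two memories are matched by the circuit. -/
def edge (K : Ctx) (mem mem' : List Bool) : Bool :=
  decide (run K.1 K.2.1 K.2.2.2.2 mem' = addBit true K.2.2.2.1 (run K.1 K.2.1 K.2.2.2.2 mem)) ||
    decide (mem' = mem)

/-- A round of the game: reads a part and two memories, and compares them to the current memory. -/
def round (K : Ctx) (s : List Bool × List Bool × Bool) : List Bool × List Bool × Bool :=
  ((s.2.1.tail.drop (memLen K).length).take (memLen K).length,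
    (s.2.1.tail.drop (memLen K).length).drop (memLen K).length,
    s.2.2 && decide (part K (s.2.1.head?.getD false) (s.2.1.tail.take (memLen K).length) =
        part K (s.2.1.head?.getD false) s.1) &&
      edge K ((s.2.1.tail.drop (memLen K).length).take (memLen K).length)
        (s.2.1.tail.take (memLen K).length))

/-- The outcome of the game. -/
def outcome (K : Ctx) (start : List Bool) (s : List Bool × List Bool × Bool) : Bool :=
  !(s.2.2 && decide (part K (s.2.1.head?.getD false) s.1 = part K (s.2.1.head?.getD false) start))

/-- The matrix of the quantified Boolean formula, for a number of rounds that is given in unary. -/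
def matrix (K : Ctx) (T v : List Bool) : Bool :=
  clean K (v.take (memLen K).length) &&
    (clean K ((v.drop (memLen K).length).take (memLen K).length) ||
      outcome K (v.take (memLen K).length) (T.foldl (fun s _ => round K s)
        ((v.drop (memLen K).length).take (memLen K).length,
          (v.drop (memLen K).length).drop (memLen K).length, true)))

/-- The quantifiers of the rounds. -/
def roundQuantifiers (K : Ctx) (T : List Bool) : List Bool :=
  T.foldl (fun s _ => true :: ((memLen K).map (fun _ => false) ++
    ((memLen K).map (fun _ => false) ++ s))) [true]

/-- The quantifier prefix. -/
def quantifiers (K : Ctx) (T : List Bool) : List Bool :=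
  (memLen K).map (fun _ => true) ++ ((memLen K).map (fun _ => false) ++ roundQuantifiers K T)

/-! ### Polynomial space -/

section PolySpace

variable {α : Type} [RegRep α] {L Z l m p u : α → List Bool} {K : α → Ctx}

/-- The fold carries a flag telling that no `false` has been seen yet, and collects the symbols in
reverse. -/
theorem ps_num (hl : PS l) : PS (fun a => num (l a)) := by
  have := PS.foldl_of_le (σ := Bool × List Bool) (F := fun _ s (x : Bool) =>
    if s.1 && x then (true, x :: s.2) else (false, s.2)) hl ((PS.const true).pair PS.nil)
    (fun x => ?_) 1 ?_
  · have h := (PS.snd this).reverse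
    convert h using 2 with a
    have key : ∀ (l s : List Bool) b, (l.foldl (fun s (x : Bool) =>
        if s.1 && x then (true, x :: s.2) else (false, s.2)) (b, s)).2.reverse =
        s.reverse ++ if b then num l else [] := by
      intro l
      induction l with
      | nil => simp [num]
      | cons x l ih =>
        intro s b
        rw [List.foldl_cons]
        cases b <;> cases x <;> exact (ih _ _).trans (by simp [num])
    rw [key]
    simp
  · exact PS.ite (PS.map_sym (fun b => b && x) (.fst (.snd .id)))
      ((PS.const true).pair ((PS.const x).cons (.snd (.snd .id))))
      ((PS.const false).pair (.snd (.snd .id)))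
  · rintro _ ⟨b, s⟩ x
    dsimp only
    split_ifs
    · simp
      omega
    · simp

theorem ps_rest (hl : PS l) : PS (fun a => rest (l a)) := (PS.drop (ps_num hl) hl).tail

theorem ps_readQubit (hL : PS L) (hZ : PS Z) (hl : PS l) :
    PS (fun a => readQubit (L a) (Z a) (l a)) := by
  have h₁ := ps_rest hl
  have h₂ := ps_rest h₁
  exact PS.ite (PS.test_head Option.isNone (ps_num hl))
    ((PS.append (PS.ite (PS.test_head Option.isNone (ps_num h₁)) PS.nil (hL.append hZ))
      (ps_num h₂)).pair (ps_rest h₂))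
    ((PS.append (PS.ite (PS.test_head Option.isNone (ps_num hl).tail) hL
      ((hL.append hZ).append hL)) (ps_num h₁)).pair h₂)

theorem ps_getBit (hm : PS m) (hp : PS p) : PS (fun a => getBit (m a) (p a)) :=
  PS.test_head (fun o => o.getD false) (PS.drop hp hm)

theorem ps_set {b : α → Bool} (hb : PS b) (hm : PS m) (hp : PS p) :
    PS (fun a => (m a).set (p a).length (b a)) := by
  have hd := PS.drop hp hm
  have := PS.ite (PS.test_head Option.isSome hd)
    ((PS.take hp hm).append (hb.cons hd.tail)) hm
  convert this using 2 with a
  rw [List.set_eq_take_append_cons_drop, List.tail_drop]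
  congr 1
  simp

theorem ps_addBit {b : α → Bool} (hb : PS b) (hp : PS p) (hm : PS m) :
    PS (fun a => addBit (b a) (p a) (m a)) :=
  ps_set (PS.map_sym₂ xor (ps_getBit hm hp) hb) hm hp

/-- Readers never lengthen the unread string; this and the next bounds feed the size condition of
`PS.foldl_of_le`. -/
theorem length_rest_le (l : List Bool) : (rest l).length ≤ l.length := by
  simp only [rest, List.length_tail, List.length_drop]
  omega

theorem length_readQubit_le (L Z l : List Bool) : (readQubit L Z l).2.length ≤ l.length := by
  rw [readQubit]
  have h₁ := length_rest_le l
  have h₂ := length_rest_le (rest l)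
  have h₃ := length_rest_le (rest (rest l))
  split_ifs <;> dsimp only <;> omega

theorem length_readControls_le (L Z mem u l : List Bool) :
    (readControls L Z mem u l).2.length ≤ l.length := by
  have key : ∀ (u : List Bool) (t : Bool × List Bool), (u.foldl (fun t _ =>
      (t.1 && getBit mem (readQubit L Z t.2).1, (readQubit L Z t.2).2)) t).2.length ≤
      t.2.length := by
    intro u
    induction u with
    | nil => simp
    | cons x u ih =>
      intro t
      exact (ih _).trans (length_readQubit_le _ _ _)
  exact key u (true, l)

theorem ps_readControls (hL : PS L) (hZ : PS Z) (hm : PS m) (hu : PS u) (hl : PS l) :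
    PS (fun a => readControls (L a) (Z a) (m a) (u a) (l a)) := by
  refine PS.foldl_of_le (F := fun a t (_ : Bool) => (t.1 && getBit (m a)
    (readQubit (L a) (Z a) t.2).1, (readQubit (L a) (Z a) t.2).2)) hu
    ((PS.const true).pair hl) (fun x => ?_) 0 ?_
  · have h := ps_readQubit (hL.comp .fst_) (hZ.comp .fst_)
      (PS.snd_.comp (PS.snd_ (α := α) (β := Bool × List Bool)))
    exact PS.pair (PS.and (.fst .snd_) (ps_getBit (hm.comp .fst_) h.fst)) h.snd
  · intro a s x
    have := length_readQubit_le (L a) (Z a) s.2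
    simp
    omega

theorem ps_gateStep {s : α → List Bool × List Bool} (hL : PS L) (hZ : PS Z) (hs : PS s) :
    PS (fun a => gateStep (L a) (Z a) (s a)) := by
  have h₁ := ps_readControls hL hZ hs.fst (ps_num hs.snd) (ps_rest hs.snd)
  have h₂ := ps_readQubit hL hZ h₁.snd
  exact PS.ite (PS.test_head Option.isNone hs.snd) hs
    (PS.pair (ps_addBit h₁.fst h₂.fst hs.fst) h₂.snd)

theorem ps_run {G : α → List Bool} (hL : PS L) (hZ : PS Z) (hG : PS G) (hm : PS m) :
    PS (fun a => run (L a) (Z a) (G a) (m a)) := by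
  refine PS.fst (PS.foldl_of_le (F := fun a s (_ : Bool) => gateStep (L a) (Z a) s) hG
    (hm.pair hG) (fun x => ps_gateStep (hL.comp .fst_) (hZ.comp .fst_) .snd_) 0 ?_)
  intro a s x
  rw [gateStep]
  split_ifs
  · simp
  · have h₁ := length_readControls_le (L a) (Z a) s.1 (num s.2) (rest s.2)
    have h₂ := length_readQubit_le (L a) (Z a)
      (readControls (L a) (Z a) s.1 (num s.2) (rest s.2)).2
    have h₃ := length_rest_le s.2
    simp [addBit]
    omega

theorem ps_parse (hl : PS l) : PS (fun a => parse (l a)) := by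
  have h₁ := ps_rest hl
  have h₂ := ps_rest h₁
  exact (ps_num hl).pair ((ps_num h₁).pair ((ps_num h₂).pair
    (ps_readQubit (ps_num hl) (ps_num h₁) (ps_rest h₂))))

theorem ps_memLen (hK : PS K) : PS (fun a => memLen (K a)) :=
  ((hK.fst.append hK.snd.fst).append hK.fst).append hK.snd.snd.fst

theorem ps_part {c : α → Bool} (hK : PS K) (hc : PS c) (hm : PS m) :
    PS (fun a => part (K a) (c a) (m a)) :=
  have h := hK.fst.append hK.snd.fst
  PS.ite hc (PS.take hK.fst (PS.drop h hm)) (PS.take h hm)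

theorem ps_clean (hK : PS K) (hm : PS m) : PS (fun a => clean (K a) (m a)) :=
  PS.beqList (PS.take hK.snd.fst (PS.drop hK.fst hm))
    (PS.take hK.snd.fst (PS.drop hK.fst (PS.map _ hm)))

theorem ps_edge (hK : PS K) (hm : PS m) (hp : PS p) : PS (fun a => edge (K a) (m a) (p a)) :=
  have h {m : α → List Bool} (hm : PS m) := ps_run hK.fst hK.snd.fst hK.snd.snd.snd.snd hm
  PS.map_sym₂ or (PS.beqList (h hp) (ps_addBit (PS.const true) hK.snd.snd.snd.fst (h hm)))
    (PS.beqList hp hm)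

theorem ps_round {s : α → List Bool × List Bool × Bool} (hK : PS K) (hs : PS s) :
    PS (fun a => round (K a) (s a)) := by
  have hM := ps_memLen hK
  have hc := PS.test_head (fun o => o.getD false) hs.snd.fst
  have h₁ := PS.take hM hs.snd.fst.tail
  have h₂ := PS.take hM (PS.drop hM hs.snd.fst.tail)
  exact h₂.pair ((PS.drop hM (PS.drop hM hs.snd.fst.tail)).pair
    ((hs.snd.snd.and (PS.beqList (ps_part hK hc h₁) (ps_part hK hc hs.fst))).and
      (ps_edge hK h₂ h₁)))

theorem ps_outcome {s : α → List Bool × List Bool × Bool} (hK : PS K) (hm : PS m) (hs : PS s) :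
    PS (fun a => outcome (K a) (m a) (s a)) :=
  have hc := PS.test_head (fun o => o.getD false) hs.snd.fst
  PS.map_sym not (hs.snd.snd.and (PS.beqList (ps_part hK hc hs.fst) (ps_part hK hc hm)))

theorem ps_matrix {T v : α → List Bool} (hK : PS K) (hT : PS T) (hv : PS v) :
    PS (fun a => matrix (K a) (T a) (v a)) := by
  have hM := ps_memLen hK
  have h₁ := PS.take hM (PS.drop hM hv)
  have h₂ := PS.take hM hv
  refine (ps_clean hK h₂).and (PS.map_sym₂ or (ps_clean hK h₁) (ps_outcome hK h₂ ?_))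
  refine PS.foldl_of_le (F := fun a s (_ : Bool) => round (K a) s) hT
    (h₁.pair ((PS.drop hM (PS.drop hM hv)).pair (PS.const true)))
    (fun x => ps_round (hK.comp .fst_) .snd_) 0 ?_
  intro a s x
  simp [round]
  omega

theorem ps_quantifiers {T : α → List Bool} (hK : PS K) (hT : PS T) :
    PS (fun a => quantifiers (K a) (T a)) := by
  have hM := ps_memLen hK
  obtain ⟨q, hq⟩ := hM.exists_size_le
  refine (hM.map _).append ((hM.map _).append ?_)
  refine PS.foldl_of_le (F := fun a s (_ : Bool) => true :: ((memLen (K a)).map (fun _ => false) ++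
    ((memLen (K a)).map (fun _ => false) ++ s))) hT (PS.constList [true]) (fun x => ?_)
    (2 * q + 1) ?_
  · have h := PS.map (fun _ => false) (hM.comp (PS.fst_ (α := α) (β := List Bool)))
    exact (PS.const true).cons (h.append (h.append .snd_))
  · intro a s x
    have := hq a
    simp at this ⊢
    omega

end PolySpace

end StrCircuit

end

noncomputable section

open Function

/-! ### Correctness of the string programs -/

namespace StrCircuit

open StoqCircuit

theorem num_unaryCode (n : ℕ) (r : List Bool) :
    num (unaryCode n ++ r) = List.replicate n true := by
  induction n with
  | zero => rfl
  | succ n ih =>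
    rw [List.replicate_succ, ← ih]
    rfl

theorem rest_unaryCode (n : ℕ) (r : List Bool) : rest (unaryCode n ++ r) = r := by
  rw [rest, num_unaryCode, unaryCode, List.append_assoc, List.drop_left]
  rfl

variable {l n₀ n₁ : ℕ}

/-- The position of a qubit in the memory. -/
def pos : Qubit 2 l n₀ n₁ → ℕ
  | .inl (j, i) => if j = 0 then i else l + n₀ + i
  | .inr (.inl i) => l + i
  | .inr (.inr i) => l + n₀ + l + i

theorem pos_injective : Injective (pos : Qubit 2 l n₀ n₁ → ℕ) := by
  rintro (⟨j, i⟩ | i | i) (⟨j', i'⟩ | i' | i') h <;> simp only [pos] at h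
  · have : j = j' ∧ i = i' := by
      have := i.2
      have := i'.2
      fin_cases j <;> fin_cases j' <;> simp [Fin.ext_iff] at h ⊢ <;> omega
    rw [this.1, this.2]
  · split_ifs at h <;> omega
  · split_ifs at h <;> omega
  · split_ifs at h <;> omega
  · rw [Fin.ext (a := i) (b := i') (by omega)]
  · omega
  · split_ifs at h <;> omega
  · omega
  · rw [Fin.ext (a := i) (b := i') (by omega)]

theorem pos_lt (q : Qubit 2 l n₀ n₁) : pos q < l + n₀ + l + n₁ := by
  rcases q with ⟨j, i⟩ | i | i <;> simp only [pos]
  · split_ifs <;> omega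
  · omega
  · omega

theorem exists_pos_eq {i : ℕ} (hi : i < l + n₀ + l + n₁) : ∃ q : Qubit 2 l n₀ n₁, pos q = i := by
  by_cases h₁ : i < l
  · exact ⟨.inl (0, ⟨i, h₁⟩), by simp [pos]⟩
  by_cases h₂ : i < l + n₀
  · exact ⟨.inr (.inl ⟨i - l, by omega⟩), by simp only [pos]; omega⟩
  by_cases h₃ : i < l + n₀ + l
  · exact ⟨.inl (1, ⟨i - (l + n₀), by omega⟩), by simp [pos]; omega⟩
  · exact ⟨.inr (.inr ⟨i - (l + n₀ + l), by omega⟩), by simp only [pos]; omega⟩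

theorem readQubit_qubitCode (q : Qubit 2 l n₀ n₁) (r : List Bool) :
    readQubit (List.replicate l true) (List.replicate n₀ true) (qubitCode q ++ r) =
      (List.replicate (pos q) true, r) := by
  rcases q with ⟨j, i⟩ | i | i
  · simp only [qubitCode, readQubit, List.append_assoc, num_unaryCode, rest_unaryCode]
    fin_cases j <;> simp [pos, List.replicate_append_replicate]
  · simp [qubitCode, readQubit, List.append_assoc, num_unaryCode, rest_unaryCode, pos,
      List.replicate_append_replicate]
  · simp [qubitCode, readQubit, List.append_assoc, num_unaryCode, rest_unaryCode, pos,
      List.replicate_append_replicate, List.replicate_succ]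

/-- The basis state that is stored in a memory. -/
def dec (mem : List Bool) (q : Qubit 2 l n₀ n₁) : Bool := mem.getD (pos q) false

theorem dec_injOn {mem mem' : List Bool} (h : mem.length = l + n₀ + l + n₁)
    (h' : mem'.length = l + n₀ + l + n₁)
    (hd : (dec mem : Qubit 2 l n₀ n₁ → Bool) = dec mem') : mem = mem' := by
  refine List.ext_getElem (h.trans h'.symm) fun i hi hi' => ?_
  obtain ⟨q, rfl⟩ := exists_pos_eq (h ▸ hi)
  have := congrFun hd q
  simpa [dec, hi, hi'] using this

theorem exists_dec_eq (b : Qubit 2 l n₀ n₁ → Bool) :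
    ∃ mem : List Bool, mem.length = l + n₀ + l + n₁ ∧ dec mem = b := by
  choose q hq using fun i : Fin (l + n₀ + l + n₁) => exists_pos_eq (l := l) (n₀ := n₀) i.2
  refine ⟨List.ofFn fun i => b (q i), by simp, funext fun p => ?_⟩
  have h := pos_lt p
  have h' : q ⟨pos p, h⟩ = p := pos_injective (hq _)
  simp [dec, h, h']

theorem getBit_replicate (mem : List Bool) (q : Qubit 2 l n₀ n₁) :
    getBit mem (List.replicate (pos q) true) = dec mem q := by
  simp [getBit, dec, List.getD_eq_getElem?_getD]

theorem length_addBit (b : Bool) (p mem : List Bool) :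
    (addBit b p mem).length = mem.length := by
  simp [addBit]

theorem dec_addBit {mem : List Bool} (h : mem.length = l + n₀ + l + n₁) (b : Bool)
    (q : Qubit 2 l n₀ n₁) :
    (dec (addBit b (List.replicate (pos q) true) mem) : Qubit 2 l n₀ n₁ → Bool) =
      update (dec mem) q (xor (dec mem q) b) := by
  funext q'
  have hq := pos_lt q
  rcases eq_or_ne q' q with rfl | hne
  · rw [update_self, dec, addBit, List.length_replicate,
      List.getD_eq_getElem _ _ (by simpa [h] using hq), List.getElem_set_self, getBit_replicate]
  · rw [update_of_ne hne, dec, addBit, List.getD_eq_getElem?_getD, List.getElem?_set_ne,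
      ← List.getD_eq_getElem?_getD, dec]
    rw [List.length_replicate]
    exact fun e => hne (pos_injective e.symm)

theorem exists_unaryCode_append (g : StoqGate (Qubit 2 l n₀ n₁)) :
    ∃ n r, gateCode g = unaryCode n ++ r := by
  cases g
  · exact ⟨_, _, rfl⟩
  · exact ⟨_, _, List.append_assoc _ _ _⟩
  · exact ⟨_, _, by rw [gateCode, List.append_assoc, List.append_assoc]⟩

/-- The leading number of a gate code is its number of controls, so the three gates are treated
alike: the conjunction of the controls is added to the target, and for X the empty conjunction is
`true`. -/
theorem gateStep_gateCode {mem : List Bool} (h : mem.length = l + n₀ + l + n₁)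
    (g : StoqGate (Qubit 2 l n₀ n₁)) (r : List Bool) :
    ∃ mem', gateStep (List.replicate l true) (List.replicate n₀ true) (mem, gateCode g ++ r) =
      (mem', r) ∧ mem'.length = l + n₀ + l + n₁ ∧
      (dec mem' : Qubit 2 l n₀ n₁ → Bool) = g.act (dec mem) := by
  have h₀ : ((gateCode g ++ r).head?.isNone) = false := by
    obtain ⟨n, r', h⟩ := exists_unaryCode_append g
    rw [h]
    cases n <;> rfl
  have hstep : ∀ s : List Bool × List Bool, s.2.head?.isNone = false →
      gateStep (List.replicate l true) (List.replicate n₀ true) s = _ := fun s hs => by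
    rw [gateStep, if_neg (by simp [hs])]
  rw [hstep _ h₀]
  refine ⟨_, Prod.ext rfl ?_, (length_addBit _ _ _).trans h, ?_⟩
  · cases g <;> simp [gateCode, num_unaryCode, rest_unaryCode, List.replicate_succ, readControls,
      readQubit_qubitCode]
  · cases g <;> simp [gateCode, num_unaryCode, rest_unaryCode, List.replicate_succ, readControls,
      readQubit_qubitCode, dec_addBit h, getBit_replicate, StoqGate.act]

theorem gateStep_iterate {n : ℕ} : ∀ (gs : List (StoqGate (Qubit 2 l n₀ n₁))) (mem : List Bool),
    mem.length = l + n₀ + l + n₁ → gs.length ≤ n → ∃ mem',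
      (gateStep (List.replicate l true) (List.replicate n₀ true))^[n]
        (mem, gs.flatMap gateCode) = (mem', []) ∧ mem'.length = l + n₀ + l + n₁ ∧
      (dec mem' : Qubit 2 l n₀ n₁ → Bool) = gs.foldl (fun b g => g.act b) (dec mem) := by
  induction n with
  | zero =>
    rintro (_ | ⟨g, gs⟩) mem h hn
    · exact ⟨mem, rfl, h, rfl⟩
    · simp at hn
  | succ n ih =>
    rintro (_ | ⟨g, gs⟩) mem h hn
    · refine ⟨mem, ?_, h, rfl⟩
      exact iterate_fixed rfl _
    · obtain ⟨mem', h₁, h₂, h₃⟩ := gateStep_gateCode h g (gs.flatMap gateCode)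
      obtain ⟨mem'', h₄, h₅, h₆⟩ := ih gs mem' h₂ (by simpa using hn)
      refine ⟨mem'', ?_, h₅, ?_⟩
      · rw [iterate_succ_apply, List.flatMap_cons, h₁, h₄]
      · rw [h₆, h₃]
        rfl

theorem foldl_eq_iterate {σ : Type} (f : σ → σ) (u : List Bool) (s : σ) :
    u.foldl (fun s _ => f s) s = f^[u.length] s := by
  induction u generalizing s with
  | nil => rfl
  | cons x u ih => rw [List.foldl_cons, ih, List.length_cons, iterate_succ_apply]

variable (C : StoqCircuit 2)

theorem run_gates {mem : List Bool} (h : mem.length = C.proofLen + C.zeros + C.proofLen + C.pluses) :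
    (run (List.replicate C.proofLen true) (List.replicate C.zeros true)
      (C.gates.flatMap gateCode) mem).length = C.proofLen + C.zeros + C.proofLen + C.pluses ∧
    (dec (run (List.replicate C.proofLen true) (List.replicate C.zeros true)
      (C.gates.flatMap gateCode) mem) : C.Q → Bool) = C.act (dec mem) := by
  -- The gate string itself is the clock of `run`. Gate codes are nonempty, so it is long enough,
  -- and surplus steps find an exhausted string and do nothing.
  have hlen : C.gates.length ≤ (C.gates.flatMap gateCode).length := by
    generalize C.gates = gs
    induction gs with
    | nil => simp
    | cons g gs ih =>
      obtain ⟨n, r, h⟩ := exists_unaryCode_append g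
      simp only [List.flatMap_cons, List.length_cons, List.length_append, h, unaryCode,
        List.length_nil]
      omega
  obtain ⟨mem', h₁, h₂, h₃⟩ := gateStep_iterate C.gates mem h hlen
  rw [run, foldl_eq_iterate, h₁]
  exact ⟨h₂, h₃⟩

/-- The parsed form of a circuit. -/
def ctx : Ctx :=
  (List.replicate C.proofLen true, List.replicate C.zeros true, List.replicate C.pluses true,
    List.replicate (pos C.out) true, C.gates.flatMap gateCode)

theorem parse_code : parse C.code = ctx C := by
  simp only [parse, code, List.append_assoc, num_unaryCode, rest_unaryCode, readQubit_qubitCode, ctx]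

theorem length_memLen :
    (memLen (ctx C)).length = C.proofLen + C.zeros + C.proofLen + C.pluses := by
  simp [memLen, ctx]

theorem slice_eq_iff {u v : List Bool} (h : u.length = v.length) (j k : ℕ) :
    (u.drop j).take k = (v.drop j).take k ↔
      ∀ i : Fin k, u.getD (j + i) false = v.getD (j + i) false := by
  constructor
  · intro e i
    have := congrArg (fun l => l.getD i false) e
    simpa [List.getD_eq_getElem?_getD, List.getElem?_take] using this
  · intro e
    refine List.ext_getElem (by simp [h]) fun i hi hi' => ?_
    simp only [List.length_take, List.length_drop] at hi hi'
    have := e ⟨i, by omega⟩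
    simp only [List.getElem_take, List.getElem_drop]
    rwa [List.getD_eq_getElem _ _ (by simp; omega), List.getD_eq_getElem _ _ (by simp; omega)] at this

variable {C} {mem mem' : List Bool}

/-- The order of the memory makes each part a contiguous slice. -/
theorem part_eq_iff (h : mem.length = (memLen (ctx C)).length)
    (h' : mem'.length = (memLen (ctx C)).length) (c : Bool) :
    part (ctx C) c mem = part (ctx C) c mem' ↔ C.Same c (dec mem) (dec mem') := by
  cases c
  · have := slice_eq_iff (h.trans h'.symm) 0 (C.proofLen + C.zeros)
    simp only [List.drop_zero] at this
    simp only [part, ctx, Bool.false_eq_true, if_false, List.length_append, List.length_replicate,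
      this, zero_add]
    constructor
    · intro e
      exact ⟨fun i => by simpa [dec, pos] using e ⟨i, by omega⟩,
        fun i => by simpa [dec, pos] using e ⟨C.proofLen + i, by omega⟩⟩
    · rintro ⟨e₁, e₂⟩ ⟨i, hi⟩
      by_cases hil : i < C.proofLen
      · simpa [dec, pos] using e₁ ⟨i, hil⟩
      · have := e₂ ⟨i - C.proofLen, by omega⟩
        simp only [dec, pos] at this
        rwa [Nat.add_sub_cancel' (by omega)] at this
  · simp only [part, ctx, if_true, List.length_append, List.length_replicate,
      slice_eq_iff (h.trans h'.symm), Same, dec, pos]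
    simp

theorem clean_iff : clean (ctx C) mem = true ↔ C.Clean (dec mem) := by
  have h := slice_eq_iff (u := mem) (v := mem.map fun _ => false) (by simp) C.proofLen C.zeros
  have hf : ∀ i, (mem.map fun _ => false).getD i false = false := by
    simp [List.getD_eq_getElem?_getD]
  rw [clean, decide_eq_true_iff]
  simp only [ctx, List.length_replicate, h, hf]
  rfl

/-- Memories of the right length correspond injectively to basis states, so comparing strings
compares states. -/
theorem edge_iff (h : mem.length = (memLen (ctx C)).length)
    (h' : mem'.length = (memLen (ctx C)).length) :
    edge (ctx C) mem mem' = true ↔ C.Edge (dec mem) (dec mem') := by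
  rw [length_memLen] at h h'
  obtain ⟨h₁, h₂⟩ := run_gates C h
  obtain ⟨h₃, h₄⟩ := run_gates C h'
  have hinj : ∀ {u v : List Bool}, u.length = C.proofLen + C.zeros + C.proofLen + C.pluses →
      v.length = C.proofLen + C.zeros + C.proofLen + C.pluses →
      (u = v ↔ (dec u : C.Q → Bool) = dec v) := fun hu hv =>
    ⟨fun e => by rw [e], fun e => dec_injOn hu hv e⟩
  simp only [edge, Bool.or_eq_true, decide_eq_true_iff, Edge]
  simp only [ctx]
  rw [hinj h₃ ((length_addBit _ _ _).trans h₁), hinj h' h, dec_addBit h₁, h₂, h₄, Bool.xor_true]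

end StrCircuit

end

noncomputable section

open Function

namespace StrCircuit

open StoqCircuit

/-! ### The quantified Boolean formula -/

/-- Reversal lets the matrix read the variables in the order in which they are quantified. -/
theorem qeval_exists_reverse (φ : List Bool → Bool) (n : ℕ) (qs u : List Bool) :
    qeval φ (List.replicate n true ++ qs) u.reverse = true ↔
      ∃ w : List Bool, w.length = n ∧ qeval φ qs (u ++ w).reverse = true := by
  rw [qeval_exists]
  constructor
  · rintro ⟨w, h, e⟩
    exact ⟨w.reverse, by simpa using h, by simpa using e⟩
  · rintro ⟨w, h, e⟩
    exact ⟨w.reverse, by simpa using h, by simpa using e⟩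

theorem qeval_forall_reverse (φ : List Bool → Bool) (n : ℕ) (qs u : List Bool) :
    qeval φ (List.replicate n false ++ qs) u.reverse = true ↔
      ∀ w : List Bool, w.length = n → qeval φ qs (u ++ w).reverse = true := by
  rw [qeval_forall]
  constructor
  · intro e w h
    simpa using e w.reverse (by simpa using h)
  · intro e w h
    simpa using e w.reverse (by simpa using h)

theorem qeval_exists_bit (φ : List Bool → Bool) (qs u : List Bool) :
    qeval φ (true :: qs) u.reverse = true ↔ ∃ c, qeval φ qs (u ++ [c]).reverse = true := by
  simp [qeval]

/-- Used where the matrix is already decided, so that the remaining quantifiers are irrelevant. -/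
theorem qeval_eq_of_forall {φ : List Bool → Bool} {b : Bool} (qs : List Bool) :
    ∀ y, (∀ v, φ (v ++ y) = b) → qeval φ qs y = b := by
  induction qs with
  | nil => exact fun y h => h []
  | cons q qs ih =>
    intro y h
    have hc : ∀ c, qeval φ qs (c :: y) = b := fun c => ih _ fun v => by simpa using h (v ++ [c])
    simp [qeval, hc]

theorem qeval_reverse_eq_of_forall {φ : List Bool → Bool} {b : Bool} (qs u : List Bool)
    (h : ∀ v, φ (u ++ v) = b) : qeval (fun y => φ y.reverse) qs u.reverse = b :=
  qeval_eq_of_forall qs _ fun v => by simpa using h v.reverse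

variable {C : StoqCircuit 2}

theorem forall_dec {p : (C.Q → Bool) → Prop} :
    (∀ b, p b) ↔ ∀ mem : List Bool, mem.length = (memLen (ctx C)).length → p (dec mem) := by
  refine ⟨fun h mem _ => h _, fun h b => ?_⟩
  obtain ⟨mem, hl, rfl⟩ := exists_dec_eq b
  exact h mem (by rwa [length_memLen])

theorem not_forall_der_succ {s w : C.Q → Bool} {t : ℕ} : (¬ ∀ c, C.Der s (t + 1) c w) ↔
    ∃ c, ∀ z' z, C.Same c z' w → C.Edge z z' → ¬ ∀ c', C.Der s t c' z := by
  simp only [Der]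
  push Not
  rfl

theorem round_append {w z z' v : List Bool} {c live : Bool}
    (hz : z.length = (memLen (ctx C)).length) (hz' : z'.length = (memLen (ctx C)).length) :
    round (ctx C) (w, c :: (z' ++ (z ++ v)), live) =
      (z, v, live && decide (part (ctx C) c z' = part (ctx C) c w) && edge (ctx C) z z') := by
  simp only [round, List.tail_cons, List.head?_cons, Option.getD_some, ← hz', List.drop_left,
    List.take_left]
  simp only [hz', ← hz, List.drop_left, List.take_left]

/-- A game in which the existential player denies that all parts of `w` are derived. That player
names a part `c`; the opponent justifies it by `z'` and `z`, and the play continues at `z`. The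
final bit names a part that differs from `s`. The flag `live` records that all justifications were
legal; once it is false, the existential player wins. The hypothesis on `φ` says that the moves `u`
matter only through the current state of the game. -/
theorem qeval_rounds {φ : List Bool → Bool} {s : List Bool}
    (hs : s.length = (memLen (ctx C)).length) (T : List Bool) :
    ∀ (u w : List Bool) (live : Bool), w.length = (memLen (ctx C)).length →
      (∀ v, φ (u ++ v) = outcome (ctx C) s ((round (ctx C))^[T.length] (w, v, live))) →
      (qeval (fun y => φ y.reverse) (roundQuantifiers (ctx C) T) u.reverse = true ↔
        (live = true → ¬ ∀ c, C.Der (dec s) T.length c (dec w))) := by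
  have hq : ∀ T, roundQuantifiers (ctx C) T =
      (fun s => true :: (List.replicate (memLen (ctx C)).length false ++
        (List.replicate (memLen (ctx C)).length false ++ s)))^[T.length] [true] := by
    intro T
    rw [← foldl_eq_iterate, roundQuantifiers, List.map_const']
  rw [hq]
  generalize T.length = t
  induction t with
  | zero =>
    intro u w live hw hφ
    rw [iterate_zero, id, qeval_exists_bit, not_forall]
    have key : ∀ c, qeval (fun y => φ y.reverse) [] (u ++ [c]).reverse = true ↔
        (live = true → ¬ C.Der (dec s) 0 c (dec w)) := by
      intro c
      have ho : outcome (ctx C) s (w, [c], live) =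
          !(live && decide (part (ctx C) c w = part (ctx C) c s)) := rfl
      rw [qeval, List.reverse_reverse, hφ, iterate_zero, id, ho, Der, ← part_eq_iff hw hs]
      cases live <;> simp
    simp only [key]
    cases live <;> simp
  | succ t ih =>
    intro u w live hw hφ
    rw [iterate_succ_apply', qeval_exists_bit]
    simp only [qeval_forall_reverse]
    rw [not_forall_der_succ]
    have key : ∀ c z', z'.length = (memLen (ctx C)).length → ∀ z,
        z.length = (memLen (ctx C)).length → (qeval (fun y => φ y.reverse) _
          (u ++ [c] ++ z' ++ z).reverse = true ↔ _) := fun c z' hz' z hz =>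
      ih (u ++ [c] ++ z' ++ z) z
        (live && decide (part (ctx C) c z' = part (ctx C) c w) && edge (ctx C) z z') hz fun v => by
          rw [← round_append hz hz', ← iterate_succ_apply, ← hφ]
          simp
    constructor
    · rintro ⟨c, h⟩ hl
      refine ⟨c, forall_dec.2 fun z' hz' => forall_dec.2 fun z hz hsame hedge => ?_⟩
      refine (key c z' hz' z hz).1 (h z' hz' z hz) ?_
      rw [hl, (edge_iff hz hz').2 hedge, decide_eq_true ((part_eq_iff hz' hw c).2 hsame)]
      rfl
    · intro h
      by_cases hl : live = true
      · obtain ⟨c, hc⟩ := h hl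
        refine ⟨c, fun z' hz' z hz => (key c z' hz' z hz).2 fun hlive => ?_⟩
        rw [Bool.and_eq_true, Bool.and_eq_true, decide_eq_true_iff] at hlive
        exact hc _ _ ((part_eq_iff hz' hw c).1 hlive.1.2) ((edge_iff hz hz').1 hlive.2)
      -- The opponent has already broken the rules, so any choice of part wins.
      · refine ⟨true, fun z' hz' z hz => (key true z' hz' z hz).2 fun hlive => ?_⟩
        rw [Bool.and_eq_true, Bool.and_eq_true] at hlive
        exact (hl hlive.1.1).elim

/-- The outer quantifiers guess `s` and let the opponent propose an unclean `w`; the rounds then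
dispute whether all parts of `w` are derived from `s`. A clean `w` loses for the opponent at once.
-/
theorem qeval_matrix (T : List Bool) :
    qeval (fun y => matrix (ctx C) T y.reverse) (quantifiers (ctx C) T) [] = true ↔
      ∃ s, C.Clean s ∧ ¬ C.Bad s T.length := by
  rw [quantifiers, List.map_const', List.map_const', ← List.reverse_nil, qeval_exists_reverse]
  simp only [qeval_forall_reverse]
  have key : ∀ s : List Bool, s.length = (memLen (ctx C)).length →
      ((∀ w : List Bool, w.length = (memLen (ctx C)).length →
        qeval (fun y => matrix (ctx C) T y.reverse) (roundQuantifiers (ctx C) T)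
          ([] ++ s ++ w).reverse = true) ↔ C.Clean (dec s) ∧ ¬ C.Bad (dec s) T.length) := by
    intro s hs
    have hφ : ∀ w : List Bool, w.length = (memLen (ctx C)).length → ∀ v,
        matrix (ctx C) T ([] ++ s ++ w ++ v) = (clean (ctx C) s && (clean (ctx C) w ||
          outcome (ctx C) s ((round (ctx C))^[T.length] (w, v, true)))) := by
      intro w hw v
      simp only [matrix, List.nil_append, List.append_assoc]
      simp only [← hs, List.take_left, List.drop_left]
      simp only [hs, ← hw, List.take_left, List.drop_left, foldl_eq_iterate]
    by_cases hc : clean (ctx C) s = true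
    · have hc' := clean_iff.1 hc
      simp only [hc, Bool.true_and] at hφ
      have hb : ¬ C.Bad (dec s) T.length ↔ ∀ w : List Bool, w.length = (memLen (ctx C)).length →
          C.Clean (dec w) ∨ ¬ ∀ c, C.Der (dec s) T.length c (dec w) := by
        rw [Bad, not_exists, forall_dec]
        refine forall₂_congr fun w _ => ?_
        tauto
      rw [hb, and_iff_right hc']
      refine forall₂_congr fun w hw => ?_
      by_cases hcw : clean (ctx C) w = true
      · refine iff_of_true ?_ (.inl (clean_iff.1 hcw))
        exact qeval_reverse_eq_of_forall (φ := matrix (ctx C) T) _ _ fun v => by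
          rw [hφ w hw, hcw, Bool.true_or]
      · rw [or_iff_right fun h => hcw (clean_iff.2 h)]
        have := qeval_rounds (φ := matrix (ctx C) T) hs T ([] ++ s ++ w) w true hw fun v => by
          rw [hφ w hw, Bool.eq_false_iff.2 hcw, Bool.false_or]
        simpa using this
    · refine iff_of_false (fun h => ?_) fun h => hc (clean_iff.2 h.1)
      -- The matrix is false for an unclean `s` whatever `w` is; `s` just serves as a string of the
      -- right length.
      have := h s hs
      rw [qeval_reverse_eq_of_forall (φ := matrix (ctx C) T) (b := false) _ _ fun v => by
        rw [hφ s hs, Bool.eq_false_iff.2 hc, Bool.false_and]] at this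
      cases this
  constructor
  · rintro ⟨s, hs, h⟩
    exact ⟨_, (key s hs).1 h⟩
  · rintro ⟨b, hb⟩
    obtain ⟨s, hs, rfl⟩ := exists_dec_eq b
    rw [← length_memLen] at hs
    exact ⟨s, hs, (key s hs).2 hb⟩

end StrCircuit

end

noncomputable section

open Function RegRep

/-! ### From polynomial-space functions to languages -/

-- The machine loads its input in reverse, so the program for `f` after reversal is run, and then
-- the input registers are cleared.
open Prog in
theorem languageInPSPACE_of_ps {f : List Bool → Bool} (hf : PS f) :
    LanguageInPSPACE {x | f x = true} := by
  obtain ⟨κ, _, _, P, p, h⟩ := hf.comp (PS.reverse .id)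
  refine languageInPSPACE_of_exec (κ := Reg (List Bool) ⊕ Reg Bool ⊕ κ)
    (.seq P (Prog.clear fun r : Reg (List Bool) => .inl r)) (.inl ()) (.inr (.inl ()))
    f p fun x => ?_
  have := h x.reverse
  beta_reduce at this
  rw [size_list, List.length_reverse, List.reverse_reverse] at this
  have hi : update (fun _ => []) (.inl ()) (x.map fun b => if b then 1 else 0).reverse =
      (Sum.elim (enc x.reverse) fun _ => [] : Reg (List Bool) ⊕ Reg Bool ⊕ κ → List ℕ) := by
    funext r
    rcases r with _ | _ | _
    · refine (update_self (Sum.inl ()) _ _).trans ?_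
      rw [← List.map_reverse]
      rfl
    · rfl
    · rfl
  rw [hi]
  refine .seq this (.clear (fun _ => rfl) ?_)
  rintro (r | _ | _) hr
  · exact (hr r rfl).elim
  · rfl
  · rfl

/-- Finitely many exceptional inputs can be hard-wired, whatever their values. -/
theorem PS.ite_mem {α : Type} [RegRep α] {f : List Bool → α} (hf : PS f) (g : List Bool → α)
    (hg : ∀ x, PS fun _ : List Bool => g x) (S : Finset (List Bool)) :
    PS (fun x => if x ∈ S then g x else f x) := by
  classical
  induction S using Finset.induction_on with
  | empty => simpa using hf
  | insert y S _ ih =>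
    convert PS.ite (PS.beqList .id (PS.constList y)) (hg y) ih using 2 with x
    by_cases h : x = y
    · subst h
      simp
    · simp [h]

/-! ### The main theorem -/

namespace StoqCircuit

/-- The number of rounds of the game. -/
def rounds (q : Polynomial ℕ) : Polynomial ℕ := (q + 1) * (2 * q + 1)

/-- The exponent `N` required by `exists_not_bad` is only singly exponential, since `a + 1 ≤ 2 ^ a`
and `3 ^ T ≤ 4 ^ T`; the bases are compared by `2 ≤ exp 1`. -/
theorem exists_clean_not_bad {C : StoqCircuit 2} {ψ : Fin 2 → NonnegState C.proofLen} {ε : ℝ}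
    {a T : ℕ} (hψ : 1 - ε ≤ C.acceptProb ψ) (hl : C.proofLen ≤ a) (hr : C.pluses ≤ a)
    (hε : ε ≤ Real.exp (-Real.exp ((3 + a + 2 * T : ℕ) : ℝ))) : ∃ s, C.Clean s ∧ ¬ C.Bad s T := by
  refine exists_not_bad ψ hψ (hε.trans ?_)
  set N := 4 * ((C.proofLen + 1) * 3 ^ T) + 4 + C.pluses with hN
  have h₁ : N ≤ 2 ^ (3 + a + 2 * T) := by
    have h₂ : a + 1 ≤ 2 ^ a := Nat.lt_two_pow_self
    have h₃ : 3 ^ T ≤ 2 ^ (2 * T) := by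
      rw [pow_mul]
      exact Nat.pow_le_pow_left (by norm_num) T
    have h₄ : (C.proofLen + 1) * 3 ^ T ≤ 2 ^ a * 2 ^ (2 * T) :=
      Nat.mul_le_mul (by omega) h₃
    have h₅ : 2 ^ a ≤ 2 ^ a * 2 ^ (2 * T) := Nat.le_mul_of_pos_right _ (by positivity)
    have h₆ : 2 ^ (3 + a + 2 * T) = 8 * (2 ^ a * 2 ^ (2 * T)) := by ring
    omega
  have h₂ : (2 : ℝ) ^ (3 + a + 2 * T) ≤ Real.exp ((3 + a + 2 * T : ℕ) : ℝ) := by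
    rw [← Real.exp_one_pow]
    exact pow_le_pow_left₀ (by norm_num) (by linarith [Real.add_one_le_exp 1]) _
  have h₃ : (N : ℝ) ≤ Real.exp ((3 + a + 2 * T : ℕ) : ℝ) := le_trans (by exact_mod_cast h₁) h₂
  have h₄ : Real.exp (-1) ≤ 1 / 2 := by
    rw [Real.exp_neg, one_div]
    exact inv_anti₀ (by norm_num) (by linarith [Real.add_one_le_exp 1])
  calc Real.exp (-Real.exp ((3 + a + 2 * T : ℕ) : ℝ)) ≤ Real.exp (N * (-1)) :=
        Real.exp_le_exp.2 (by linarith)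
    _ = Real.exp (-1) ^ N := Real.exp_nat_mul _ _
    _ ≤ (1 / 2) ^ N := pow_le_pow_left₀ (Real.exp_nonneg _) h₄ N

theorem ps_exists_clean {V : List Bool → StoqCircuit 2} (hV : IsPolyTimeVerifier V)
    (T : Polynomial ℕ) : ∃ f : List Bool → Bool, PS f ∧
      ∀ x, f x = true ↔ ∃ s, (V x).Clean s ∧ ¬ (V x).Bad s (T.eval x.length) := by
  obtain ⟨h⟩ := hV
  have hK := StrCircuit.ps_parse (PS.of_polyTime h)
  have hT : PS fun x : List Bool => List.replicate (T.eval x.length) true := .replicate_eval T .id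
  refine ⟨_, PS.qeval (φ := fun x y => StrCircuit.matrix (StrCircuit.parse (V x).code)
    (List.replicate (T.eval x.length) true) y.reverse) (StrCircuit.ps_matrix (hK.comp .fst_)
      (hT.comp .fst_) (PS.reverse .snd_)) (StrCircuit.ps_quantifiers hK hT), fun x => ?_⟩
  rw [StrCircuit.parse_code]
  simpa using StrCircuit.qeval_matrix (C := V x) (List.replicate (T.eval x.length) true)

/-- The code of a circuit has polynomial length and contains both numbers in unary. -/
theorem exists_polynomial_le {V : List Bool → StoqCircuit 2} (hV : IsPolyTimeVerifier V) :
    ∃ b : Polynomial ℕ, ∀ x, (V x).proofLen ≤ b.eval x.length ∧ (V x).pluses ≤ b.eval x.length := by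
  obtain ⟨h⟩ := hV
  obtain ⟨b, hb⟩ := (PS.of_polyTime h).exists_size_le
  refine ⟨b, fun x => ?_⟩
  have := hb x
  simp only [size_list, code, unaryCode, List.length_append, List.length_replicate] at this
  omega

end StoqCircuit

open StoqCircuit in
theorem stoqMAWith_subset_PSPACE {q : Polynomial ℕ} {l r : ℕ → ℕ} {ε s : ℕ → ℝ}
    (hl : ∀ n, l n ≤ q.eval n) (hr : ∀ n, r n ≤ q.eval n)
    (hε : ∀ᶠ n : ℕ in atTop,
      ε n ≤ Real.exp (-Real.exp (((3 + q + 2 * rounds q).eval n : ℕ) : ℝ)))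
    (hs : ∀ᶠ n : ℕ in atTop, s n ≤ 1 - 1 / (((q.eval n : ℕ) : ℝ) + 1)) :
    StoqMAWith 2 l r (fun n => 1 - ε n) s ⊆ PSPACE := by
  classical
  rintro I ⟨-, V, hV, hlen, hyes, hno⟩
  obtain ⟨n₀, hn₀⟩ := eventually_atTop.1 (hε.and hs)
  obtain ⟨f, hf, hfx⟩ := ps_exists_clean hV (rounds q)
  -- The asymptotic hypotheses may fail on these short inputs only, which are answered by a table.
  let S : Finset (List Bool) := (List.finite_length_lt Bool n₀).toFinset
  have hS : ∀ x, x ∉ S ↔ n₀ ≤ x.length := by simp [S]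
  refine ⟨_, languageInPSPACE_of_ps (hf.ite_mem (fun x => decide (x ∈ I.yes))
    (fun x => .const _) S), fun x hx => ?_, Set.disjoint_left.2 fun x hx hx' => ?_⟩
  · by_cases hxS : x ∈ S
    · simp [hxS, hx]
    · obtain ⟨h₁, -⟩ := hn₀ x.length ((hS x).1 hxS)
      obtain ⟨h₃, h₄⟩ := hlen x (.inl hx)
      obtain ⟨ψ, hψ⟩ := hyes x hx
      simp only [hxS, Set.mem_ofPred_eq, if_false, hfx]
      refine exists_clean_not_bad hψ (h₃.le.trans (hl _)) (h₄.trans (hr _)) ?_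
      simpa using h₁
  · by_cases hxS : x ∈ S
    · have : x ∈ I.yes := by simpa [hxS] using hx'
      exact Set.disjoint_left.1 I.disj this hx
    · obtain ⟨-, h₂⟩ := hn₀ x.length ((hS x).1 hxS)
      obtain ⟨h₃, -⟩ := hlen x (.inr hx)
      simp only [hxS, Set.mem_ofPred_eq, if_false, hfx] at hx'
      obtain ⟨b, hb, hbad⟩ := hx'
      -- With `Q = q + 1`, the rejection gap is `1 / Q`, and `rounds q` is at least `Q * (2 *
      -- C.proofLen + 1)`.
      refine hbad (bad_of_acceptProb_le hb (Q := q.eval x.length + 1) (Nat.succ_pos _)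
        (fun ψ => ?_) ?_)
      · push_cast
        exact (hno x hx ψ).trans h₂
      · have := h₃.le.trans (hl _)
        simp only [rounds, Polynomial.eval_mul, Polynomial.eval_add, Polynomial.eval_one,
          Polynomial.eval_ofNat]
        gcongr

theorem stoqMA_subset_PSPACE {ε s : ℕ → ℝ}
    (hε : ∀ p : Polynomial ℕ, ∀ᶠ n : ℕ in atTop,
      ε n ≤ Real.exp (-Real.exp ((p.eval n : ℕ) : ℝ)))
    (hs : ∃ q : Polynomial ℕ, ∀ᶠ n : ℕ in atTop, s n ≤ 1 - 1 / (((q.eval n : ℕ) : ℝ) + 1)) :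
    StoqMA 2 (fun n => 1 - ε n) s ⊆ PSPACE := by
  rintro I ⟨l, r, hI, V, hV, hlen, hI'⟩
  obtain ⟨q, hq⟩ := hs
  obtain ⟨b, hb⟩ := StoqCircuit.exists_polynomial_le hV
  -- The given `l` and `r` need not be polynomially bounded where the promise contains no input of
  -- that length; cutting them off at `q + b` changes nothing on the promise. Enlarging `q` only
  -- weakens the soundness hypothesis.
  refine stoqMAWith_subset_PSPACE (q := q + b) (l := fun n => min (l n) ((q + b).eval n))
    (r := fun n => min (r n) ((q + b).eval n)) (fun n => min_le_right _ _)
    (fun n => min_le_right _ _) (hε _) (hq.mono fun n hn => hn.trans ?_)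
    ⟨hI, V, hV, fun x hx => ?_, hI'⟩
  · rw [Polynomial.eval_add]
    push_cast
    have : (0 : ℝ) ≤ b.eval n := Nat.cast_nonneg _
    gcongr
    linarith
  · obtain ⟨h₁, h₂⟩ := hlen x hx
    obtain ⟨h₃, h₄⟩ := hb x
    simp only [Polynomial.eval_add]
    constructor <;> omega

theorem mainTheorem4 :
    (∀ q : Polynomial ℕ, ∃ p : Polynomial ℕ, ∀ (l r : ℕ → ℕ) (ε s : ℕ → ℝ),
      (∀ n, l n ≤ q.eval n) → (∀ n, r n ≤ q.eval n) →
      (∀ n, 0 ≤ ε n) →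
      (∀ᶠ n : ℕ in atTop, ε n ≤ Real.exp (-Real.exp ((p.eval n : ℕ) : ℝ))) →
      (∀ n, 1 / 2 ≤ s n) →
      (∀ᶠ n : ℕ in atTop, s n ≤ 1 - 1 / (((q.eval n : ℕ) : ℝ) + 1)) →
      StoqMAWith 2 l r (fun n => 1 - ε n) s ⊆ PSPACE) ∧
    (∀ ε s : ℕ → ℝ,
      (∀ n, 0 ≤ ε n) →
      (∀ p : Polynomial ℕ, ∀ᶠ n : ℕ in atTop, ε n ≤ Real.exp (-Real.exp ((p.eval n : ℕ) : ℝ))) →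
      (∀ n, 1 / 2 ≤ s n) →
      (∃ q : Polynomial ℕ, ∀ᶠ n : ℕ in atTop, s n ≤ 1 - 1 / (((q.eval n : ℕ) : ℝ) + 1)) →
      StoqMA 2 (fun n => 1 - ε n) s ⊆ PSPACE) ∧
    StoqMAPerfect 2 ⊆ PSPACE := by
  refine ⟨fun q => ⟨_, fun l r ε s hl hr _ hε _ hs => stoqMAWith_subset_PSPACE hl hr hε hs⟩,
    fun ε s _ hε _ hs => stoqMA_subset_PSPACE hε hs, ?_⟩
  rintro I ⟨s, hI⟩
  obtain ⟨l, r, ⟨-, g, hg⟩, -⟩ := id hI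
  -- With completeness one, the gap polynomial `g` of the thresholds directly bounds `s` away from
  -- one.
  refine stoqMA_subset_PSPACE (ε := fun _ => 0) (s := s) (fun p => .of_forall fun n => ?_)
    ⟨g, .of_forall fun n => ?_⟩ (by simpa using hI)
  · exact (Real.exp_pos _).le
  · linarith [hg n]

end
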